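/- Let $L$ be an algebraically closed field and let $V\subseteq\mathbb P^N(L)$ be a smooth irreducible projective variety of dimension $m$ (that is, $V$ is the zero set of homogeneous polynomials over $L$, its homogeneous ideal is prime, its function field has transcendence degree $m$ over $L$, and the Zariski tangent space at each point has dimension $m$). For each $n\ge 0$ give $V^n$ the Zariski topology, whose closed sets are the subsets of $V^n\subseteq(\mathbb P^N)^n$ cut out by multihomogeneous polynomials with coefficients in $L$. For a closed set $C$ let $\dim C$ be the supremum of the $k$ for which there is a chain $C_0\subsetneq C_1\subsetneq\dots\subsetneq C_k$ of irreducible closed subsets of $C$ (with $\dim\emptyset=-\infty$). For $C\subseteq V^{n+r}=V^n\times V^r$ let $\mathrm{pr}(C)\subseteq V^n$ be its projection, and for $a\in V^n$ let $C(a)=\{b\in V^r:(a,b)\in C\}$. Then $V$ with these topologies is an irreducible Zariski structure of dimension $m$. That is, $V$ is irreducible, $\dim V=m$, and for all $n,r\ge0$: - (L) the diagonal of $V^n\times V^n$ is closed, points of $V$ are closed, and products of closed sets are closed; - (P) the projections $V^{n+1}\to V^n$ that omit one coordinate are continuous and map closed sets to closed sets; - (DCC) $V^n$ is a Noetherian topological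 space; - (DIM) $\dim C$ is finite or $-\infty$ for every closed $C\subseteq V^n$; - (PS) if $C_1,C_2\subseteq V^n$ are closed and irreducible and $C_1\cap C_2\neq\emptyset$, then every irreducible component $W$ of $C_1\cap C_2$ satisfies $\dim W\ge\dim C_1+\dim C_2-\dim V^n$; - (DF) if $C\subseteq V^{n+r}$ is closed, then $\{a\in V^n:\dim C(a)>k\}$ is closed for every integer $k\ge0$; - (GF) if $C\subseteq V^{n+r}$ is closed and irreducible, then $\dim C=\dim \mathrm{pr}(C)+\min_{a\in \mathrm{pr}(C)}\dim C(a)$. -/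

import Mathlib

open scoped LinearAlgebra.Projectivization

noncomputable section

namespace ZariskiGeometry

/-! ## Zariski structures

`M` is a set, and each Cartesian power `M^n`, realised as `Fin n → M`, carries a topology.
The set `M` itself is identified with `M^1`. The topology on `M^n` is a datum; it is not the
product topology. -/

section Structures

/-- The dimension of a (closed) subset of a topological space: the supremum of the lengths `k` of
strictly increasing chains `C₀ ⊂ C₁ ⊂ ⋯ ⊂ C_k` of irreducible closed subsets of it. The dimension
of the empty set is `⊥`. For an irreducible closed `C` one may always take `C_k = C`, and in
general this is the maximum of the dimensions of the irreducible components. -/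
def dim {X : Type*} [TopologicalSpace X] (C : Set X) : WithBot ℕ∞ :=
  topologicalKrullDim C

/-- `W` is an irreducible component of the closed set `C`: it is maximal among the irreducible
closed sets contained in `C`. -/
def IsComponent {X : Type*} [TopologicalSpace X] (W C : Set X) : Prop :=
  Maximal (fun Z : Set X => IsClosed Z ∧ IsIrreducible Z ∧ Z ⊆ C) W

/-- The projection of `M^(n+m)` onto its first `n` factors. -/
def fstProj {M : Type*} (n m : ℕ) (x : Fin (n + m) → M) : Fin n → M :=
  fun i => x (Fin.castAdd m i)

/-- The projection of `M^(n+m)` onto its last `m` factors. -/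
def sndProj {M : Type*} (n m : ℕ) (x : Fin (n + m) → M) : Fin m → M :=
  fun i => x (Fin.natAdd n i)

/-- The fibre `C(a) = {b ∈ M^m : (a, b) ∈ C}` of `C ⊆ M^(n+m)` over `a ∈ M^n`. -/
def fibre {M : Type*} {n m : ℕ} (C : Set (Fin (n + m) → M)) (a : Fin n → M) :
    Set (Fin m → M) :=
  {b | Fin.append a b ∈ C}

/-- The axioms of a Zariski structure on `M`, for given topologies on the powers of `M`. -/
structure IsZariskiStructure (M : Type*) [τ : ∀ n : ℕ, TopologicalSpace (Fin n → M)] : Prop where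
  /-- (L) The diagonals in `M^n × M^n` are closed. -/
  isClosed_diagonal : ∀ n : ℕ, IsClosed {x : Fin (n + n) → M | fstProj n n x = sndProj n n x}
  /-- (L) Singletons are closed. -/
  isClosed_singleton : ∀ a : Fin 1 → M, IsClosed {a}
  /-- (L) Cartesian products of closed sets are closed. -/
  isClosed_prod : ∀ (n m : ℕ) (C : Set (Fin n → M)) (D : Set (Fin m → M)),
    IsClosed C → IsClosed D →
      IsClosed {x : Fin (n + m) → M | fstProj n m x ∈ C ∧ sndProj n m x ∈ D}
  /-- (P) The projections `M^(n+1) → M^n` (omitting any one coordinate) are continuous. -/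
  continuous_proj : ∀ (n : ℕ) (i : Fin (n + 1)),
    Continuous (fun (x : Fin (n + 1) → M) (j : Fin n) => x (i.succAbove j))
  /-- (P) The projections `M^(n+1) → M^n` (omitting any one coordinate) are closed maps. -/
  isClosedMap_proj : ∀ (n : ℕ) (i : Fin (n + 1)),
    IsClosedMap (fun (x : Fin (n + 1) → M) (j : Fin n) => x (i.succAbove j))
  /-- (DCC) Every power of `M` is a Noetherian space. -/
  noetherian : ∀ n : ℕ, TopologicalSpace.NoetherianSpace (Fin n → M)
  /-- (DIM) The dimension of closed sets is well defined: the lengths of the chains of irreducible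
  closed subsets of a closed set are bounded, so that their supremum is a maximum. -/
  dim_lt_top : ∀ (n : ℕ) (C : Set (Fin n → M)), IsClosed C → dim C < ⊤
  /-- (PS) Pre-smoothness: every component of the intersection of two irreducible closed sets
  `C₁`, `C₂` that meet has dimension at least `dim C₁ + dim C₂ - dim M^n`. -/
  presmooth : ∀ (n : ℕ) (C₁ C₂ : Set (Fin n → M)),
    IsClosed C₁ → IsIrreducible C₁ → IsClosed C₂ → IsIrreducible C₂ → (C₁ ∩ C₂).Nonempty →
      ∀ W : Set (Fin n → M), IsComponent W (C₁ ∩ C₂) →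
        dim C₁ + dim C₂ ≤ dim W + dim (Set.univ : Set (Fin n → M))
  /-- (DF) Definability of fibre dimension. -/
  isClosed_fibre : ∀ (n m : ℕ) (C : Set (Fin (n + m) → M)), IsClosed C →
    ∀ k : ℕ, IsClosed {a : Fin n → M | (k : WithBot ℕ∞) < dim (fibre C a)}
  /-- (GF) Generic fibres: `dim C = dim pr(C) + min_{a ∈ pr(C)} dim C(a)` for `C` irreducible. -/
  generic_fibre : ∀ (n m : ℕ) (C : Set (Fin (n + m) → M)), IsClosed C → IsIrreducible C →
    ∃ d : WithBot ℕ∞,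
      IsLeast ((fun a : Fin n → M => dim (fibre C a)) '' (fstProj n m '' C)) d ∧
        dim C = dim (fstProj n m '' C) + d

/-- `M` is an irreducible Zariski structure of dimension `d`. -/
structure IsIrreducibleZariskiStructure (M : Type*) [τ : ∀ n : ℕ, TopologicalSpace (Fin n → M)]
    (d : ℕ) : Prop extends IsZariskiStructure M where
  irreducible : IsIrreducible (Set.univ : Set (Fin 1 → M))
  dim_eq : dim (Set.univ : Set (Fin 1 → M)) = (d : WithBot ℕ∞)

end Structures

/-! ## Projective varieties over a field `L` -/

section Varieties

variable {L : Type*} [Field L] {N : ℕ}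

/-- A polynomial in `n` groups of `N + 1` variables is multihomogeneous of multidegree `d` if, for
each `i`, all its monomials have degree `d i` in the `i`-th group of variables. -/
def IsMultihomogeneous {n : ℕ} (f : MvPolynomial (Fin n × Fin (N + 1)) L) (d : Fin n → ℕ) : Prop :=
  MvPolynomial.IsWeightedHomogeneous
    (fun p : Fin n × Fin (N + 1) => (Pi.single p.1 1 : Fin n → ℕ)) f d

/-- The value of a polynomial in `n` groups of variables at (representatives of) an `n`-tuple of
points of projective space. For multihomogeneous polynomials, whether it vanishes does not depend
on the representatives. -/
def evalTuple {n : ℕ} (x : Fin n → ℙ L (Fin (N + 1) → L))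
    (f : MvPolynomial (Fin n × Fin (N + 1)) L) : L :=
  MvPolynomial.eval (fun p : Fin n × Fin (N + 1) => (x p.1).rep p.2) f

/-- The common zero set in `(ℙ^N)^n` of a set of polynomials. -/
def multiZeroLocus {n : ℕ} (S : Set (MvPolynomial (Fin n × Fin (N + 1)) L)) :
    Set (Fin n → ℙ L (Fin (N + 1) → L)) :=
  {x | ∀ f ∈ S, evalTuple x f = 0}

variable (L N) in
/-- The Zariski topology on `(ℙ^N(L))^n`: the closed sets are the common zero sets of sets of
multihomogeneous polynomials with coefficients in `L`. -/
@[reducible]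
def zariskiTopology (n : ℕ) : TopologicalSpace (Fin n → ℙ L (Fin (N + 1) → L)) :=
  TopologicalSpace.ofClosed
    {C | ∃ S : Set (MvPolynomial (Fin n × Fin (N + 1)) L),
      (∀ f ∈ S, ∃ d, IsMultihomogeneous f d) ∧ C = multiZeroLocus S}
    (by
      refine ⟨{1}, ?_, ?_⟩
      · rintro f rfl
        exact ⟨0, MvPolynomial.isWeightedHomogeneous_one L _⟩
      · ext x
        simp [multiZeroLocus, evalTuple])
    (by
      intro A hA
      choose! S hS hAS using fun C (hC : C ∈ A) => hA hC
      refine ⟨⋃ C ∈ A, S C, ?_, ?_⟩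
      · intro f hf
        simp only [Set.mem_iUnion] at hf
        obtain ⟨C, hC, hf⟩ := hf
        exact hS C hC f hf
      · ext x
        simp only [Set.mem_sInter, multiZeroLocus, Set.mem_iUnion, Set.mem_ofPred_eq]
        constructor
        · rintro h f ⟨C, hC, hf⟩
          have h1 := h C hC
          rw [hAS C hC] at h1
          exact h1 f hf
        · intro h C hC
          rw [hAS C hC]
          exact fun f hf => h f ⟨C, hC, hf⟩)
    (by
      rintro _ ⟨S, hS, rfl⟩ _ ⟨T, hT, rfl⟩
      refine ⟨{h | ∃ f ∈ S, ∃ g ∈ T, h = f * g}, ?_, ?_⟩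
      · rintro _ ⟨f, hf, g, hg, rfl⟩
        obtain ⟨d, hd⟩ := hS f hf
        obtain ⟨e, he⟩ := hT g hg
        exact ⟨d + e, MvPolynomial.IsWeightedHomogeneous.mul hd he⟩
      · ext x
        constructor
        · rintro (h | h) _ ⟨f, hf, g, hg, rfl⟩
          · have h1 : MvPolynomial.eval _ f = 0 := h f hf
            simp [evalTuple, h1]
          · have h1 : MvPolynomial.eval _ g = 0 := h g hg
            simp [evalTuple, h1]
        · intro h
          by_contra hx
          simp only [Set.mem_union, not_or, multiZeroLocus, Set.mem_ofPred_eq, not_forall] at hx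
          obtain ⟨⟨f, hf, hf0⟩, g, hg, hg0⟩ := hx
          have h1 := h (f * g) ⟨f, hf, g, hg, rfl⟩
          rw [evalTuple, map_mul] at h1
          exact (mul_ne_zero hf0 hg0) h1)

/-- The Zariski topology on `V^n`, for `V ⊆ ℙ^N(L)`: the closed sets are the subsets cut out on
`V^n ⊆ (ℙ^N)^n` by multihomogeneous polynomials over `L`. -/
@[reducible]
def powerTopology (V : Set (ℙ L (Fin (N + 1) → L))) (n : ℕ) : TopologicalSpace (Fin n → V) :=
  (zariskiTopology L N n).induced (fun x i => (x i : ℙ L (Fin (N + 1) → L)))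

/-- The (punctured) affine cone over `V ⊆ ℙ^N(L)`. -/
def cone (V : Set (ℙ L (Fin (N + 1) → L))) : Set (Fin (N + 1) → L) :=
  {v | ∃ hv : v ≠ 0, Projectivization.mk L v hv ∈ V}

/-- The homogeneous ideal `I(V)` of `V ⊆ ℙ^N(L)`, consisting of all the polynomials that vanish on
the affine cone over `V`. -/
def idealOf (V : Set (ℙ L (Fin (N + 1) → L))) : Ideal (MvPolynomial (Fin (N + 1)) L) :=
  MvPolynomial.vanishingIdeal L (cone V)

/-- The homogeneous coordinate ring `L[x₀, …, x_N] / I(V)`. -/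
abbrev CoordRing (V : Set (ℙ L (Fin (N + 1) → L))) : Type _ :=
  MvPolynomial (Fin (N + 1)) L ⧸ idealOf V

/-- The function field `L(V)` of an irreducible `V ⊆ ℙ^N(L)`: the fractions `a / b` with `a`, `b`
homogeneous of the same degree, `b ∉ I(V)`, in the fraction field of the homogeneous coordinate
ring (these fractions already form a subfield). -/
def functionField (V : Set (ℙ L (Fin (N + 1) → L))) :
    Subalgebra L (FractionRing (CoordRing V)) :=
  Algebra.adjoin L
    {z | ∃ (d : ℕ) (a b : MvPolynomial (Fin (N + 1)) L), a.IsHomogeneous d ∧ b.IsHomogeneous d ∧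
      b ∉ idealOf V ∧
      z * algebraMap (CoordRing V) _ (Ideal.Quotient.mk (idealOf V) b) =
        algebraMap (CoordRing V) _ (Ideal.Quotient.mk (idealOf V) a)}

/-- The Zariski tangent space to the affine cone over `V` at `v`: the common kernel of the
differentials at `v` of the elements of `I(V)`. At a representative `v` of a point `P` of `V`, its
quotient by the line spanned by `v` is the Zariski tangent space to `V` at `P`, up to a twist. -/
def coneTangentSpace (V : Set (ℙ L (Fin (N + 1) → L))) (v : Fin (N + 1) → L) :
    Submodule L (Fin (N + 1) → L) where
  carrier := {w | ∀ f ∈ idealOf V,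
    ∑ i, MvPolynomial.eval v (MvPolynomial.pderiv i f) * w i = 0}
  zero_mem' := by
    intro f _
    simp
  add_mem' := by
    intro w w' hw hw' f hf
    simp [mul_add, Finset.sum_add_distrib, hw f hf, hw' f hf]
  smul_mem' := by
    intro c w hw f hf
    have h := congrArg (fun t => c * t) (hw f hf)
    simp only [Finset.mul_sum, mul_zero] at h
    simp only [Pi.smul_apply, smul_eq_mul]
    rw [← h]
    exact Finset.sum_congr rfl fun i _ => by ring

/-- `V ⊆ ℙ^N(L)` is a smooth (irreducible) projective variety of dimension `m` (used for `L`
algebraically closed). -/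
structure IsSmoothProjectiveVariety (V : Set (ℙ L (Fin (N + 1) → L))) (m : ℕ) : Prop where
  /-- `V` is the common zero set of a set of homogeneous polynomials. -/
  algebraic : ∃ S : Set (MvPolynomial (Fin (N + 1)) L),
    (∀ f ∈ S, ∃ d : ℕ, f.IsHomogeneous d) ∧ V = {P | ∀ f ∈ S, MvPolynomial.eval P.rep f = 0}
  /-- `V` is irreducible: its homogeneous ideal is prime. -/
  irreducible : (idealOf V).IsPrime
  /-- `V` has dimension `m`: the function field has transcendence degree `m` over `L`. -/
  trdeg_eq : Algebra.trdeg L (functionField V) = m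
  /-- `V` is smooth: its Zariski tangent space at every point has dimension `m`, so that the
  tangent space to the cone has dimension `m + 1`. -/
  smooth : ∀ P ∈ V, Module.finrank L (coneTangentSpace V P.rep) = m + 1

end Varieties

end ZariskiGeometry

end

open scoped LinearAlgebra.Projectivization

noncomputable section

namespace ZariskiGeometry

/-! ## Transcendence degrees of quotients of finitely generated domains -/

section CommutativeAlgebra

universe u

/-! A closed subset `C` of a product of `n` projective spaces is studied through its multicone, the
set of all tuples of representatives of its points. Its vanishing ideal `coneIdeal C` is prime when
`C` is irreducible, and the Nullstellensatz recovers irreducible sets from suitable primes.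
Transcendence degrees of quotients by these primes drop strictly along inclusions, and by at most
one in a hypersurface section (principal ideal theorem, proved by Noether normalization). Since a
point has a multicone of dimension `n`, it follows that the chain dimension of an irreducible closed
`C` is the transcendence degree of its multicone minus `n` (`exists_natCast_eq_dim`).

Closedness of projections is elimination theory. It also yields that a positive-dimensional
irreducible closed set meets every hypersurface of multidegree `(1, …, 1)`
(`inter_hypersurface_nonempty`). Since general forms cut the dimension down, `k ≤ dim C` holds
exactly when any `k` such forms have a common zero on `C`. This criterion is compatible with
projection: it exhibits the locus of large fibres as an intersection of projections of closed sets,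
which is (DF). For (GF), forms in the fibre coordinates bound `dim C` from below, and forms on the
base isolating a point bound it from above.

For (PS), intersect `C₁ × C₂` with the diagonal. Smoothness makes the diagonal of `V × V` locally
the zero set of `m` equations (`exists_local_equations`, from a first-order expansion with an
invertible matrix), so that of `V^n × V^n` is locally cut out by `nm` equations. A component
therefore loses at most `nm = dim V^n` dimensions.

Finally, the coordinate ring has transcendence degree one more than the function field
(`trdeg_coordRing_eq`), so `dim V = m`; everything is transported along the closed embedding of
`V^n` in `(ℙ^N)^n`. -/

/-- If `b = f * a` in an integral extension of an integrally closed domain, with `b` in the base,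
then the constant coefficient of the minimal polynomial of `f` divides a power of `b`. -/
theorem minpoly_coeff_zero_dvd_pow {B A : Type*} [CommRing B] [IsDomain B] [IsIntegrallyClosed B]
    [CommRing A] [IsDomain A] [Algebra B A] [FaithfulSMul B A] [Algebra.IsIntegral B A]
    {f a : A} {b : B} (h : algebraMap B A b = f * a) :
    ∃ e : ℕ, (minpoly B f).coeff 0 ∣ b ^ e := by
  obtain ⟨p, hp, hpa⟩ := Algebra.IsIntegral.isIntegral (R := B) a
  set e := p.natDegree with he
  -- With `p` monic of degree `e` and `p(a) = 0`, this is the polynomial for which `q(f) = f ^ e *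
  -- p(a) = 0`. Its constant term is `b ^ e`, and integral closedness makes the minimal polynomial
  -- of `f` divide it.
  let q : Polynomial B := ∑ i ∈ Finset.range (e + 1),
    Polynomial.C (p.coeff i * b ^ i) * Polynomial.X ^ (e - i)
  have hq : Polynomial.aeval f q = 0 := by
    have h1 : Polynomial.aeval f q = f ^ e * Polynomial.aeval a p := by
      rw [Polynomial.aeval_eq_sum_range (p := p), Finset.mul_sum, map_sum]
      refine Finset.sum_congr rfl fun i hi => ?_
      have hie : i ≤ e := Nat.lt_succ_iff.mp (Finset.mem_range.mp hi)
      simp only [map_mul, Polynomial.aeval_C, map_pow, Polynomial.aeval_X, h, Algebra.smul_def]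
      rw [show f ^ e = f ^ (e - i) * f ^ i by rw [← pow_add, Nat.sub_add_cancel hie]]
      ring
    rw [h1, Polynomial.aeval_def, hpa, mul_zero]
  refine ⟨e, ?_⟩
  obtain ⟨r, hr⟩ := minpoly.isIntegrallyClosed_dvd (Algebra.IsIntegral.isIntegral (R := B) f) hq
  have h0 : q.coeff 0 = b ^ e := by
    simp only [q, Polynomial.finsetSum_coeff, Polynomial.coeff_C_mul, Polynomial.coeff_X_pow]
    rw [Finset.sum_eq_single e]
    · simp [he, hp.coeff_natDegree]
    · intro i hi hie
      have : i < e := lt_of_le_of_ne (Nat.lt_succ_iff.mp (Finset.mem_range.mp hi)) hie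
      rw [if_neg (by omega), mul_zero]
    · simp
  rw [← h0, hr, Polynomial.mul_coeff_zero]
  exact dvd_mul_right _ _

/-- The constant coefficient serves as a substitute for the norm of `f`. It is nonzero because `f`
divides a nonzero element of `B`, a power of which the coefficient divides. -/
theorem minpoly_coeff_zero_ne_zero {B A : Type*} [CommRing B] [IsDomain B] [IsIntegrallyClosed B]
    [CommRing A] [IsDomain A] [Algebra B A] [FaithfulSMul B A] [Algebra.IsIntegral B A]
    {f : A} (hf : f ≠ 0) : (minpoly B f).coeff 0 ≠ 0 := by
  obtain ⟨r, hr, a, ha⟩ := (Algebra.IsIntegral.isIntegral (R := B) f).isAlgebraic.exists_nonzero_dvd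
    (mem_nonZeroDivisors_of_ne_zero hf)
  obtain ⟨e, he⟩ := minpoly_coeff_zero_dvd_pow ha
  exact ne_zero_of_dvd_ne_zero (pow_ne_zero e hr) he

theorem minpoly_coeff_zero_mem_span {B A : Type*} [CommRing B] [IsDomain B] [CommRing A]
    [Algebra B A] (f : A) :
    algebraMap B A ((minpoly B f).coeff 0) ∈ Ideal.span {f} := by
  have h := minpoly.aeval B f
  rw [← Polynomial.divX_mul_X_add (minpoly B f)] at h
  simp only [map_add, map_mul, Polynomial.aeval_X, Polynomial.aeval_C] at h
  rw [Ideal.mem_span_singleton]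
  refine ⟨-Polynomial.aeval f (minpoly B f).divX, ?_⟩
  linear_combination h

/-- A nonconstant polynomial that divides a power of `p` involves only variables of `p`. -/
theorem eq_zero_of_dvd_pow_rename {k σ : Type*} [Field k] {g : MvPolynomial σ k} {j : σ}
    (hj : g.degreeOf j ≠ 0) {p : MvPolynomial {i // i ≠ j} k} {e : ℕ}
    (h : g ∣ (MvPolynomial.rename Subtype.val p) ^ e) : p = 0 := by
  classical
  by_contra hp
  obtain ⟨r, hr⟩ := h
  have hp' : MvPolynomial.rename (Subtype.val : {i // i ≠ j} → σ) p ≠ 0 := fun h0 =>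
    hp (MvPolynomial.rename_injective _ Subtype.val_injective (by simpa using h0))
  -- The degree in `X_j` is additive on products and vanishes on powers of the renamed `p`, whereas
  -- it is positive on `g`.
  have hdeg : (MvPolynomial.rename (Subtype.val : {i // i ≠ j} → σ) p).degreeOf j = 0 := by
    rw [← Nat.le_zero, MvPolynomial.degreeOf_le_iff]
    intro m hm
    have := MvPolynomial.coeff_rename_ne_zero (Subtype.val : {i // i ≠ j} → σ) p m
      (MvPolynomial.mem_support_iff.mp hm)
    obtain ⟨u, rfl, -⟩ := this
    rw [Finsupp.mapDomain_of_notMem_range]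
    rintro ⟨i, hi⟩
    exact i.2 hi
  have hne : g * r ≠ 0 := hr ▸ pow_ne_zero e hp'
  have h1 := MvPolynomial.degreeOf_mul_eq (n := j) (left_ne_zero_of_mul hne)
    (right_ne_zero_of_mul hne)
  rw [← hr, MvPolynomial.degreeOf_pow_eq _ _ _ hp', hdeg] at h1
  omega

theorem exists_degreeOf_ne_zero {k σ : Type*} [Field k] {g : MvPolynomial σ k} (h0 : g ≠ 0)
    (hu : ¬ IsUnit g) : ∃ j, g.degreeOf j ≠ 0 := by
  by_contra! h
  have : g.totalDegree = 0 := by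
    rw [MvPolynomial.totalDegree_eq_zero_iff]
    intro m hm i
    exact Nat.le_zero.mp (MvPolynomial.degreeOf_le_iff.mp (h i).le m hm)
  rw [MvPolynomial.totalDegree_eq_zero_iff_eq_C] at this
  apply hu
  rw [this]
  refine (IsUnit.mk0 _ fun h1 => h0 ?_).map MvPolynomial.C
  rw [this, h1, map_zero]

/-- The principal ideal theorem for transcendence degrees, when `Q` is the radical of `(f)`. -/
theorem trdeg_le_trdeg_quotient_add_one_of_radical {k A : Type u} [Field k] [CommRing A]
    [IsDomain A] [Algebra k A] [Algebra.FiniteType k A] {f : A} (hf : f ≠ 0) (Q : Ideal A)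
    [Q.IsPrime] (hQ : Q = (Ideal.span {f}).radical) :
    Algebra.trdeg k A ≤ Algebra.trdeg k (A ⧸ Q) + 1 := by
  classical
  obtain ⟨s, g, hinj, hint⟩ := exists_integral_inj_algHom_of_fg k A
  algebraize [g.toRingHom]
  have : IsScalarTower k (MvPolynomial (Fin s) k) A := IsScalarTower.of_algebraMap_eq' (by
    ext x; simp [RingHom.algebraMap_toAlgebra])
  have : FaithfulSMul (MvPolynomial (Fin s) k) A :=
    (faithfulSMul_iff_algebraMap_injective _ _).mpr hinj
  have : Algebra.IsIntegral (MvPolynomial (Fin s) k) A := ⟨hint⟩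
  have hgA : ∀ x, algebraMap (MvPolynomial (Fin s) k) A x = g x := fun x => rfl
  set f0 := (minpoly (MvPolynomial (Fin s) k) f).coeff 0 with hf0
  have hfQ : Ideal.span {f} ≤ Q := hQ ▸ Ideal.le_radical
  have hf0Q : g f0 ∈ Q := hfQ (minpoly_coeff_zero_mem_span f)
  have hf0ne : f0 ≠ 0 :=
    minpoly_coeff_zero_ne_zero hf
  have hf0u : ¬ IsUnit f0 := fun hu =>
    (inferInstance : Q.IsPrime).ne_top (Ideal.eq_top_of_isUnit_mem _ hf0Q (hu.map g))
  obtain ⟨j, hj⟩ := exists_degreeOf_ne_zero hf0ne hf0u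
  -- The norm-like element `f0` involves `X_j`, and the remaining variables stay independent modulo
  -- `Q`: a relation `p` among them has a power divisible by `f`, hence a power divisible by `f0`,
  -- which forces `p = 0`. Thus only one variable is lost.
  have hind : AlgebraicIndependent k
      (fun i : {i // i ≠ j} => Ideal.Quotient.mkₐ k Q (g (MvPolynomial.X i.1))) := by
    rw [algebraicIndependent_iff]
    intro p hp
    have h1 : Ideal.Quotient.mkₐ k Q (g (MvPolynomial.rename Subtype.val p)) = 0 := by
      rw [← hp, MvPolynomial.rename_eq_aeval]
      simp only [← AlgHom.comp_apply]
      congr 1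
      ext i
      simp
    have h2 : g (MvPolynomial.rename Subtype.val p) ∈ Q := by
      rwa [Ideal.Quotient.mkₐ_eq_mk, Ideal.Quotient.eq_zero_iff_mem] at h1
    rw [hQ] at h2
    obtain ⟨r, hr⟩ := h2
    rw [Ideal.mem_span_singleton] at hr
    obtain ⟨a, ha⟩ := hr
    rw [← map_pow] at ha
    obtain ⟨e, he⟩ := minpoly_coeff_zero_dvd_pow (B := MvPolynomial (Fin s) k) ha
    rw [← pow_mul] at he
    exact eq_zero_of_dvd_pow_rename hj he
  have h1 := hind.lift_cardinalMk_le_trdeg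
  have h2 : Algebra.trdeg k A = (s : Cardinal) := by
    have h3 := trdeg_add_eq k (MvPolynomial (Fin s) k) (A := A)
    rw [trdeg_eq_zero (R := MvPolynomial (Fin s) k) (A := A), add_zero,
      MvPolynomial.trdeg_of_isDomain] at h3
    simpa using h3.symm
  rw [h2]
  have h4 : Fintype.card {i : Fin s // i ≠ j} + 1 = s := by
    rw [Fintype.card_subtype_compl, Fintype.card_fin, Fintype.card_subtype_eq]
    have := j.2
    omega
  simp only [Cardinal.mk_fintype, Cardinal.lift_natCast, Cardinal.lift_uzero] at h1
  calc (s : Cardinal) = (Fintype.card {i : Fin s // i ≠ j} : Cardinal) + 1 := by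
        exact_mod_cast h4.symm
    _ ≤ _ := by gcongr

/-- Prime avoidance: `h` is taken in all the other minimal primes but not in `Q`. Inverting it
leaves `Q` as the radical of the ideal. -/
theorem exists_notMem_mul_pow_mem {A : Type*} [CommRing A] [IsNoetherianRing A]
    {I Q : Ideal A} (hQ : Q ∈ I.minimalPrimes) : ∃ h : A, h ∉ Q ∧
      ∀ x ∈ Q, ∃ n : ℕ, (h * x) ^ n ∈ I := by
  classical
  have hfin := I.finite_minimalPrimes_of_isNoetherianRing
  have hQp : Q.IsPrime := hQ.1.1
  let T := hfin.toFinset.erase Q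
  have hT : ¬ T.inf id ≤ Q := by
    intro h
    obtain ⟨P, hP, hPQ⟩ := (Ideal.IsPrime.inf_le' hQp).mp h
    simp only [T, Finset.mem_erase, Set.Finite.mem_toFinset] at hP
    exact hP.1 (le_antisymm hPQ (hQ.2 hP.2.1 hPQ))
  obtain ⟨h, hh, hhQ⟩ := SetLike.not_le_iff_exists.mp hT
  refine ⟨h, hhQ, fun x hx => ?_⟩
  have : h * x ∈ I.radical := by
    rw [← Ideal.sInf_minimalPrimes, Submodule.mem_sInf]
    intro P hP
    by_cases hPQ : P = Q
    · exact hPQ ▸ Q.mul_mem_left h hx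
    · have : T.inf id ≤ P := Finset.inf_le (f := id)
        (Finset.mem_erase.mpr ⟨hPQ, hfin.mem_toFinset.mpr hP⟩)
      exact Ideal.mul_mem_right x P (this hh)
  exact this

/-- The principal ideal theorem for transcendence degrees. -/
theorem trdeg_le_trdeg_quotient_add_one {k A : Type u} [Field k] [CommRing A]
    [IsDomain A] [Algebra k A] [Algebra.FiniteType k A] {f : A} (hf : f ≠ 0) {Q : Ideal A}
    (hQ : Q ∈ (Ideal.span {f}).minimalPrimes) :
    Algebra.trdeg k A ≤ Algebra.trdeg k (A ⧸ Q) + 1 := by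
  have : IsNoetherianRing A := Algebra.FiniteType.isNoetherianRing k A
  have hQp : Q.IsPrime := hQ.1.1
  obtain ⟨h, hhQ, hh⟩ := exists_notMem_mul_pow_mem hQ
  have hh0 : h ≠ 0 := fun h0 => hhQ (h0 ▸ Q.zero_mem)
  -- After inverting `h`, the extension of `Q` is the radical of `(f)`, so the special case applies.
  -- Localization does not lower the transcendence degree of `A`, and does not raise that of `A ⧸
  -- Q`.
  let A' := Localization.Away h
  have hle : Submonoid.powers h ≤ nonZeroDivisors A := powers_le_nonZeroDivisors_of_noZeroDivisors hh0
  have : IsDomain A' := IsLocalization.isDomain_localization hle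
  have : Algebra.FiniteType A A' := IsLocalization.finiteType_of_monoid_fg (Submonoid.powers h) A'
  have : Algebra.FiniteType k A' := Algebra.FiniteType.trans (S := A) inferInstance inferInstance
  have hinj : Function.Injective (algebraMap A A') := IsLocalization.injective A' hle
  have hdisj : Disjoint (Submonoid.powers h : Set A) (Q : Set A) := by
    rw [Set.disjoint_left]
    rintro _ ⟨n, rfl⟩ hn
    exact hhQ (hQp.mem_of_pow_mem n hn)
  let Q' : Ideal A' := Q.map (algebraMap A A')
  have hQ'p : Q'.IsPrime := IsLocalization.isPrime_of_isPrime_disjoint (Submonoid.powers h) A' Q hQp hdisj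
  have hcomap : Q'.comap (algebraMap A A') = Q :=
    IsLocalization.under_map_of_isPrime_disjoint (Submonoid.powers h) A' hQp hdisj
  have hu : IsUnit (algebraMap A A' h) := IsLocalization.Away.algebraMap_isUnit h
  have hrad : Q' = (Ideal.span {algebraMap A A' f}).radical := by
    apply le_antisymm
    · rw [Ideal.map_le_iff_le_comap]
      intro x hx
      obtain ⟨n, hn⟩ := hh x hx
      refine ⟨n, ?_⟩
      rw [Ideal.mem_span_singleton] at hn ⊢
      have := map_dvd (algebraMap A A') hn
      rw [map_pow, map_mul, mul_pow] at this
      exact ((hu.pow n).dvd_mul_left).mp this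
    · refine hQ'p.isRadical.radical_le_iff.mpr ?_
      rw [Ideal.span_singleton_le_iff_mem]
      exact Ideal.mem_map_of_mem _ (hQ.1.2 (Ideal.mem_span_singleton_self f))
  have h1 := trdeg_le_trdeg_quotient_add_one_of_radical (k := k)
    (fun h0 => hf (hinj (by simpa using h0))) Q' hrad
  have h2 : Algebra.trdeg k A ≤ Algebra.trdeg k A' :=
    trdeg_le_of_injective (IsScalarTower.toAlgHom k A A') hinj
  have h3 : Algebra.trdeg k (A' ⧸ Q') ≤ Algebra.trdeg k (A ⧸ Q) := by
    let φ : (A ⧸ Q) →ₐ[k] (A' ⧸ Q') := Ideal.quotientMapₐ Q' (IsScalarTower.toAlgHom k A A')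
      (by rw [← hcomap]; exact le_rfl)
    have hφ : Function.Injective φ := by
      refine Ideal.quotientMap_injective' (H := hcomap.ge) ?_
      exact hcomap.le
    have : IsScalarTower k (A ⧸ Q) (A' ⧸ Q') := IsScalarTower.of_algebraMap_eq' (by
      ext x; exact (φ.commutes x).symm)
    have : FaithfulSMul (A ⧸ Q) (A' ⧸ Q') := (faithfulSMul_iff_algebraMap_injective _ _).mpr hφ
    have : Algebra.IsAlgebraic (A ⧸ Q) (A' ⧸ Q') := by
      constructor
      intro x
      obtain ⟨y, rfl⟩ := Ideal.Quotient.mk_surjective x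
      obtain ⟨n, a, ha⟩ := IsLocalization.Away.surj h y
      -- A fraction with denominator `h ^ n` is a root of a linear polynomial, whose leading
      -- coefficient is nonzero because `h ∉ Q`.
      refine ⟨Polynomial.C (Ideal.Quotient.mk Q (h ^ n)) * Polynomial.X -
        Polynomial.C (Ideal.Quotient.mk Q a), ?_, ?_⟩
      · intro h0
        have := congrArg (fun p => Polynomial.coeff p 1) h0
        simp only [Polynomial.coeff_sub, Polynomial.coeff_mul_X, Polynomial.coeff_C_succ, sub_zero,
          Polynomial.coeff_zero, Polynomial.coeff_C_zero] at this
        exact hhQ (hQp.mem_of_pow_mem n (Ideal.Quotient.eq_zero_iff_mem.mp this))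
      · have h5 : ∀ z, algebraMap (A ⧸ Q) (A' ⧸ Q') (Ideal.Quotient.mk Q z) =
          Ideal.Quotient.mk Q' (algebraMap A A' z) := fun z => rfl
        rw [map_sub, map_mul, Polynomial.aeval_C, Polynomial.aeval_X, Polynomial.aeval_C, h5, h5,
          ← map_mul, ← ha, map_pow, mul_comm, sub_self]
    have h4 := trdeg_add_eq k (A ⧸ Q) (A := A' ⧸ Q')
    rw [trdeg_eq_zero (R := A ⧸ Q) (A := A' ⧸ Q'), add_zero] at h4
    exact h4.ge
  calc _ ≤ _ := h2
    _ ≤ _ := h1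
    _ ≤ _ := by gcongr

/-- The transcendence degree drops in proper quotients. -/
theorem trdeg_quotient_add_one_le {k A : Type u} [Field k] [CommRing A]
    [IsDomain A] [Algebra k A] {Q : Ideal A} [Q.IsPrime] (hQ : Q ≠ ⊥) :
    Algebra.trdeg k (A ⧸ Q) + 1 ≤ Algebra.trdeg k A := by
  have hQ0 : FaithfulSMul k (A ⧸ Q) :=
    (faithfulSMul_iff_algebraMap_injective _ _).mpr (algebraMap k (A ⧸ Q)).injective
  obtain ⟨s, hs⟩ := exists_isTranscendenceBasis k (A ⧸ Q)
  obtain ⟨q, hq, hq0⟩ := Submodule.exists_mem_ne_zero_of_ne_bot hQ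
  let y : s → A := fun i => (Ideal.Quotient.mk_surjective i.1).choose
  have hy : ∀ i, Ideal.Quotient.mk Q (y i) = i.1 := fun i =>
    (Ideal.Quotient.mk_surjective i.1).choose_spec
  have hmap : (Ideal.Quotient.mkₐ k Q) ∘ y = fun i : s => i.1 := funext hy
  have hind : AlgebraicIndependent k ((Ideal.Quotient.mkₐ k Q) ∘ y) := hmap ▸ hs.1
  have hyind : AlgebraicIndependent k y := AlgebraicIndependent.of_comp _ hind
  -- Lifts of a transcendence basis of the quotient, together with a nonzero `q ∈ Q`, remain
  -- independent. Otherwise `q` divides a nonzero polynomial in the lifts; that polynomial lies in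
  -- `Q`, so it gives a relation in the quotient.
  have hopt : AlgebraicIndependent k (fun o : Option s => o.elim q y) := by
    rw [AlgebraicIndependent.option_iff]
    refine ⟨hyind, fun halg => ?_⟩
    obtain ⟨r, hr0, a, ha⟩ := halg.exists_nonzero_dvd (mem_nonZeroDivisors_of_ne_zero hq0)
    obtain ⟨r, hr⟩ := r
    rw [Algebra.adjoin_range_eq_range_aeval] at hr
    obtain ⟨p, rfl⟩ := hr
    have h1 : (MvPolynomial.aeval y) p ∈ Q := by
      have : (MvPolynomial.aeval y) p = q * a := ha
      rw [this]
      exact Ideal.mul_mem_right a Q hq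
    have h2 : MvPolynomial.aeval ((Ideal.Quotient.mkₐ k Q) ∘ y) p = 0 := by
      have : MvPolynomial.aeval ((Ideal.Quotient.mkₐ k Q) ∘ y) =
        (Ideal.Quotient.mkₐ k Q).comp (MvPolynomial.aeval y) := by ext; simp
      rw [this]
      exact Ideal.Quotient.eq_zero_iff_mem.mpr h1
    have h3 := hind.eq_zero_of_aeval_eq_zero p h2
    apply hr0
    ext
    simp [h3]
  have h1 := hopt.cardinalMk_le_trdeg
  rwa [Cardinal.mk_option, hs.cardinalMk_eq_trdeg] at h1

end CommutativeAlgebra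

/-! ## Closed subsets of products of projective spaces and multicones -/

section Multicones

universe u

variable {L : Type u} [Field L] {N n : ℕ}

/-- The coordinates of the chosen representatives of a tuple of points. -/
def repVec (x : Fin n → ℙ L (Fin (N + 1) → L)) : Fin n × Fin (N + 1) → L :=
  fun p => (x p.1).rep p.2

/-- `v` is a tuple of representatives of the tuple of points `x`. -/
def IsRep (v : Fin n × Fin (N + 1) → L) (x : Fin n → ℙ L (Fin (N + 1) → L)) : Prop :=
  ∃ t : Fin n → Lˣ, ∀ p, v p = t p.1 * (x p.1).rep p.2

theorem isRep_repVec (x : Fin n → ℙ L (Fin (N + 1) → L)) : IsRep (repVec x) x :=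
  ⟨1, fun p => by simp [repVec]⟩

theorem IsRep.exists_ne_zero {v : Fin n × Fin (N + 1) → L} {x : Fin n → ℙ L (Fin (N + 1) → L)}
    (h : IsRep v x) (i : Fin n) : ∃ j, v (i, j) ≠ 0 := by
  obtain ⟨t, ht⟩ := h
  obtain ⟨j, hj⟩ := Function.ne_iff.mp (x i).rep_nonzero
  exact ⟨j, by rw [ht]; exact mul_ne_zero (t i).ne_zero hj⟩

theorem exists_isRep {v : Fin n × Fin (N + 1) → L} (h : ∀ i, ∃ j, v (i, j) ≠ 0) :
    ∃ x : Fin n → ℙ L (Fin (N + 1) → L), IsRep v x := by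
  have h0 : ∀ i, (fun j => v (i, j)) ≠ 0 := fun i => Function.ne_iff.mpr (h i)
  choose a ha using fun i => Projectivization.exists_smul_eq_mk_rep L _ (h0 i)
  refine ⟨fun i => Projectivization.mk L _ (h0 i), fun i => (a i)⁻¹, fun p => ?_⟩
  rw [← ha p.1]
  simp [Units.smul_def]

theorem IsRep.unique {v : Fin n × Fin (N + 1) → L} {x y : Fin n → ℙ L (Fin (N + 1) → L)}
    (hx : IsRep v x) (hy : IsRep v y) : x = y := by
  obtain ⟨t, ht⟩ := hx
  obtain ⟨s, hs⟩ := hy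
  ext1 i
  rw [← (x i).mk_rep, ← (y i).mk_rep, Projectivization.mk_eq_mk_iff]
  refine ⟨(t i)⁻¹ * s i, ?_⟩
  ext j
  have h := (ht (i, j)).symm.trans (hs (i, j))
  simp only at h
  rw [mul_smul, Pi.smul_apply, Pi.smul_apply, Units.smul_def, Units.smul_def, smul_eq_mul,
    smul_eq_mul, ← h, ← mul_assoc, Units.inv_mul, one_mul]

theorem IsRep.scale {v : Fin n × Fin (N + 1) → L} {x : Fin n → ℙ L (Fin (N + 1) → L)}
    (h : IsRep v x) (s : Fin n → Lˣ) : IsRep (fun p => s p.1 * v p) x := by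
  obtain ⟨t, ht⟩ := h
  exact ⟨s * t, fun p => by simp [ht, mul_assoc]⟩

theorem IsRep.exists_scale {v w : Fin n × Fin (N + 1) → L} {x : Fin n → ℙ L (Fin (N + 1) → L)}
    (hv : IsRep v x) (hw : IsRep w x) : ∃ s : Fin n → Lˣ, w = fun p => s p.1 * v p := by
  obtain ⟨t, ht⟩ := hv
  obtain ⟨r, hr⟩ := hw
  refine ⟨fun i => r i * (t i)⁻¹, funext fun p => ?_⟩
  rw [hr, ht]
  simp [mul_assoc]

/-- The restriction of a polynomial to the torus orbit of `v`. -/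
def orbitPoly (v : Fin n × Fin (N + 1) → L) :
    MvPolynomial (Fin n × Fin (N + 1)) L →ₐ[L] MvPolynomial (Fin n) L :=
  MvPolynomial.aeval fun p => MvPolynomial.C (v p) * MvPolynomial.X p.1

theorem eval_orbitPoly (v : Fin n × Fin (N + 1) → L) (t : Fin n → L)
    (f : MvPolynomial (Fin n × Fin (N + 1)) L) :
    MvPolynomial.eval t (orbitPoly v f) = MvPolynomial.eval (fun p => t p.1 * v p) f := by
  induction f using MvPolynomial.induction_on with
  | C a => simp [orbitPoly]
  | add p q hp hq => simp [hp, hq]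
  | mul_X p i hp => rw [map_mul, map_mul, hp, map_mul]; simp [orbitPoly, mul_comm]

theorem coe_mapDomain_fst (u : Fin n × Fin (N + 1) →₀ ℕ) :
    ⇑(u.mapDomain Prod.fst) = Finsupp.weight
      (fun p : Fin n × Fin (N + 1) => (Pi.single p.1 1 : Fin n → ℕ)) u := by
  ext i
  simp [Finsupp.weight_apply, Finsupp.mapDomain, Finsupp.sum, Finsupp.finsetSum_apply,
    Pi.single_apply, Finsupp.single_apply, eq_comm]

theorem orbitPoly_monomial (v : Fin n × Fin (N + 1) → L) (u : Fin n × Fin (N + 1) →₀ ℕ) (a : L) :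
    orbitPoly v (MvPolynomial.monomial u a) =
      MvPolynomial.monomial (u.mapDomain Prod.fst) (MvPolynomial.eval v (MvPolynomial.monomial u a)) := by
  rw [orbitPoly, MvPolynomial.aeval_monomial, MvPolynomial.eval_monomial,
    MvPolynomial.monomial_eq (s := u.mapDomain Prod.fst)]
  simp only [mul_pow, Finsupp.prod_mul, map_mul, MvPolynomial.algebraMap_eq]
  rw [Finsupp.prod_mapDomain_index (by simp) (by intros; exact pow_add _ _ _), map_finsuppProd]
  simp only [map_pow]
  ring

/-- Scaling the groups of variables by indeterminates separates multidegrees. This is the device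
that lets arbitrary polynomials, not only multihomogeneous ones, be used on representatives. -/
theorem coeff_orbitPoly (v : Fin n × Fin (N + 1) → L) (m : Fin n →₀ ℕ)
    (f : MvPolynomial (Fin n × Fin (N + 1)) L) :
    (orbitPoly v f).coeff m = MvPolynomial.eval v (MvPolynomial.weightedHomogeneousComponent
      (fun p : Fin n × Fin (N + 1) => (Pi.single p.1 1 : Fin n → ℕ)) (⇑m) f) := by
  classical
  induction f using MvPolynomial.induction_on' with
  | monomial u a =>
    rw [orbitPoly_monomial, MvPolynomial.coeff_monomial]
    have hu := MvPolynomial.isWeightedHomogeneous_monomial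
      (fun p : Fin n × Fin (N + 1) => (Pi.single p.1 1 : Fin n → ℕ)) u a rfl
    rw [← coe_mapDomain_fst] at hu
    rw [MvPolynomial.weightedHomogeneousComponent_of_mem hu]
    by_cases h : u.mapDomain Prod.fst = m
    · simp [h]
    · rw [if_neg h, if_neg (fun h1 => h (DFunLike.coe_injective h1.symm)), map_zero]
  | add p q hp hq => simp [hp, hq]

theorem exists_units_eval_ne_zero [Infinite L] {f : MvPolynomial (Fin n) L} (hf : f ≠ 0) :
    ∃ t : Fin n → Lˣ, MvPolynomial.eval (fun i => (t i : L)) f ≠ 0 := by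
  -- The product of the variables forces a nonvanishing point into the torus.
  have h : f * ∏ i, MvPolynomial.X i ≠ 0 :=
    mul_ne_zero hf (Finset.prod_ne_zero_iff.mpr fun i _ => MvPolynomial.X_ne_zero i)
  obtain ⟨t, ht⟩ : ∃ t, MvPolynomial.eval t (f * ∏ i, MvPolynomial.X i) ≠ 0 := by
    by_contra! h0
    exact h (MvPolynomial.funext fun t => by rw [h0 t, map_zero])
  rw [map_mul, map_prod] at ht
  have h1 := right_ne_zero_of_mul ht
  rw [Finset.prod_ne_zero_iff] at h1
  refine ⟨fun i => Units.mk0 (t i) (by simpa using h1 i (Finset.mem_univ i)), ?_⟩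
  exact left_ne_zero_of_mul ht

theorem orbitPoly_eq_zero_iff [Infinite L] {v : Fin n × Fin (N + 1) → L}
    {x : Fin n → ℙ L (Fin (N + 1) → L)} (hv : IsRep v x)
    (f : MvPolynomial (Fin n × Fin (N + 1)) L) :
    orbitPoly v f = 0 ↔ ∀ w, IsRep w x → MvPolynomial.eval w f = 0 := by
  constructor
  · intro h w hw
    obtain ⟨s, rfl⟩ := hv.exists_scale hw
    rw [← eval_orbitPoly v (fun i => (s i : L)), h, map_zero]
  · intro h
    by_contra h0
    obtain ⟨t, ht⟩ := exists_units_eval_ne_zero h0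
    rw [eval_orbitPoly] at ht
    exact ht (h _ (hv.scale t))

attribute [local instance] zariskiTopology

/-- Whether a multihomogeneous polynomial vanishes does not depend on representatives. -/
theorem IsMultihomogeneous.eval_scale {f : MvPolynomial (Fin n × Fin (N + 1)) L} {d : Fin n → ℕ}
    (hf : IsMultihomogeneous f d) (v : Fin n × Fin (N + 1) → L) (t : Fin n → L) :
    MvPolynomial.eval (fun p => t p.1 * v p) f = (∏ i, t i ^ d i) * MvPolynomial.eval v f := by
  have h : orbitPoly v f =
      MvPolynomial.monomial (Finsupp.equivFunOnFinite.symm d) (MvPolynomial.eval v f) := by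
    classical
    ext m
    rw [coeff_orbitPoly, MvPolynomial.weightedHomogeneousComponent_of_mem hf,
      MvPolynomial.coeff_monomial]
    by_cases hm : ⇑m = d
    · subst hm
      simp
    · rw [if_neg hm, if_neg (fun h => hm (by rw [← h]; rfl)), map_zero]
  rw [← eval_orbitPoly, h, MvPolynomial.eval_monomial, mul_comm,
    Finsupp.prod_fintype _ _ (by simp)]
  rfl

theorem IsMultihomogeneous.eval_eq_zero_iff {f : MvPolynomial (Fin n × Fin (N + 1)) L}
    {d : Fin n → ℕ} (hf : IsMultihomogeneous f d) {v w : Fin n × Fin (N + 1) → L}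
    {x : Fin n → ℙ L (Fin (N + 1) → L)} (hv : IsRep v x) (hw : IsRep w x) :
    MvPolynomial.eval v f = 0 ↔ MvPolynomial.eval w f = 0 := by
  obtain ⟨s, rfl⟩ := hv.exists_scale hw
  rw [hf.eval_scale v (fun i => (s i : L)), mul_eq_zero, or_iff_right]
  exact Finset.prod_ne_zero_iff.mpr fun i _ => pow_ne_zero _ (s i).ne_zero

theorem isClosed_iff_exists_multihomogeneous {C : Set (Fin n → ℙ L (Fin (N + 1) → L))} :
    IsClosed C ↔ ∃ S : Set (MvPolynomial (Fin n × Fin (N + 1)) L),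
      (∀ f ∈ S, ∃ d, IsMultihomogeneous f d) ∧ C = multiZeroLocus S := by
  rw [← isOpen_compl_iff]
  change Cᶜᶜ ∈ _ ↔ _
  rw [compl_compl]
  rfl

/-- The polynomials that vanish at all representatives of points of `C`. -/
def coneIdeal (C : Set (Fin n → ℙ L (Fin (N + 1) → L))) :
    Ideal (MvPolynomial (Fin n × Fin (N + 1)) L) :=
  MvPolynomial.vanishingIdeal L {v | ∃ x ∈ C, IsRep v x}

theorem mem_coneIdeal {C : Set (Fin n → ℙ L (Fin (N + 1) → L))}
    {f : MvPolynomial (Fin n × Fin (N + 1)) L} :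
    f ∈ coneIdeal C ↔ ∀ x ∈ C, ∀ v, IsRep v x → MvPolynomial.eval v f = 0 := by
  simp only [coneIdeal, MvPolynomial.mem_vanishingIdeal_iff, Set.mem_ofPred_eq]
  exact ⟨fun h x hx v hv => h v ⟨x, hx, hv⟩, fun h v ⟨x, hx, hv⟩ => h x hx v hv⟩

theorem coneIdeal_anti {C D : Set (Fin n → ℙ L (Fin (N + 1) → L))} (h : C ⊆ D) :
    coneIdeal D ≤ coneIdeal C := fun _ hf =>
  mem_coneIdeal.mpr fun x hx => mem_coneIdeal.mp hf x (h hx)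

/-- A polynomial vanishes on a whole torus orbit exactly when each of its multihomogeneous
components vanishes at one representative, so the components define the set. -/
theorem isClosed_setOf_forall_isRep [Infinite L] (S : Set (MvPolynomial (Fin n × Fin (N + 1)) L)) :
    IsClosed {x : Fin n → ℙ L (Fin (N + 1) → L) |
      ∀ f ∈ S, ∀ v, IsRep v x → MvPolynomial.eval v f = 0} := by
  rw [isClosed_iff_exists_multihomogeneous]
  refine ⟨{g | ∃ f ∈ S, ∃ m : Fin n →₀ ℕ, g = MvPolynomial.weightedHomogeneousComponent
      (fun p : Fin n × Fin (N + 1) => (Pi.single p.1 1 : Fin n → ℕ)) (⇑m) f}, ?_, ?_⟩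
  · rintro _ ⟨f, -, m, rfl⟩
    exact ⟨m, MvPolynomial.weightedHomogeneousComponent_isWeightedHomogeneous _ _⟩
  · ext x
    constructor
    · rintro h _ ⟨f, hf, m, rfl⟩
      have := (orbitPoly_eq_zero_iff (isRep_repVec x) f).mpr (h f hf)
      have h1 := coeff_orbitPoly (repVec x) m f
      rw [this, MvPolynomial.coeff_zero] at h1
      exact h1.symm
    · intro h f hf
      rw [← orbitPoly_eq_zero_iff (isRep_repVec x)]
      ext m
      rw [coeff_orbitPoly, MvPolynomial.coeff_zero]
      exact h _ ⟨f, hf, m, rfl⟩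

/-- A set is closed if it is cut out, on representatives, by some polynomials. -/
theorem isClosed_of_forall_isRep [Infinite L] {C : Set (Fin n → ℙ L (Fin (N + 1) → L))}
    (S : Set (MvPolynomial (Fin n × Fin (N + 1)) L))
    (h : ∀ x v, IsRep v x → (x ∈ C ↔ ∀ f ∈ S, MvPolynomial.eval v f = 0)) : IsClosed C := by
  convert isClosed_setOf_forall_isRep S
  ext x
  rw [h x _ (isRep_repVec x)]
  exact ⟨fun h1 f hf v hv => (h x v hv).mp ((h x _ (isRep_repVec x)).mpr h1) f hf,
    fun h1 f hf => h1 f hf _ (isRep_repVec x)⟩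

theorem mem_iff_of_isClosed {C : Set (Fin n → ℙ L (Fin (N + 1) → L))} (hC : IsClosed C)
    {x : Fin n → ℙ L (Fin (N + 1) → L)} {v : Fin n × Fin (N + 1) → L} (hv : IsRep v x) :
    x ∈ C ↔ ∀ f ∈ coneIdeal C, MvPolynomial.eval v f = 0 := by
  refine ⟨fun hx f hf => mem_coneIdeal.mp hf x hx v hv, fun h => ?_⟩
  obtain ⟨S, hS, rfl⟩ := isClosed_iff_exists_multihomogeneous.mp hC
  intro f hf
  obtain ⟨d, hd⟩ := hS f hf
  refine (hd.eval_eq_zero_iff hv (isRep_repVec x)).mp (h f (mem_coneIdeal.mpr fun y hy w hw => ?_))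
  exact (hd.eval_eq_zero_iff (isRep_repVec y) hw).mp (hy f hf)

end Multicones

/-! ## Dimension in topological spaces -/

section TopologicalDimension

open TopologicalSpace

theorem le_of_forall_natCast_le {a b : WithBot ℕ∞} (h : ∀ k : ℕ, (k : WithBot ℕ∞) ≤ a → k ≤ b) :
    a ≤ b := by
  induction a using WithBot.recBotCoe with
  | bot => exact bot_le
  | coe a =>
    induction b using WithBot.recBotCoe with
    | bot => simpa using h 0 (by exact_mod_cast bot_le (a := a))
    | coe b =>
      rw [WithBot.coe_le_coe]
      exact ENat.forall_natCast_le_iff_le.mp fun k hk => by exact_mod_cast h k (by exact_mod_cast hk)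

theorem lt_natCast_succ_iff {a : WithBot ℕ∞} {k : ℕ} :
    a < ((k + 1 : ℕ) : WithBot ℕ∞) ↔ a ≤ k := by
  induction a using WithBot.recBotCoe with
  | bot => simp
  | coe a =>
    rw [← WithBot.coe_natCast, ← WithBot.coe_natCast, WithBot.coe_lt_coe, WithBot.coe_le_coe]
    push_cast
    exact ENat.lt_add_one_iff (ENat.natCast_ne_top k)

theorem natCast_succ_le_iff {a : WithBot ℕ∞} {k : ℕ} :
    ((k + 1 : ℕ) : WithBot ℕ∞) ≤ a ↔ (k : WithBot ℕ∞) < a := by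
  rw [← not_lt, lt_natCast_succ_iff, not_le]

variable {X : Type*} [TopologicalSpace X]

theorem isIrreducible_image_iff_of_isInducing {Y : Type*} [TopologicalSpace Y] {f : X → Y}
    (hf : Topology.IsInducing f) {Z : Set X} : IsIrreducible (f '' Z) ↔ IsIrreducible Z := by
  refine ⟨fun h => ⟨h.nonempty.of_image, ?_⟩, fun h => h.image f hf.continuous.continuousOn⟩
  intro u v hu hv hZu hZv
  obtain ⟨u, hu', rfl⟩ := hf.isOpen_iff.mp hu
  obtain ⟨v, hv', rfl⟩ := hf.isOpen_iff.mp hv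
  obtain ⟨x, hx, hxu⟩ := hZu
  obtain ⟨y, hy, hyv⟩ := hZv
  obtain ⟨_, ⟨z, hz, rfl⟩, hzu⟩ := h.2 u v hu' hv' ⟨f x, ⟨x, hx, rfl⟩, hxu⟩ ⟨f y, ⟨y, hy, rfl⟩, hyv⟩
  exact ⟨z, hz, hzu⟩

/-- Because `C` is closed, chains in the subspace `C` can be exchanged for chains in `X` ending
inside `C`: take closures of images one way, preimages the other. -/
theorem natCast_le_dim_iff {C : Set X} (hC : IsClosed C) {k : ℕ} :
    (k : WithBot ℕ∞) ≤ dim C ↔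
      ∃ p : LTSeries (IrreducibleCloseds X), p.length = k ∧ (p.last : Set X) ⊆ C := by
  rw [dim, topologicalKrullDim, Order.le_krullDim_iff]
  constructor
  · rintro ⟨l, rfl⟩
    refine ⟨l.map (IrreducibleCloseds.map Subtype.val continuous_subtype_val)
      (IrreducibleCloseds.map_strictMono_of_isInducing Topology.IsInducing.subtypeVal), rfl, ?_⟩
    rw [LTSeries.last_map]
    rw [IrreducibleCloseds.coe_map]
    refine closure_minimal ?_ hC
    rintro _ ⟨x, -, rfl⟩
    exact x.2
  · rintro ⟨p, rfl, hp⟩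
    have hsub : ∀ i, (p i : Set X) ⊆ C := fun i =>
      subset_trans (p.monotone (Fin.le_last i) : p i ≤ p (Fin.last _)) hp
    refine ⟨⟨p.length, fun i => ⟨Subtype.val ⁻¹' (p i : Set X), ?_, ?_⟩, ?_⟩, rfl⟩
    · rw [← isIrreducible_image_iff_of_isInducing Topology.IsInducing.subtypeVal,
        Subtype.image_preimage_coe, Set.inter_eq_right.mpr (hsub i)]
      exact (p i).isIrreducible
    · exact (p i).isClosed.preimage continuous_subtype_val
    · intro i
      have h : p i.castSucc < p i.succ := p.step i
      refine ⟨fun x hx => h.1 hx, fun h1 => h.2 fun x hx => ?_⟩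
      exact @h1 ⟨x, hsub _ hx⟩ hx

theorem dim_le_dim_of_subset {C D : Set X} (h : C ⊆ D) : dim C ≤ dim D :=
  (Topology.IsEmbedding.inclusion h).isInducing.topologicalKrullDim_le

theorem dim_image_of_isEmbedding {Y : Type*} [TopologicalSpace Y] {f : X → Y}
    (hf : Topology.IsEmbedding f) (C : Set X) : dim (f '' C) = dim C :=
  ((hf.homeomorphImage C).isHomeomorph.topologicalKrullDim_eq _).symm

theorem dim_empty : dim (∅ : Set X) = ⊥ := by
  have : IsEmpty (IrreducibleCloseds (∅ : Set X)) :=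
    ⟨fun Z => by obtain ⟨x, -⟩ := Z.isIrreducible.nonempty; exact x.2⟩
  exact Order.krullDim_eq_bot

theorem zero_le_dim {C : Set X} (hC : C.Nonempty) : (0 : WithBot ℕ∞) ≤ dim C := by
  obtain ⟨x, hx⟩ := hC
  have : Nonempty (IrreducibleCloseds C) :=
    ⟨⟨closure {⟨x, hx⟩}, isIrreducible_singleton.closure, isClosed_closure⟩⟩
  exact Order.krullDim_nonneg

theorem natCast_succ_le_dim_of_ssubset {Z Y : Set X} (hZ : IsClosed Z) (hY : IsClosed Y)
    (hYi : IsIrreducible Y) (h : Z ⊂ Y) {k : ℕ} (hk : (k : WithBot ℕ∞) ≤ dim Z) :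
    ((k + 1 : ℕ) : WithBot ℕ∞) ≤ dim Y := by
  obtain ⟨p, rfl, hp⟩ := (natCast_le_dim_iff hZ).mp hk
  rw [natCast_le_dim_iff hY]
  have hlt : p.last < (⟨Y, hYi, hY⟩ : IrreducibleCloseds X) :=
    ⟨fun x hx => h.1 (hp hx), fun h1 => h.2 fun x hx => hp (h1 hx)⟩
  refine ⟨RelSeries.snoc p ⟨Y, hYi, hY⟩ hlt, rfl, ?_⟩
  rw [RelSeries.last_snoc]
  exact subset_rfl

theorem exists_ssubset_of_natCast_succ_le_dim {C : Set X} (hC : IsClosed C) {k : ℕ}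
    (hk : ((k + 1 : ℕ) : WithBot ℕ∞) ≤ dim C) : ∃ Z Y : Set X, IsClosed Z ∧ IsIrreducible Z ∧
      IsClosed Y ∧ IsIrreducible Y ∧ Z ⊂ Y ∧ Y ⊆ C ∧ (k : WithBot ℕ∞) ≤ dim Z := by
  obtain ⟨p, hpk, hp⟩ := (natCast_le_dim_iff hC).mp hk
  have hne : p.length ≠ 0 := by omega
  refine ⟨p.eraseLast.last, p.last, p.eraseLast.last.isClosed, p.eraseLast.last.isIrreducible,
    p.last.isClosed, p.last.isIrreducible, p.eraseLast_last_rel_last hne, hp, ?_⟩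
  rw [natCast_le_dim_iff p.eraseLast.last.isClosed]
  exact ⟨p.eraseLast, by simp [hpk], subset_rfl⟩

theorem exists_irreducible_of_natCast_le_dim {C : Set X} (hC : IsClosed C) {k : ℕ}
    (hk : (k : WithBot ℕ∞) ≤ dim C) : ∃ Z : Set X, IsClosed Z ∧ IsIrreducible Z ∧ Z ⊆ C ∧
      (k : WithBot ℕ∞) ≤ dim Z := by
  obtain ⟨p, hpk, hp⟩ := (natCast_le_dim_iff hC).mp hk
  refine ⟨p.last, p.last.isClosed, p.last.isIrreducible, hp, ?_⟩
  rw [natCast_le_dim_iff p.last.isClosed]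
  exact ⟨p, hpk, subset_rfl⟩

/-- A closed continuous map does not raise the dimension. -/
theorem dim_image_le {Y : Type*} [TopologicalSpace Y] [NoetherianSpace X] {f : X → Y}
    (hf : Continuous f) (hcl : IsClosedMap f) {C : Set X} (hC : IsClosed C) :
    dim (f '' C) ≤ dim C := by
  -- An irreducible closed set in the image is the image of an irreducible closed set upstairs: the
  -- irreducible components of `C ∩ f⁻¹(W)` have closed images covering `W`, so one of them already
  -- covers it.
  have key : ∀ (C : Set X), IsClosed C → ∀ W : Set Y, IsClosed W → IsIrreducible W → W ⊆ f '' C →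
      ∃ Z ⊆ C, IsClosed Z ∧ IsIrreducible Z ∧ f '' Z = W := by
    intro C hC W hW hWi hWC
    obtain ⟨S, hSf, hSc, hSi, hSu⟩ := NoetherianSpace.exists_finite_set_isClosed_irreducible
      (hC.inter (hW.preimage hf))
    have hcov : W ⊆ ⋃₀ ((fun Z => f '' Z) '' S) := by
      intro y hy
      obtain ⟨x, hx, rfl⟩ := hWC hy
      have : x ∈ ⋃₀ S := hSu ▸ ⟨hx, hy⟩
      obtain ⟨Z, hZ, hxZ⟩ := this
      exact ⟨f '' Z, ⟨Z, hZ, rfl⟩, x, hxZ, rfl⟩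
    obtain ⟨_, hZ', hWZ⟩ := isIrreducible_iff_sUnion_isClosed.mp hWi (hSf.image _).toFinset
      (by simpa using fun Z hZ => hcl Z (hSc Z hZ)) (by simpa using hcov)
    simp only [Set.Finite.mem_toFinset] at hZ'
    obtain ⟨Z, hZ, rfl⟩ := hZ'
    have hZs : Z ⊆ C ∩ f ⁻¹' W := by
      rw [hSu]
      exact Set.subset_sUnion_of_mem hZ
    refine ⟨Z, fun x hx => (hZs hx).1, hSc Z hZ, hSi Z hZ, subset_antisymm ?_ hWZ⟩
    rintro _ ⟨x, hx, rfl⟩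
    exact (hZs hx).2
  refine le_of_forall_natCast_le fun k => ?_
  induction k generalizing C with
  | zero =>
    intro h
    obtain ⟨Z, -, hZi, hZ, -⟩ := exists_irreducible_of_natCast_le_dim (hcl C hC) h
    obtain ⟨y, hy⟩ := hZi.nonempty
    obtain ⟨x, hx, -⟩ := hZ hy
    exact zero_le_dim ⟨x, hx⟩
  | succ k ih =>
    intro h
    obtain ⟨Z, Y, hZ, hZi, hY, hYi, hZY, hYC, hk⟩ :=
      exists_ssubset_of_natCast_succ_le_dim (hcl C hC) h
    obtain ⟨Y', hY'C, hY'c, hY'i, rfl⟩ := key C hC Y hY hYi hYC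
    -- The part of `Y'` above `Z` is a proper closed subset of the irreducible `Y'` and still maps
    -- onto `Z`, so the induction hypothesis applies to it.
    have h1 : f '' (Y' ∩ f ⁻¹' Z) = Z := by
      rw [Set.image_inter_preimage, Set.inter_eq_right]
      exact hZY.subset
    have h2 := ih (hY'c.inter (hZ.preimage hf)) (h1.symm ▸ hk)
    refine (natCast_succ_le_dim_of_ssubset (hY'c.inter (hZ.preimage hf)) hY'c hY'i ?_ h2).trans
      (dim_le_dim_of_subset hY'C)
    refine ⟨Set.inter_subset_left, fun h3 => hZY.2 ?_⟩
    rintro _ ⟨x, hx, rfl⟩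
    exact (h3 hx).2

end TopologicalDimension

/-! ## Irreducible closed subsets of products of projective spaces -/

section Irreducible

universe u

variable {L : Type u} [Field L] {N n : ℕ}

attribute [local instance] zariskiTopology

theorem exists_form_ne_zero (q : Fin n → ℙ L (Fin (N + 1) → L)) :
    ∃ F : MvPolynomial (Fin n × Fin (N + 1)) L, IsMultihomogeneous F 1 ∧
      MvPolynomial.eval (repVec q) F ≠ 0 := by
  choose c hc using fun i => (isRep_repVec q).exists_ne_zero i
  refine ⟨∏ i, MvPolynomial.X (i, c i), ?_, ?_⟩
  · have h := MvPolynomial.IsWeightedHomogeneous.prod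
      (w := fun p : Fin n × Fin (N + 1) => (Pi.single p.1 1 : Fin n → ℕ)) Finset.univ
      (fun i => (MvPolynomial.X (i, c i) : MvPolynomial _ L)) (fun i => Pi.single i 1)
      (fun i _ => MvPolynomial.isWeightedHomogeneous_X L _ (i, c i))
    rwa [show ∑ i : Fin n, (Pi.single i 1 : Fin n → ℕ) = 1 from
      Finset.univ_sum_single (1 : Fin n → ℕ)] at h
  · rw [map_prod, Finset.prod_ne_zero_iff]
    intro i _
    simpa using hc i

/-- In a factor where the points differ, use a 2×2 minor against `p`; in the others, a coordinate
nonzero at `q`. The fixed multidegree `(1, …, 1)` keeps all these forms in one vector space and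
makes their ratios functions on points. -/
theorem exists_form_separating {p q : Fin n → ℙ L (Fin (N + 1) → L)} (h : p ≠ q) :
    ∃ F : MvPolynomial (Fin n × Fin (N + 1)) L, IsMultihomogeneous F 1 ∧
      MvPolynomial.eval (repVec p) F = 0 ∧ MvPolynomial.eval (repVec q) F ≠ 0 := by
  classical
  choose c hc using fun i => (isRep_repVec q).exists_ne_zero i
  obtain ⟨i, hi⟩ := Function.ne_iff.mp h
  obtain ⟨j, hj⟩ := (isRep_repVec p).exists_ne_zero i
  obtain ⟨j', hj'⟩ : ∃ j', repVec p (i, j) * repVec q (i, j') ≠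
      repVec p (i, j') * repVec q (i, j) := by
    by_contra! h0
    apply hi
    rw [← (p i).mk_rep, ← (q i).mk_rep, Eq.comm, Projectivization.mk_eq_mk_iff']
    refine ⟨repVec q (i, j) / repVec p (i, j), ?_⟩
    ext l
    have := h0 l
    simp only [repVec] at this hj ⊢
    simp only [Pi.smul_apply, smul_eq_mul]
    field_simp
    linear_combination -this
  let G : Fin n → MvPolynomial (Fin n × Fin (N + 1)) L := fun k => if k = i then
    MvPolynomial.C (repVec p (i, j)) * MvPolynomial.X (i, j') -
      MvPolynomial.C (repVec p (i, j')) * MvPolynomial.X (i, j) else MvPolynomial.X (k, c k)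
  have hG : ∀ k, MvPolynomial.IsWeightedHomogeneous
      (fun p : Fin n × Fin (N + 1) => (Pi.single p.1 1 : Fin n → ℕ)) (G k) (Pi.single k 1) := by
    intro k
    by_cases hk : k = i
    · subst hk
      simp only [G, if_true]
      exact ((MvPolynomial.isWeightedHomogeneous_X L _ (k, j')).C_mul _).sub
        ((MvPolynomial.isWeightedHomogeneous_X L _ (k, j)).C_mul _)
    · simp only [G, if_neg hk]
      exact MvPolynomial.isWeightedHomogeneous_X L _ (k, c k)
  refine ⟨∏ k, G k, ?_, ?_, ?_⟩
  · have h := MvPolynomial.IsWeightedHomogeneous.prod Finset.univ G (fun i => Pi.single i 1)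
      (fun i _ => hG i)
    rwa [show ∑ i : Fin n, (Pi.single i 1 : Fin n → ℕ) = 1 from
      Finset.univ_sum_single (1 : Fin n → ℕ)] at h
  · rw [map_prod, Finset.prod_eq_zero (Finset.mem_univ i)]
    simp [G]
    ring
  · rw [map_prod, Finset.prod_ne_zero_iff]
    intro k _
    by_cases hk : k = i
    · subst hk
      simpa [G, sub_eq_zero] using hj'
    · simpa [G, hk] using hc k

/-- The locus where a polynomial vanishes at all representatives. -/
def hypersurface (F : MvPolynomial (Fin n × Fin (N + 1)) L) :
    Set (Fin n → ℙ L (Fin (N + 1) → L)) :=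
  {x | ∀ v, IsRep v x → MvPolynomial.eval v F = 0}

theorem mem_hypersurface {F : MvPolynomial (Fin n × Fin (N + 1)) L} {d : Fin n → ℕ}
    (hF : IsMultihomogeneous F d) {x : Fin n → ℙ L (Fin (N + 1) → L)}
    {v : Fin n × Fin (N + 1) → L} (hv : IsRep v x) :
    x ∈ hypersurface F ↔ MvPolynomial.eval v F = 0 :=
  ⟨fun h => h v hv, fun h _ hw => (hF.eval_eq_zero_iff hv hw).mp h⟩

theorem subset_hypersurface_iff {C : Set (Fin n → ℙ L (Fin (N + 1) → L))}
    {F : MvPolynomial (Fin n × Fin (N + 1)) L} : C ⊆ hypersurface F ↔ F ∈ coneIdeal C :=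
  mem_coneIdeal.symm

/-- The points that have a representative in the zero locus of `Q`. -/
def zeroSet (Q : Ideal (MvPolynomial (Fin n × Fin (N + 1)) L)) :
    Set (Fin n → ℙ L (Fin (N + 1) → L)) :=
  {x | ∃ v, IsRep v x ∧ ∀ f ∈ Q, MvPolynomial.eval v f = 0}

theorem zeroSet_coneIdeal {C : Set (Fin n → ℙ L (Fin (N + 1) → L))} (hC : IsClosed C) :
    zeroSet (coneIdeal C) = C := by
  ext x
  exact ⟨fun ⟨v, hv, h⟩ => (mem_iff_of_isClosed hC hv).mpr h, fun h =>
    ⟨_, isRep_repVec x, (mem_iff_of_isClosed hC (isRep_repVec x)).mp h⟩⟩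

theorem coneIdeal_lt_of_ssubset {C D : Set (Fin n → ℙ L (Fin (N + 1) → L))} (hC : IsClosed C)
    (h : C ⊂ D) : coneIdeal D < coneIdeal C := by
  refine lt_of_le_not_ge (coneIdeal_anti h.1) fun h1 => h.2 fun x hx => ?_
  rw [mem_iff_of_isClosed hC (isRep_repVec x)]
  exact fun f hf => mem_coneIdeal.mp (h1 hf) x hx _ (isRep_repVec x)

section

variable [Infinite L]

theorem isClosed_hypersurface (F : MvPolynomial (Fin n × Fin (N + 1)) L) :
    IsClosed (hypersurface F) := by
  simpa [hypersurface] using isClosed_setOf_forall_isRep {F}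

theorem isClosed_singleton_tuple (p : Fin n → ℙ L (Fin (N + 1) → L)) : IsClosed {p} := by
  have : {p} = ⋂ F ∈ {F | IsMultihomogeneous F 1 ∧ MvPolynomial.eval (repVec p) F = 0},
      hypersurface F := by
    refine subset_antisymm ?_ fun q hq => ?_
    · rintro _ rfl
      exact Set.mem_iInter₂.mpr fun F hF => (mem_hypersurface hF.1 (isRep_repVec _)).mpr hF.2
    · by_contra h
      obtain ⟨F, hF, hFp, hFq⟩ := exists_form_separating (Ne.symm h)
      exact hFq (Set.mem_iInter₂.mp hq F ⟨hF, hFp⟩ _ (isRep_repVec q))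
  rw [this]
  exact isClosed_biInter fun F _ => isClosed_hypersurface F

/-- On each torus orbit a product vanishes only if a factor does, since the polynomials in the
scaling parameters form a domain. Irreducibility then selects the same factor for all of `C`. -/
theorem coneIdeal_isPrime {C : Set (Fin n → ℙ L (Fin (N + 1) → L))} (hC : IsIrreducible C) :
    (coneIdeal C).IsPrime := by
  refine ⟨?_, fun {f g} hfg => ?_⟩
  · obtain ⟨x, hx⟩ := hC.nonempty
    rw [Ideal.ne_top_iff_one]
    intro h
    simpa using mem_coneIdeal.mp h x hx _ (isRep_repVec x)
  · simp only [← subset_hypersurface_iff]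
    refine isPreirreducible_iff_isClosed_union_isClosed.mp hC.2 _ _ (isClosed_hypersurface f)
      (isClosed_hypersurface g) fun x hx => ?_
    have h : orbitPoly (repVec x) (f * g) = 0 :=
      (orbitPoly_eq_zero_iff (isRep_repVec x) _).mpr (mem_coneIdeal.mp hfg x hx)
    rw [map_mul, mul_eq_zero] at h
    exact h.imp (orbitPoly_eq_zero_iff (isRep_repVec x) _).mp
      (orbitPoly_eq_zero_iff (isRep_repVec x) _).mp

end

variable [IsAlgClosed L]

/-- A Nullstellensatz ignoring the irrelevant locus where some group of coordinates is zero.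
Multiplying `f` by coordinates kills that locus, and a point of `zeroSet Q` provides coordinates
whose product is outside `Q`. -/
theorem mem_of_forall_isRep {Q : Ideal (MvPolynomial (Fin n × Fin (N + 1)) L)} [Q.IsPrime]
    (hQ : (zeroSet Q).Nonempty) {f : MvPolynomial (Fin n × Fin (N + 1)) L}
    (hf : ∀ x v, IsRep v x → (∀ g ∈ Q, MvPolynomial.eval v g = 0) → MvPolynomial.eval v f = 0) :
    f ∈ Q := by
  obtain ⟨x, w, hw, hwQ⟩ := hQ
  choose c hc using hw.exists_ne_zero
  have h1 : f * ∏ i, MvPolynomial.X (i, c i) ∈ Q := by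
    rw [← MvPolynomial.IsPrime.vanishingIdeal_zeroLocus (K := L) Q,
      MvPolynomial.mem_vanishingIdeal_iff]
    intro v hv
    have hv' : ∀ g ∈ Q, MvPolynomial.eval v g = 0 := fun g hg => by
      simpa using hv g hg
    change MvPolynomial.eval v _ = 0
    rw [map_mul, map_prod]
    by_cases h0 : ∀ i, v (i, c i) ≠ 0
    · obtain ⟨y, hy⟩ := exists_isRep fun i => ⟨c i, h0 i⟩
      rw [hf y v hy hv', zero_mul]
    · push Not at h0
      obtain ⟨i, hi⟩ := h0
      rw [Finset.prod_eq_zero (Finset.mem_univ i) (by simpa using hi), mul_zero]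
  refine ((inferInstance : Q.IsPrime).mem_or_mem h1).resolve_right fun h2 => ?_
  have := hwQ _ h2
  rw [map_prod, Finset.prod_eq_zero_iff] at this
  obtain ⟨i, -, hi⟩ := this
  exact hc i (by simpa using hi)

theorem coneIdeal_zeroSet_le {Q : Ideal (MvPolynomial (Fin n × Fin (N + 1)) L)} [Q.IsPrime]
    (hQ : (zeroSet Q).Nonempty) : coneIdeal (zeroSet Q) ≤ Q := fun _ hf =>
  mem_of_forall_isRep hQ fun x v hv hvQ => mem_coneIdeal.mp hf x ⟨v, hv, hvQ⟩ v hv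

/-- `Q` is not assumed multihomogeneous, so the set need not be given as closed. If closed `A` and
`B` cover it and neither contains it, each gives a polynomial outside `Q`, and their product lies in
`Q` by `mem_of_forall_isRep`. -/
theorem isIrreducible_zeroSet {Q : Ideal (MvPolynomial (Fin n × Fin (N + 1)) L)} [hQp : Q.IsPrime]
    (hQ : (zeroSet Q).Nonempty) : IsIrreducible (zeroSet Q) := by
  refine ⟨hQ, isPreirreducible_iff_isClosed_union_isClosed.mpr fun A B hA hB hAB => ?_⟩
  have key : ∀ A : Set (Fin n → ℙ L (Fin (N + 1) → L)), IsClosed A → ¬ zeroSet Q ⊆ A →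
      ∃ f ∈ coneIdeal A, f ∉ Q := by
    intro A hA h
    obtain ⟨x, ⟨v, hv, hvQ⟩, hxA⟩ := Set.not_subset.mp h
    rw [mem_iff_of_isClosed hA hv] at hxA
    push Not at hxA
    obtain ⟨f, hf, hfv⟩ := hxA
    exact ⟨f, hf, fun h => hfv (hvQ f h)⟩
  by_contra! h
  obtain ⟨f, hf, hfQ⟩ := key A hA h.1
  obtain ⟨g, hg, hgQ⟩ := key B hB h.2
  refine (hQp.mem_or_mem (mem_of_forall_isRep (f := f * g) hQ fun x v hv hvQ => ?_)).elim hfQ hgQ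
  rw [map_mul]
  rcases hAB ⟨v, hv, hvQ⟩ with hx | hx
  · rw [mem_coneIdeal.mp hf x hx v hv, zero_mul]
  · rw [mem_coneIdeal.mp hg x hx v hv, mul_zero]

theorem isIrreducible_of_coneIdeal_isPrime {C : Set (Fin n → ℙ L (Fin (N + 1) → L))}
    (hC : IsClosed C) (hne : C.Nonempty) (h : (coneIdeal C).IsPrime) : IsIrreducible C := by
  have h1 := isIrreducible_zeroSet (Q := coneIdeal C) ((zeroSet_coneIdeal hC).symm ▸ hne)
  rwa [zeroSet_coneIdeal hC] at h1

end Irreducible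

/-! ## The dimension formula and hypersurface sections -/

section DimensionFormula

universe u

variable {L : Type u} [Field L]

/-- The transcendence degree of the quotient of a polynomial ring by an ideal. -/
def ringDim {σ : Type} (I : Ideal (MvPolynomial σ L)) : ℕ :=
  Cardinal.toNat (Algebra.trdeg L (MvPolynomial σ L ⧸ I))

variable {σ : Type} [Finite σ]

theorem natCast_ringDim (I : Ideal (MvPolynomial σ L)) :
    (ringDim I : Cardinal) = Algebra.trdeg L (MvPolynomial σ L ⧸ I) :=
  Cardinal.cast_toNat_of_lt_aleph0 trdeg_lt_aleph0_of_finiteType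

theorem trdeg_quotient_map_mk {P Q : Ideal (MvPolynomial σ L)} (h : P ≤ Q) :
    Algebra.trdeg L ((MvPolynomial σ L ⧸ P) ⧸ Q.map (Ideal.Quotient.mk P)) = ringDim Q := by
  rw [natCast_ringDim]
  exact (DoubleQuot.quotQuotEquivQuotOfLEₐ L h).trdeg_eq

theorem ringDim_lt_of_lt {P Q : Ideal (MvPolynomial σ L)} [P.IsPrime] [Q.IsPrime] (h : P < Q) :
    ringDim Q < ringDim P := by
  have hQ' : (Q.map (Ideal.Quotient.mk P)).IsPrime :=
    Ideal.map_isPrime_of_surjective Ideal.Quotient.mk_surjective (by rw [Ideal.mk_ker]; exact h.le)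
  have hne : Q.map (Ideal.Quotient.mk P) ≠ ⊥ := by
    rw [Ne, Ideal.map_eq_bot_iff_le_ker, Ideal.mk_ker]
    exact h.not_ge
  have h1 := trdeg_quotient_add_one_le (k := L) hne
  rw [trdeg_quotient_map_mk h.le, ← natCast_ringDim] at h1
  have : ringDim Q + 1 ≤ ringDim P := by exact_mod_cast h1
  omega

theorem ringDim_le_of_le {P Q : Ideal (MvPolynomial σ L)} [P.IsPrime] [Q.IsPrime] (h : P ≤ Q) :
    ringDim Q ≤ ringDim P := by
  rcases h.eq_or_lt with rfl | h
  · exact le_rfl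
  · exact (ringDim_lt_of_lt h).le

theorem ringDim_le_add_one {P Q : Ideal (MvPolynomial σ L)} [P.IsPrime] {f : MvPolynomial σ L}
    (hf : f ∉ P) (hQ : Q ∈ (P ⊔ Ideal.span {f}).minimalPrimes) : ringDim P ≤ ringDim Q + 1 := by
  have hPQ : P ≤ Q := le_sup_left.trans hQ.1.2
  have hQ' : Q.map (Ideal.Quotient.mk P) ∈
      (Ideal.span {Ideal.Quotient.mk P f} : Ideal (MvPolynomial σ L ⧸ P)).minimalPrimes := by
    have h := Ideal.minimalPrimes_map_of_surjective (f := Ideal.Quotient.mk P)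
      Ideal.Quotient.mk_surjective (Ideal.span {f})
    rw [Ideal.map_span, Set.image_singleton, Ideal.mk_ker, sup_comm] at h
    exact h ▸ ⟨Q, hQ, rfl⟩
  have h0 : Ideal.Quotient.mk P f ≠ 0 := fun h => hf (Ideal.Quotient.eq_zero_iff_mem.mp h)
  have h1 := trdeg_le_trdeg_quotient_add_one (k := L) h0 hQ'
  rw [trdeg_quotient_map_mk hPQ, ← natCast_ringDim] at h1
  exact_mod_cast h1

variable {N n : ℕ}

attribute [local instance] zariskiTopology

theorem orbitPoly_surjective {v : Fin n × Fin (N + 1) → L} {x : Fin n → ℙ L (Fin (N + 1) → L)}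
    (hv : IsRep v x) : Function.Surjective (orbitPoly v) := by
  choose c hc using hv.exists_ne_zero
  rw [← AlgHom.range_eq_top, eq_top_iff, ← MvPolynomial.adjoin_range_X, Algebra.adjoin_le_iff]
  rintro _ ⟨i, rfl⟩
  refine ⟨MvPolynomial.C (v (i, c i))⁻¹ * MvPolynomial.X (i, c i), ?_⟩
  simp [orbitPoly, ← mul_assoc, ← MvPolynomial.C_mul, inv_mul_cancel₀ (hc i)]

/-- The multicone over a point is a torus orbit, with one free scalar per factor; its coordinate
ring modulo the vanishing ideal is a polynomial ring in `n` variables. -/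
theorem ringDim_coneIdeal_singleton [Infinite L] (x : Fin n → ℙ L (Fin (N + 1) → L)) :
    ringDim (coneIdeal {x}) = n := by
  have h : coneIdeal {x} = RingHom.ker (orbitPoly (repVec x)) := by
    ext f
    rw [mem_coneIdeal, RingHom.mem_ker, orbitPoly_eq_zero_iff (isRep_repVec x)]
    simp
  have e := (Ideal.quotientKerAlgEquivOfSurjective (orbitPoly_surjective (isRep_repVec x))).trdeg_eq
  rw [MvPolynomial.trdeg_of_isDomain] at e
  rw [ringDim, h, e]
  simp

variable [IsAlgClosed L]

/-- Take a prime `Q` below `coneIdeal W₀` and minimal over `coneIdeal C` and `F`, and let `W` be the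
closure of its zero set. No multihomogeneity of `Q` is required: `coneIdeal W ≤ Q` already shows
that passing to `W` does not lower the transcendence degree. -/
theorem exists_hypersurface_section_containing {C W₀ : Set (Fin n → ℙ L (Fin (N + 1) → L))}
    (hC : IsClosed C) (hCi : IsIrreducible C) (hW₀i : IsIrreducible W₀) (hW₀ : W₀ ⊆ C)
    {F : MvPolynomial (Fin n × Fin (N + 1)) L} {d : Fin n → ℕ} (hF : IsMultihomogeneous F d)
    (hFC : ¬ C ⊆ hypersurface F) (hFW : W₀ ⊆ hypersurface F) :
    ∃ W, IsClosed W ∧ IsIrreducible W ∧ W₀ ⊆ W ∧ W ⊆ C ∩ hypersurface F ∧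
      ringDim (coneIdeal C) ≤ ringDim (coneIdeal W) + 1 := by
  have hCp := coneIdeal_isPrime hCi
  have hWp := coneIdeal_isPrime hW₀i
  have hle : coneIdeal C ⊔ Ideal.span {F} ≤ coneIdeal W₀ := by
    rw [sup_le_iff, Ideal.span_singleton_le_iff_mem]
    exact ⟨coneIdeal_anti hW₀, subset_hypersurface_iff.mp hFW⟩
  obtain ⟨Q, hQ, hQW⟩ := Ideal.exists_minimalPrimes_le hle
  have hQp : Q.IsPrime := hQ.1.1
  have hsub : W₀ ⊆ zeroSet Q := fun x hx =>
    ⟨_, isRep_repVec x, fun f hf => mem_coneIdeal.mp (hQW hf) x hx _ (isRep_repVec x)⟩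
  have hne : (zeroSet Q).Nonempty := hW₀i.nonempty.mono hsub
  have hirr := (isIrreducible_zeroSet hne).closure
  have hcl : closure (zeroSet Q) ⊆ C ∩ hypersurface F := by
    refine closure_minimal (fun x hx => ?_) (hC.inter (isClosed_hypersurface F))
    obtain ⟨v, hv, hvQ⟩ := hx
    exact ⟨(mem_iff_of_isClosed hC hv).mpr fun f hf => hvQ f (hQ.1.2 (Ideal.mem_sup_left hf)),
      (mem_hypersurface hF hv).mpr (hvQ F (hQ.1.2 (Ideal.mem_sup_right
        (Ideal.mem_span_singleton_self F))))⟩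
  refine ⟨_, isClosed_closure, hirr, hsub.trans subset_closure, hcl, ?_⟩
  have hprime := coneIdeal_isPrime hirr
  have h1 : coneIdeal (closure (zeroSet Q)) ≤ Q :=
    (coneIdeal_anti subset_closure).trans (coneIdeal_zeroSet_le hne)
  exact (ringDim_le_add_one (fun h => hFC (subset_hypersurface_iff.mpr h)) hQ).trans
    (Nat.add_le_add_right (ringDim_le_of_le h1) 1)

/-- A proper inclusion strictly lowers `ringDim`, which bounds chains. Conversely, while `ringDim`
exceeds `n` there are two points; a form separating them gives a proper irreducible section with a
drop of at most one, and chains of the full length are built inductively. -/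
theorem natCast_le_dim_iff_ringDim {C : Set (Fin n → ℙ L (Fin (N + 1) → L))}
    (hC : IsClosed C) (hCi : IsIrreducible C) (k : ℕ) :
    (k : WithBot ℕ∞) ≤ dim C ↔ k + n ≤ ringDim (coneIdeal C) := by
  induction k generalizing C with
  | zero =>
    refine iff_of_true (zero_le_dim hCi.nonempty) ?_
    obtain ⟨x, hx⟩ := hCi.nonempty
    have := coneIdeal_isPrime hCi
    have := coneIdeal_isPrime (isIrreducible_singleton (x := x))
    rw [zero_add]
    exact (ringDim_coneIdeal_singleton x).symm.trans_le
      (ringDim_le_of_le (coneIdeal_anti (Set.singleton_subset_iff.mpr hx)))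
  | succ k ih =>
    have hp := coneIdeal_isPrime hCi
    constructor
    · intro h
      obtain ⟨Z, Y, hZ, hZi, hY, hYi, hZY, hYC, hk⟩ := exists_ssubset_of_natCast_succ_le_dim hC h
      have := coneIdeal_isPrime hZi
      have h1 := (ih hZ hZi).mp hk
      have h2 := ringDim_lt_of_lt (coneIdeal_lt_of_ssubset hZ (hZY.trans_subset hYC))
      omega
    · intro h
      have hns : ∃ p ∈ C, ∃ q ∈ C, p ≠ q := by
        by_contra! h0
        obtain ⟨p, hp⟩ := hCi.nonempty
        have : C = {p} := Set.eq_singleton_iff_unique_mem.mpr ⟨hp, fun q hq => h0 q hq p hp⟩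
        rw [this, ringDim_coneIdeal_singleton] at h
        omega
      obtain ⟨p, hpC, q, hqC, hpq⟩ := hns
      obtain ⟨F, hF, hFp, hFq⟩ := exists_form_separating hpq
      have hqF : q ∉ hypersurface F := fun h => hFq (h _ (isRep_repVec q))
      obtain ⟨W, hW, hWi, -, hWC, hd⟩ := exists_hypersurface_section_containing hC hCi
        (isIrreducible_singleton (x := p)) (Set.singleton_subset_iff.mpr hpC) hF
        (fun h => hqF (h hqC))
        (Set.singleton_subset_iff.mpr ((mem_hypersurface hF (isRep_repVec p)).mpr hFp))
      refine natCast_succ_le_dim_of_ssubset hW hC hCi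
        ⟨fun x hx => (hWC hx).1, fun h => hqF (hWC (h hqC)).2⟩ ((ih hW hWi).mpr ?_)
      omega

theorem exists_natCast_eq_dim {C : Set (Fin n → ℙ L (Fin (N + 1) → L))}
    (hC : IsClosed C) (hCi : IsIrreducible C) :
    ∃ k : ℕ, dim C = k ∧ ringDim (coneIdeal C) = k + n := by
  have h0 := (natCast_le_dim_iff_ringDim hC hCi 0).mp (zero_le_dim hCi.nonempty)
  refine ⟨ringDim (coneIdeal C) - n, le_antisymm ?_ ?_, by omega⟩
  · refine le_of_forall_natCast_le fun k hk => ?_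
    have := (natCast_le_dim_iff_ringDim hC hCi k).mp hk
    exact_mod_cast (show k ≤ ringDim (coneIdeal C) - n by omega)
  · exact (natCast_le_dim_iff_ringDim hC hCi _).mpr (by omega)

/-- Cutting an irreducible closed set with `r` hypersurfaces lowers the dimension of each
component by at most `r`. -/
theorem exists_component_dim_le {C W₀ : Set (Fin n → ℙ L (Fin (N + 1) → L))}
    (hC : IsClosed C) (hCi : IsIrreducible C) (hW₀i : IsIrreducible W₀) (hW₀ : W₀ ⊆ C)
    {r : ℕ} (F : Fin r → MvPolynomial (Fin n × Fin (N + 1)) L)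
    (hF : ∀ k, ∃ d, IsMultihomogeneous (F k) d) (hFW : ∀ k, W₀ ⊆ hypersurface (F k)) :
    ∃ W, IsClosed W ∧ IsIrreducible W ∧ W₀ ⊆ W ∧ W ⊆ C ∧ (∀ k, W ⊆ hypersurface (F k)) ∧
      dim C ≤ dim W + r := by
  induction r generalizing C with
  | zero => exact ⟨C, hC, hCi, hW₀, subset_rfl, fun k => k.elim0, by simp⟩
  | succ r ih =>
    obtain ⟨W₁, hW₁, hW₁i, hW₀₁, hW₁C, hW₁F, hd⟩ : ∃ W, IsClosed W ∧ IsIrreducible W ∧ W₀ ⊆ W ∧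
        W ⊆ C ∧ W ⊆ hypersurface (F 0) ∧ dim C ≤ dim W + 1 := by
      by_cases h : C ⊆ hypersurface (F 0)
      · exact ⟨C, hC, hCi, hW₀, subset_rfl, h, le_add_of_nonneg_right zero_le_one⟩
      · obtain ⟨d, hd⟩ := hF 0
        obtain ⟨W, hW, hWi, hW₀W, hWC, hdim⟩ := exists_hypersurface_section_containing hC hCi hW₀i
          hW₀ hd h (hFW 0)
        refine ⟨W, hW, hWi, hW₀W, fun x hx => (hWC hx).1, fun x hx => (hWC hx).2, ?_⟩
        obtain ⟨a, ha, ha'⟩ := exists_natCast_eq_dim hC hCi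
        obtain ⟨b, hb, hb'⟩ := exists_natCast_eq_dim hW hWi
        rw [ha, hb]
        exact_mod_cast (show a ≤ b + 1 by omega)
    obtain ⟨W, hW, hWi, hW₀W, hWC, hWF, hdW⟩ := ih hW₁ hW₁i hW₀₁ (fun k => F k.succ)
      (fun k => hF k.succ) (fun k => hFW k.succ)
    refine ⟨W, hW, hWi, hW₀W, hWC.trans hW₁C, fun k => ?_, ?_⟩
    · exact Fin.cases (hWC.trans hW₁F) hWF k
    · refine hd.trans ((add_le_add_left hdW 1).trans_eq ?_)
      rw [add_assoc]
      push_cast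
      rfl

end DimensionFormula

/-! ## Elimination theory -/

section Elimination

variable {L : Type*} [Field L]

theorem eval_smul_of_isHomogeneous {τ : Type*} {h : MvPolynomial τ L} {k : ℕ}
    (hh : h.IsHomogeneous k) (t : L) (y : τ → L) :
    MvPolynomial.eval (t • y) h = t ^ k * MvPolynomial.eval y h := by
  rw [MvPolynomial.eval_eq, MvPolynomial.eval_eq, Finset.mul_sum]
  refine Finset.sum_congr rfl fun d hd => ?_
  have h1 : d.degree = k := by
    rw [Finsupp.degree_eq_weight_one]
    exact hh (MvPolynomial.mem_support_iff.mp hd)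
  simp only [Pi.smul_apply, smul_eq_mul, mul_pow, Finset.prod_mul_distrib]
  rw [Finset.prod_pow_eq_pow_sum, ← Finsupp.degree_apply, h1]
  ring

/-- A polynomial that vanishes on all nonzero multiples of `y` has homogeneous components that
vanish at `y`. -/
theorem eval_homogeneousComponent_eq_zero [Infinite L] {τ : Type*} {h : MvPolynomial τ L}
    {y : τ → L} (H : ∀ t : L, t ≠ 0 → MvPolynomial.eval (t • y) h = 0) (d : ℕ) :
    MvPolynomial.eval y (MvPolynomial.homogeneousComponent d h) = 0 := by
  -- As a polynomial in `t`, this is `h(t y)`; its coefficients are the values of the homogeneous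
  -- components at `y`.
  let q : Polynomial L := ∑ k ∈ Finset.range (h.totalDegree + 1),
    Polynomial.monomial k (MvPolynomial.eval y (MvPolynomial.homogeneousComponent k h))
  have hq : ∀ t, q.eval t = MvPolynomial.eval (t • y) h := by
    intro t
    conv_rhs => rw [← MvPolynomial.sum_homogeneousComponent h]
    rw [map_sum, Polynomial.eval_finsetSum]
    refine Finset.sum_congr rfl fun k _ => ?_
    rw [Polynomial.eval_monomial,
      eval_smul_of_isHomogeneous (MvPolynomial.homogeneousComponent_isHomogeneous k h), mul_comm]
  have hq0 : q = 0 := by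
    refine Polynomial.eq_zero_of_infinite_isRoot q (Set.Infinite.mono (s := {0}ᶜ) ?_ ?_)
    · intro t ht
      exact (hq t).trans (H t ht)
    · exact (Set.finite_singleton 0).infinite_compl
  by_cases hd : d < h.totalDegree + 1
  · have h1 : q.coeff d = 0 := by rw [hq0, Polynomial.coeff_zero]
    rw [Polynomial.finsetSum_coeff] at h1
    simpa [Polynomial.coeff_monomial, hd, Nat.lt_succ_iff] using h1
  · rw [MvPolynomial.homogeneousComponent_eq_zero _ _ (by omega), map_zero]

theorem monomial_mem_span_X_pow {τ : Type*} (β : τ →₀ ℕ) :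
    (MvPolynomial.monomial β (1 : L)) ∈
      Ideal.span (Set.range (MvPolynomial.X : τ → MvPolynomial τ L)) ^ β.degree := by
  rw [MvPolynomial.monomial_eq, MvPolynomial.C_1, one_mul, Finsupp.prod, Finsupp.degree_apply,
    ← Finset.prod_pow_eq_pow_sum]
  exact Ideal.prod_mem_prod fun i _ =>
    Ideal.pow_mem_pow (Ideal.subset_span (Set.mem_range_self i)) _

/-- The main theorem of elimination theory: the locus of parameters where a system has no
nonzero solution (on a cone) is open. -/
theorem exists_eval_ne_zero_of_no_solution [IsAlgClosed L] {σ τ : Type*} [Finite τ]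
    (S : Set (MvPolynomial τ (MvPolynomial σ L))) (a₀ : σ → L)
    (h₀ : ∀ y : τ → L, (∀ f ∈ S, MvPolynomial.eval y (f.map (MvPolynomial.eval a₀)) = 0) → y = 0) :
    ∃ g : MvPolynomial σ L, MvPolynomial.eval a₀ g ≠ 0 ∧ ∀ a, MvPolynomial.eval a g ≠ 0 →
      ∀ y : τ → L, (∀ t : L, t ≠ 0 → ∀ f ∈ S,
        MvPolynomial.eval (t • y) (f.map (MvPolynomial.eval a)) = 0) → y = 0 := by
  classical
  have := Fintype.ofFinite τ
  let φ : MvPolynomial τ (MvPolynomial σ L) →+* MvPolynomial τ L :=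
    MvPolynomial.map (MvPolynomial.eval a₀)
  have hφ : Function.Surjective φ := MvPolynomial.map_surjective _ fun c =>
    ⟨MvPolynomial.C c, MvPolynomial.eval_C c⟩
  have hrad : Ideal.span (Set.range (MvPolynomial.X : τ → MvPolynomial τ L)) ≤
      ((Ideal.span S).map φ).radical := by
    rw [← MvPolynomial.vanishingIdeal_zeroLocus_eq_radical (K := L), Ideal.span_le]
    rintro _ ⟨j, rfl⟩
    rw [SetLike.mem_coe, MvPolynomial.mem_vanishingIdeal_iff]
    intro y hy
    have : y = 0 := h₀ y fun f hf => by
      exact hy (φ f) (Ideal.mem_map_of_mem φ (Ideal.subset_span hf))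
    simp [this]
  obtain ⟨d, hd⟩ := Ideal.exists_pow_le_of_le_radical_of_fg hrad
    (Submodule.fg_span (Set.finite_range _))
  let B := {β : τ →₀ ℕ // β ∈ (Finset.univ : Finset τ).finsuppAntidiag d}
  have hB : ∀ β : τ →₀ ℕ, β ∈ (Finset.univ : Finset τ).finsuppAntidiag d ↔ β.degree = d := by
    intro β
    rw [Finset.mem_finsuppAntidiag, Finsupp.degree_eq_sum]
    simp
  -- By the Nullstellensatz all monomials of degree `d` lie in the ideal specialized at `a₀`; they
  -- are lifted to elements of the ideal with parameters.
  have hH : ∀ β : B, ∃ H ∈ Ideal.span S, φ H = MvPolynomial.monomial β.1 1 := by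
    intro β
    rw [← Ideal.mem_map_iff_of_surjective φ hφ]
    apply hd
    have := monomial_mem_span_X_pow (L := L) β.1
    rwa [(hB β.1).mp β.2] at this
  choose H hHS hHφ using hH
  -- The degree-`d` coefficients of the lifts form a matrix which specializes to the identity at
  -- `a₀`; its determinant is the required `g`.
  let M : Matrix B B (MvPolynomial σ L) := Matrix.of fun β γ => (H β).coeff γ.1
  refine ⟨M.det, ?_, fun a ha y hy => ?_⟩
  · have : M.map (MvPolynomial.eval a₀) = 1 := by
      ext β γ
      have h1 := congrArg (MvPolynomial.coeff γ.1) (hHφ β)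
      rw [MvPolynomial.coeff_map, MvPolynomial.coeff_monomial] at h1
      simp only [M, Matrix.map_apply, Matrix.of_apply, h1, Matrix.one_apply]
      exact if_congr Subtype.ext_iff.symm rfl rfl
    rw [RingHom.map_det, RingHom.mapMatrix_apply, this, Matrix.det_one]
    exact one_ne_zero
  · have hv : ∀ β : B, ∀ t : L, t ≠ 0 →
        MvPolynomial.eval (t • y) ((H β).map (MvPolynomial.eval a)) = 0 := by
      intro β t ht
      have : Ideal.span S ≤ RingHom.ker ((MvPolynomial.eval (t • y)).comp
          (MvPolynomial.map (MvPolynomial.eval a))) := by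
        rw [Ideal.span_le]
        exact fun f hf => hy t ht f hf
      exact this (hHS β)
    -- The lifts need not be homogeneous, but they vanish on all nonzero multiples of `y`, so their
    -- degree-`d` parts vanish at `y`. When the matrix is invertible, all degree-`d` monomials in
    -- `y` vanish.
    have hM : (M.map (MvPolynomial.eval a)).mulVec
        (fun γ : B => MvPolynomial.eval y (MvPolynomial.monomial γ.1 1)) = 0 := by
      ext β
      have h1 := eval_homogeneousComponent_eq_zero (hv β) d
      rw [MvPolynomial.homogeneousComponent_apply, map_sum] at h1
      rw [Pi.zero_apply, ← h1]
      refine (Finset.sum_coe_sort ((Finset.univ : Finset τ).finsuppAntidiag d) (fun γ =>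
        MvPolynomial.eval a ((H β).coeff γ) *
          MvPolynomial.eval y (MvPolynomial.monomial γ 1))).trans ?_
      symm
      refine (Finset.sum_subset (fun γ hγ => (hB γ).mpr (Finset.mem_filter.mp hγ).2)
        fun γ hγ hγ' => ?_).trans (Finset.sum_congr rfl fun γ _ => ?_)
      · have h2 : ((H β).map (MvPolynomial.eval a)).coeff γ = 0 := by
          by_contra h3
          exact hγ' (Finset.mem_filter.mpr ⟨MvPolynomial.mem_support_iff.mpr h3, (hB γ).mp hγ⟩)
        rw [h2, map_zero, map_zero]
      · rw [MvPolynomial.eval_monomial, MvPolynomial.eval_monomial, MvPolynomial.coeff_map, one_mul]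
    have hdet : (M.map (MvPolynomial.eval a)).det ≠ 0 := by
      rwa [RingHom.map_det] at ha
    have h2 := Matrix.eq_zero_of_mulVec_eq_zero hdet hM
    ext j
    have h3 := congrFun h2 ⟨Finsupp.single j d, (hB _).mpr (Finsupp.degree_single j d)⟩
    simp only [MvPolynomial.eval_monomial, one_mul, Pi.zero_apply] at h3
    rw [Finsupp.prod_single_index (h := fun n e => y n ^ e) (pow_zero _)] at h3
    exact eq_zero_of_pow_eq_zero h3

end Elimination

/-! ## Maps between products of projective spaces -/

section Maps

universe u

variable {L : Type u} [Field L] {N n m r : ℕ}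

attribute [local instance] zariskiTopology

theorem IsRep.comp {v : Fin n × Fin (N + 1) → L} {x : Fin n → ℙ L (Fin (N + 1) → L)}
    (h : IsRep v x) (φ : Fin m → Fin n) :
    IsRep (fun p : Fin m × Fin (N + 1) => v (φ p.1, p.2)) (fun i => x (φ i)) := by
  obtain ⟨t, ht⟩ := h
  exact ⟨fun i => t (φ i), fun p => ht _⟩

/-- The concatenation of tuples of vectors. -/
def appendVec (v : Fin n × Fin (N + 1) → L) (w : Fin m × Fin (N + 1) → L) :
    Fin (n + m) × Fin (N + 1) → L :=
  fun p => Fin.addCases (fun i => v (i, p.2)) (fun j => w (j, p.2)) p.1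

theorem IsRep.append {v : Fin n × Fin (N + 1) → L} {x : Fin n → ℙ L (Fin (N + 1) → L)}
    {w : Fin m × Fin (N + 1) → L} {y : Fin m → ℙ L (Fin (N + 1) → L)}
    (hv : IsRep v x) (hw : IsRep w y) : IsRep (appendVec v w) (Fin.append x y) := by
  obtain ⟨t, ht⟩ := hv
  obtain ⟨s, hs⟩ := hw
  refine ⟨Fin.append t s, fun ⟨i, j⟩ => ?_⟩
  refine Fin.addCases (fun i => ?_) (fun i => ?_) i
  · simpa [appendVec] using ht (i, j)
  · simpa [appendVec] using hs (i, j)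

theorem IsRep.eq_iff {v : Fin n × Fin (N + 1) → L} {x : Fin n → ℙ L (Fin (N + 1) → L)}
    {i k : Fin n} (hv : IsRep v x) :
    x i = x k ↔ ∀ j j', v (i, j) * v (k, j') = v (i, j') * v (k, j) := by
  obtain ⟨t, ht⟩ := hv
  constructor
  · intro h j j'
    simp only [ht, h]
    ring
  · intro h
    obtain ⟨j, hj⟩ := Function.ne_iff.mp (x i).rep_nonzero
    rw [← (x i).mk_rep, ← (x k).mk_rep, Eq.comm, Projectivization.mk_eq_mk_iff']
    refine ⟨(x k).rep j / (x i).rep j, ?_⟩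
    ext l
    have h1 := h j l
    simp only [ht] at h1
    have h2 : (x i).rep j * (x k).rep l = (x i).rep l * (x k).rep j := by
      have := mul_left_cancel₀ (mul_ne_zero (t i).ne_zero (t k).ne_zero)
        (show (t i * t k : L) * ((x i).rep j * (x k).rep l) =
          (t i * t k : L) * ((x i).rep l * (x k).rep j) by linear_combination h1)
      exact this
    simp only [Pi.smul_apply, smul_eq_mul]
    simp only [Pi.zero_apply] at hj
    field_simp
    linear_combination -h2

/-- The cone ideal is strictly decreasing on closed sets, so the descending chain condition comes
from the Noetherian polynomial ring. -/
theorem noetherianSpace_tuple :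
    TopologicalSpace.NoetherianSpace (Fin n → ℙ L (Fin (N + 1) → L)) := by
  let φ : TopologicalSpace.Closeds (Fin n → ℙ L (Fin (N + 1) → L)) →
    (Ideal (MvPolynomial (Fin n × Fin (N + 1)) L))ᵒᵈ := fun C => OrderDual.toDual (coneIdeal (C : Set _))
  have hφ : StrictMono φ := fun C D h => coneIdeal_lt_of_ssubset C.isClosed h
  exact ((TopologicalSpace.noetherianSpace_TFAE (Fin n → ℙ L (Fin (N + 1) → L))).out 0 1 :
    _ ↔ WellFoundedLT (TopologicalSpace.Closeds (Fin n → ℙ L (Fin (N + 1) → L)))).mpr hφ.wellFoundedLT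

theorem append_fstProj_sndProj {M : Type*} (x : Fin (n + m) → M) :
    Fin.append (fstProj n m x) (sndProj n m x) = x := by
  ext i
  refine Fin.addCases (fun i => ?_) (fun i => ?_) i <;> simp [fstProj, sndProj]

theorem fstProj_append {M : Type*} (x : Fin n → M) (y : Fin m → M) :
    fstProj n m (Fin.append x y) = x := by
  ext i; simp [fstProj]

theorem sndProj_append {M : Type*} (x : Fin n → M) (y : Fin m → M) :
    sndProj n m (Fin.append x y) = y := by
  ext i; simp [sndProj]

variable [Infinite L]

theorem continuous_comp (φ : Fin m → Fin n) :
    Continuous (fun (x : Fin n → ℙ L (Fin (N + 1) → L)) (i : Fin m) => x (φ i)) := by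
  rw [continuous_iff_isClosed]
  intro C hC
  refine isClosed_of_forall_isRep ((MvPolynomial.rename fun p : Fin m × Fin (N + 1) =>
    (φ p.1, p.2)) '' (coneIdeal C : Set (MvPolynomial (Fin m × Fin (N + 1)) L))) fun x v hv => ?_
  rw [Set.mem_preimage, mem_iff_of_isClosed hC (hv.comp φ), Set.forall_mem_image]
  simp only [MvPolynomial.eval_rename]
  rfl

theorem continuous_fstProj :
    Continuous (fstProj (M := ℙ L (Fin (N + 1) → L)) n m) := continuous_comp (Fin.castAdd m)

theorem continuous_sndProj :
    Continuous (sndProj (M := ℙ L (Fin (N + 1) → L)) n m) := continuous_comp (Fin.natAdd n)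

theorem continuous_append_right (a : Fin n → ℙ L (Fin (N + 1) → L)) :
    Continuous (fun b : Fin m → ℙ L (Fin (N + 1) → L) => Fin.append a b) := by
  rw [continuous_iff_isClosed]
  intro C hC
  refine isClosed_of_forall_isRep ((MvPolynomial.aeval (R := L)
    fun p : Fin (n + m) × Fin (N + 1) => (Fin.addCases (fun i => MvPolynomial.C (repVec a (i, p.2)))
      (fun j => MvPolynomial.X (j, p.2)) p.1 : MvPolynomial (Fin m × Fin (N + 1)) L)) ''
        (coneIdeal C : Set (MvPolynomial (Fin (n + m) × Fin (N + 1)) L))) fun x v hv => ?_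
  rw [Set.mem_preimage, mem_iff_of_isClosed hC ((isRep_repVec a).append hv), Set.forall_mem_image]
  refine forall₂_congr fun f _ => ?_
  rw [← MvPolynomial.coe_aeval_eq_eval v, RingHom.coe_coe, ← AlgHom.comp_apply,
    MvPolynomial.comp_aeval, MvPolynomial.aeval_eq_eval]
  have : appendVec (repVec a) v = fun p : Fin (n + m) × Fin (N + 1) => MvPolynomial.aeval v
      (Fin.addCases (fun i => MvPolynomial.C (repVec a (i, p.2)))
      (fun j => MvPolynomial.X (j, p.2)) p.1 : MvPolynomial (Fin m × Fin (N + 1)) L) := by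
    ext ⟨i, j⟩
    refine Fin.addCases (fun i => ?_) (fun i => ?_) i <;> simp [appendVec]
  rw [this]

theorem continuous_append_left (b : Fin m → ℙ L (Fin (N + 1) → L)) :
    Continuous (fun a : Fin n → ℙ L (Fin (N + 1) → L) => Fin.append a b) := by
  have h := (continuous_comp (L := L) (N := N) (Fin.addCases (Fin.natAdd m) (Fin.castAdd n) :
    Fin (n + m) → Fin (m + n))).comp (continuous_append_right (m := n) b)
  convert h using 1
  ext a i
  refine Fin.addCases (fun i => ?_) (fun i => ?_) i <;> simp

theorem isEmbedding_append (a : Fin n → ℙ L (Fin (N + 1) → L)) :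
    Topology.IsEmbedding (fun b : Fin m → ℙ L (Fin (N + 1) → L) => Fin.append a b) :=
  Topology.IsEmbedding.of_leftInverse (f := sndProj n m) (fun b => sndProj_append a b)
    continuous_sndProj (continuous_append_right a)

theorem isClosed_prod_tuple {C : Set (Fin n → ℙ L (Fin (N + 1) → L))}
    {D : Set (Fin m → ℙ L (Fin (N + 1) → L))} (hC : IsClosed C) (hD : IsClosed D) :
    IsClosed {x | fstProj n m x ∈ C ∧ sndProj n m x ∈ D} :=
  (hC.preimage continuous_fstProj).inter (hD.preimage continuous_sndProj)

theorem isClosed_fibre_tuple {C : Set (Fin (n + m) → ℙ L (Fin (N + 1) → L))} (hC : IsClosed C)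
    (a : Fin n → ℙ L (Fin (N + 1) → L)) : IsClosed (fibre C a) :=
  hC.preimage (continuous_append_right a)

theorem isClosed_setOf_eq_coord (i k : Fin n) :
    IsClosed {x : Fin n → ℙ L (Fin (N + 1) → L) | x i = x k} := by
  refine isClosed_of_forall_isRep (Set.range fun p : Fin (N + 1) × Fin (N + 1) =>
    MvPolynomial.X (i, p.1) * MvPolynomial.X (k, p.2) -
      MvPolynomial.X (i, p.2) * MvPolynomial.X (k, p.1)) fun x v hv => ?_
  rw [Set.mem_ofPred_eq, hv.eq_iff, Set.forall_mem_range, Prod.forall]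
  simp [sub_eq_zero]

theorem isClosed_diagonal_tuple :
    IsClosed {x : Fin (n + n) → ℙ L (Fin (N + 1) → L) | fstProj n n x = sndProj n n x} := by
  have : {x : Fin (n + n) → ℙ L (Fin (N + 1) → L) | fstProj n n x = sndProj n n x} =
      ⋂ i, {x | x (Fin.castAdd n i) = x (Fin.natAdd n i)} := by
    ext x
    simp [funext_iff, fstProj, sndProj]
  rw [this]
  exact isClosed_iInter fun i => isClosed_setOf_eq_coord _ _

/-- Each slice `{a} × D` is irreducible, hence inside one of two covering closed sets. The `a` whose
slice lies in a given one form a closed set, and irreducibility of `C` concludes. Only separate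
continuity of concatenation is used. -/
theorem isIrreducible_prod {C : Set (Fin n → ℙ L (Fin (N + 1) → L))}
    {D : Set (Fin m → ℙ L (Fin (N + 1) → L))} (hC : IsIrreducible C) (hD : IsIrreducible D) :
    IsIrreducible {x | fstProj n m x ∈ C ∧ sndProj n m x ∈ D} := by
  constructor
  · obtain ⟨x, hx⟩ := hC.nonempty
    obtain ⟨y, hy⟩ := hD.nonempty
    exact ⟨Fin.append x y, by simpa [fstProj_append, sndProj_append] using ⟨hx, hy⟩⟩
  rw [isPreirreducible_iff_isClosed_union_isClosed]
  intro A B hA hB hAB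
  have key : ∀ A : Set (Fin (n + m) → ℙ L (Fin (N + 1) → L)), IsClosed A →
      IsClosed {a : Fin n → ℙ L (Fin (N + 1) → L) | ∀ b ∈ D, Fin.append a b ∈ A} := by
    intro A hA
    have : {a : Fin n → ℙ L (Fin (N + 1) → L) | ∀ b ∈ D, Fin.append a b ∈ A} =
        ⋂ b ∈ D, (fun a => Fin.append a b) ⁻¹' A := by ext; simp
    rw [this]
    exact isClosed_biInter fun b _ => hA.preimage (continuous_append_left b)
  have h1 : C ⊆ {a | ∀ b ∈ D, Fin.append a b ∈ A} ∪ {a | ∀ b ∈ D, Fin.append a b ∈ B} := by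
    intro a ha
    refine (isPreirreducible_iff_isClosed_union_isClosed.mp hD.2 _ _
      (hA.preimage (continuous_append_right a)) (hB.preimage (continuous_append_right a))
      fun b hb => ?_).imp (fun h b hb => h hb) (fun h b hb => h hb)
    exact hAB (show Fin.append a b ∈ _ by simpa [fstProj_append, sndProj_append] using ⟨ha, hb⟩)
  refine (isPreirreducible_iff_isClosed_union_isClosed.mp hC.2 _ _ (key A hA) (key B hB) h1).imp
    (fun h x hx => ?_) (fun h x hx => ?_)
  · simpa [append_fstProj_sndProj] using h hx.1 _ hx.2
  · simpa [append_fstProj_sndProj] using h hx.1 _ hx.2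

end Maps

/-! ### Completeness: projections are closed maps. -/

section ClosedMap

universe u

variable {L : Type u} [Field L] {N n m r : ℕ}

attribute [local instance] zariskiTopology

/-- A polynomial in `n + 1` groups of variables, as a polynomial in the `i`-th group of variables
with coefficients in the polynomials in the other groups. -/
def splitGroup (i : Fin (n + 1)) : MvPolynomial (Fin (n + 1) × Fin (N + 1)) L →ₐ[L]
    MvPolynomial (Fin (N + 1)) (MvPolynomial (Fin n × Fin (N + 1)) L) :=
  MvPolynomial.aeval fun p => Fin.succAboveCases i (MvPolynomial.X p.2)
    (fun k => MvPolynomial.C (MvPolynomial.X (k, p.2))) p.1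

/-- Insertion of a vector in a tuple of vectors. -/
def insertVec (i : Fin (n + 1)) (y : Fin (N + 1) → L) (v : Fin n × Fin (N + 1) → L) :
    Fin (n + 1) × Fin (N + 1) → L :=
  fun p => Fin.succAboveCases i (y p.2) (fun k => v (k, p.2)) p.1

theorem eval_splitGroup (i : Fin (n + 1)) (y : Fin (N + 1) → L) (v : Fin n × Fin (N + 1) → L)
    (f : MvPolynomial (Fin (n + 1) × Fin (N + 1)) L) :
    MvPolynomial.eval y ((splitGroup i f).map (MvPolynomial.eval v)) =
      MvPolynomial.eval (insertVec i y v) f := by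
  induction f using MvPolynomial.induction_on with
  | C a => simp [splitGroup, MvPolynomial.algebraMap_apply]
  | add p q hp hq => simp only [map_add, hp, hq]
  | mul_X p q hp =>
    rw [map_mul, map_mul, map_mul, hp, map_mul]
    congr 1
    obtain ⟨k, j⟩ := q
    refine Fin.succAboveCases i ?_ (fun k => ?_) k <;> simp [splitGroup, insertVec]

theorem exists_isRep_insertVec {i : Fin (n + 1)} {y : Fin (N + 1) → L} {v : Fin n × Fin (N + 1) → L}
    {a : Fin n → ℙ L (Fin (N + 1) → L)} (hv : IsRep v a) (hy : y ≠ 0) :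
    ∃ x : Fin (n + 1) → ℙ L (Fin (N + 1) → L), IsRep (insertVec i y v) x ∧
      (fun k => x (i.succAbove k)) = a := by
  obtain ⟨x, hx⟩ : ∃ x, IsRep (insertVec i y v) x := exists_isRep fun k => by
    refine Fin.succAboveCases i ?_ (fun k => ?_) k
    · simpa [insertVec] using Function.ne_iff.mp hy
    · simpa [insertVec] using hv.exists_ne_zero k
  refine ⟨x, hx, ?_⟩
  have h : (fun p : Fin n × Fin (N + 1) => insertVec i y v (i.succAbove p.1, p.2)) = v := by
    ext p
    simp [insertVec]
  exact (h ▸ hx.comp i.succAbove).unique hv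

variable [IsAlgClosed L]

/-- Over a tuple outside the image, the equations of `C` in the omitted group have no nonzero
solution. Elimination gives `g` nonzero at that tuple; `g` must vanish on the image, since a point
of `C` supplies a nonzero solution along with all its multiples. -/
theorem isClosedMap_succAbove (i : Fin (n + 1)) :
    IsClosedMap (fun (x : Fin (n + 1) → ℙ L (Fin (N + 1) → L)) (j : Fin n) =>
      x (i.succAbove j)) := by
  intro C hC
  set D := (fun (x : Fin (n + 1) → ℙ L (Fin (N + 1) → L)) (j : Fin n) => x (i.succAbove j)) '' C
  refine isClosed_of_forall_isRep (coneIdeal D : Set _) fun a v hv => ?_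
  refine ⟨fun ha f hf => mem_coneIdeal.mp hf a ha v hv, fun h => ?_⟩
  by_contra ha
  obtain ⟨g, hg, hg'⟩ := exists_eval_ne_zero_of_no_solution
    (splitGroup i '' (coneIdeal C : Set (MvPolynomial (Fin (n + 1) × Fin (N + 1)) L))) v (by
      intro y hy
      by_contra hy0
      obtain ⟨x, hx, hxa⟩ := exists_isRep_insertVec (i := i) hv hy0
      refine ha ⟨x, (mem_iff_of_isClosed hC hx).mpr fun f hf => ?_, hxa⟩
      rw [← eval_splitGroup]
      exact hy _ ⟨f, hf, rfl⟩)
  refine hg (h g (mem_coneIdeal.mpr ?_))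
  rintro _ ⟨x, hx, rfl⟩ w hw
  by_contra hgw
  refine (x i).rep_nonzero (hg' w hgw _ ?_)
  rintro t ht _ ⟨f, hf, rfl⟩
  rw [eval_splitGroup]
  refine mem_coneIdeal.mp hf x hx _ ?_
  obtain ⟨s, hs⟩ := hw
  refine ⟨fun k => Fin.succAboveCases i (Units.mk0 t ht) s k, fun ⟨k, j⟩ => ?_⟩
  refine Fin.succAboveCases i ?_ (fun k => ?_) k
  · simp [insertVec]
  · simpa [insertVec] using hs (k, j)

theorem isClosedMap_fstProj : IsClosedMap (fstProj (M := ℙ L (Fin (N + 1) → L)) n r) := by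
  induction r with
  | zero => exact IsClosedMap.id
  | succ r ih =>
    have : fstProj (M := ℙ L (Fin (N + 1) → L)) n (r + 1) = fstProj n r ∘
        (fun (x : Fin (n + r + 1) → ℙ L (Fin (N + 1) → L)) (j : Fin (n + r)) =>
          x ((Fin.last (n + r)).succAbove j)) := by
      funext x i
      simp only [fstProj, Function.comp_apply, Fin.succAbove_last]
      rfl
    rw [this]
    exact ih.comp (isClosedMap_succAbove (Fin.last (n + r)))

end ClosedMap

/-! ## Dimension of fibres -/

section Fibres

universe u

variable {L : Type u} [Field L] {N n m r : ℕ}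

attribute [local instance] zariskiTopology

theorem IsMultihomogeneous.rename {F : MvPolynomial (Fin m × Fin (N + 1)) L} {d : Fin m → ℕ}
    (hF : IsMultihomogeneous F d) (φ : Fin m → Fin n) :
    ∃ d', IsMultihomogeneous (MvPolynomial.rename (fun p => (φ p.1, p.2)) F) d' := by
  refine ⟨⇑((Finsupp.equivFunOnFinite.symm d).mapDomain φ), fun u hu => ?_⟩
  obtain ⟨w, rfl, hw⟩ := MvPolynomial.coeff_rename_ne_zero _ _ _ hu
  have h1 := hF hw
  rw [← coe_mapDomain_fst] at h1 ⊢
  have h2 : w.mapDomain Prod.fst = Finsupp.equivFunOnFinite.symm d := by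
    rw [← h1]; ext; rfl
  rw [← h2, ← Finsupp.mapDomain_comp, ← Finsupp.mapDomain_comp]
  rfl

theorem hypersurface_rename {F : MvPolynomial (Fin m × Fin (N + 1)) L} {d : Fin m → ℕ}
    (hF : IsMultihomogeneous F d) (φ : Fin m → Fin n) :
    hypersurface (MvPolynomial.rename (fun p => (φ p.1, p.2)) F) =
      (fun x i => x (φ i)) ⁻¹' hypersurface F := by
  obtain ⟨d', hd'⟩ := hF.rename φ
  ext x
  rw [mem_hypersurface hd' (isRep_repVec x), Set.mem_preimage,
    mem_hypersurface hF ((isRep_repVec x).comp φ), MvPolynomial.eval_rename]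
  rfl

/-- Distinct points exclude `N = 0`. The two indices span the coordinate line used as target in
`inter_hypersurface_nonempty`. -/
theorem exists_ne_of_ne {p q : Fin n → ℙ L (Fin (N + 1) → L)} (h : p ≠ q) :
    ∃ j j' : Fin (N + 1), j ≠ j' := by
  by_contra! h0
  obtain ⟨i, hi⟩ := Function.ne_iff.mp h
  obtain ⟨j, hj⟩ := (isRep_repVec q).exists_ne_zero i
  apply hi
  rw [← (p i).mk_rep, ← (q i).mk_rep, Projectivization.mk_eq_mk_iff']
  refine ⟨(p i).rep j / (q i).rep j, ?_⟩
  ext l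
  rw [h0 l j, Pi.smul_apply, smul_eq_mul, div_mul_cancel₀ _ (show (q i).rep j ≠ 0 from hj)]

section

variable [Infinite L]

/-- A finite set of points is avoided by the zeros of some form of multidegree `(1, …, 1)`. -/
theorem exists_form_forall_ne_zero {ι : Type*} [Finite ι] (q : ι → Fin n → ℙ L (Fin (N + 1) → L)) :
    ∃ F : MvPolynomial (Fin n × Fin (N + 1)) L, IsMultihomogeneous F 1 ∧
      ∀ k, q k ∉ hypersurface F := by
  obtain ⟨F, hF, h⟩ := Module.Dual.exists_forall_mem_ne_zero_of_forall_exists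
    (MvPolynomial.weightedHomogeneousSubmodule L
      (fun p : Fin n × Fin (N + 1) => (Pi.single p.1 1 : Fin n → ℕ)) 1)
    (fun k => (MvPolynomial.aeval (R := L) (repVec (q k))).toLinearMap)
    (fun k => exists_form_ne_zero (q k))
  exact ⟨F, hF, fun k hk => h k (hk _ (isRep_repVec _))⟩

/-- Among the forms vanishing at `a`, those vanishing at a given `q k` form a proper subspace by
`exists_form_separating`; over an infinite field finitely many of these do not fill the space. -/
theorem exists_form_forall_ne_zero_of_ne {ι : Type*} [Finite ι] (a : Fin n → ℙ L (Fin (N + 1) → L))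
    (q : ι → Fin n → ℙ L (Fin (N + 1) → L)) (hq : ∀ k, q k ≠ a) :
    ∃ F : MvPolynomial (Fin n × Fin (N + 1)) L, IsMultihomogeneous F 1 ∧ a ∈ hypersurface F ∧
      ∀ k, q k ∉ hypersurface F := by
  obtain ⟨F, hF, h⟩ := Module.Dual.exists_forall_mem_ne_zero_of_forall_exists
    (MvPolynomial.weightedHomogeneousSubmodule L
      (fun p : Fin n × Fin (N + 1) => (Pi.single p.1 1 : Fin n → ℕ)) 1 ⊓
        LinearMap.ker (MvPolynomial.aeval (R := L) (repVec a)).toLinearMap)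
    (fun k => (MvPolynomial.aeval (R := L) (repVec (q k))).toLinearMap)
    (fun k => by
      obtain ⟨F, hF, h1, h2⟩ := exists_form_separating (hq k).symm
      exact ⟨F, ⟨hF, h1⟩, h2⟩)
  exact ⟨F, hF.1, (mem_hypersurface hF.1 (isRep_repVec a)).mpr hF.2,
    fun k hk => h k (hk _ (isRep_repVec _))⟩

end

variable [IsAlgClosed L]

/-- An irreducible closed set of positive dimension meets every hypersurface of multidegree
`(1, …, 1)`. -/
theorem inter_hypersurface_nonempty {C : Set (Fin n → ℙ L (Fin (N + 1) → L))} (hC : IsClosed C)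
    (hCi : IsIrreducible C) (hd : (1 : WithBot ℕ∞) ≤ dim C)
    {F : MvPolynomial (Fin n × Fin (N + 1)) L} (hF : IsMultihomogeneous F 1) :
    (C ∩ hypersurface F).Nonempty := by
  classical
  obtain ⟨p, hp, q, hq, hpq⟩ : ∃ p ∈ C, ∃ q ∈ C, p ≠ q := by
    obtain ⟨Z, Y, hZ, hZi, hY, hYi, hZY, hYC, -⟩ := exists_ssubset_of_natCast_succ_le_dim
      (k := 0) hC (by simpa using hd)
    obtain ⟨p, hp⟩ := hZi.nonempty
    obtain ⟨q, hq, hqZ⟩ := Set.exists_of_ssubset hZY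
    exact ⟨p, hYC (hZY.1 hp), q, hYC hq, fun h => hqZ (h ▸ hp)⟩
  by_contra hemp
  have hFne : ∀ x ∈ C, ∀ w, IsRep w x → MvPolynomial.eval w F ≠ 0 := fun x hx w hw h =>
    hemp ⟨x, hx, (mem_hypersurface hF hw).mpr h⟩
  obtain ⟨G, hG, hGp, hGq⟩ := exists_form_separating hpq
  obtain ⟨j, j', hjj⟩ := exists_ne_of_ne hpq
  -- The representative of `[s : t]` on the coordinate line spanned by the indices `j` and `j'`.
  let e : L → L → Fin 1 × Fin (N + 1) → L := fun s t i =>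
    if i.2 = j then s else if i.2 = j' then t else 0
  let ψ : MvPolynomial (Fin n × Fin (N + 1)) L →ₐ[L]
    MvPolynomial (Fin (1 + n) × Fin (N + 1)) L := MvPolynomial.rename fun p => (Fin.natAdd 1 p.1, p.2)
  -- If `F` has no zero on `C`, this is the graph of `x ↦ [G(x) : F(x)]` from `C` to the line, with
  -- the target written first.
  let D : Set (Fin (1 + n) → ℙ L (Fin (N + 1) → L)) := sndProj 1 n ⁻¹' C ∩
    ((⋂ k ∈ {k | k ≠ j ∧ k ≠ j'}, hypersurface (MvPolynomial.X (Fin.castAdd n 0, k))) ∩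
      hypersurface (MvPolynomial.X (Fin.castAdd n 0, j) * ψ F -
        MvPolynomial.X (Fin.castAdd n 0, j') * ψ G))
  have hD : IsClosed D := (hC.preimage continuous_sndProj).inter
    ((isClosed_biInter fun k _ => isClosed_hypersurface _).inter (isClosed_hypersurface _))
  have hY := isClosedMap_fstProj D hD
  have hmem : ∀ s t y x w, IsRep (e s t) y → x ∈ C → IsRep w x →
      s * MvPolynomial.eval w F = t * MvPolynomial.eval w G → y ∈ fstProj 1 n '' D := by
    intro s t y x w hy hx hw h
    refine ⟨Fin.append y x, ?_, fstProj_append y x⟩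
    have key : ∀ v, IsRep v (Fin.append y x) → ∃ l : L, ∃ c : L,
        (∀ k, v (Fin.castAdd n 0, k) = l * e s t (0, k)) ∧
        MvPolynomial.eval v (ψ F) = c * MvPolynomial.eval w F ∧
        MvPolynomial.eval v (ψ G) = c * MvPolynomial.eval w G := by
      intro v hv
      obtain ⟨μ, hμ⟩ := (hy.append hw).exists_scale hv
      have h2 : (v ∘ fun p : Fin n × Fin (N + 1) => (Fin.natAdd 1 p.1, p.2)) =
          fun p => (μ (Fin.natAdd 1 p.1) : L) * w p := by
        ext p
        simp [hμ, appendVec]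
      refine ⟨μ (Fin.castAdd n 0), ∏ i, (μ (Fin.natAdd 1 i) : L) ^ (1 : Fin n → ℕ) i,
        fun k => ?_, ?_, ?_⟩
      · simp only [hμ, appendVec, Fin.addCases_left]
      · rw [MvPolynomial.eval_rename, h2, ← hF.eval_scale w (fun i => (μ (Fin.natAdd 1 i) : L))]
      · rw [MvPolynomial.eval_rename, h2, ← hG.eval_scale w (fun i => (μ (Fin.natAdd 1 i) : L))]
    refine ⟨?_, Set.mem_iInter₂.mpr fun k hk v hv => ?_, fun v hv => ?_⟩
    · rw [Set.mem_preimage, sndProj_append]; exact hx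
    · obtain ⟨l, c, h1, -, -⟩ := key v hv
      rw [MvPolynomial.eval_X, h1]
      simp [e, hk.1, hk.2]
    · obtain ⟨l, c, h1, h2, h3⟩ := key v hv
      rw [map_sub, map_mul, map_mul, MvPolynomial.eval_X, MvPolynomial.eval_X, h1, h1, h2, h3]
      simp only [e, if_true, if_neg hjj.symm]
      linear_combination l * c * h
  -- The image of the graph is closed and misses `[1 : 0]`, where `F` would have to vanish. Hence a
  -- polynomial vanishes on the image but not at `[1 : 0]`.
  obtain ⟨f, hf, hf0⟩ : ∃ f ∈ coneIdeal (fstProj 1 n '' D), MvPolynomial.eval (e 1 0) f ≠ 0 := by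
    obtain ⟨y, hy⟩ : ∃ y, IsRep (e 1 0) y := exists_isRep fun i => ⟨j, by simp [e]⟩
    by_contra! h
    obtain ⟨z, hz, rfl⟩ := (mem_iff_of_isClosed hY hy).mpr h
    have h1 := hz.2.2 _ ((append_fstProj_sndProj z) ▸ hy.append (isRep_repVec (sndProj 1 n z)))
    rw [map_sub, map_mul, map_mul, MvPolynomial.eval_X, MvPolynomial.eval_X,
      MvPolynomial.eval_rename, MvPolynomial.eval_rename] at h1
    simp only [appendVec, Fin.addCases_left, e, if_true, if_neg hjj.symm] at h1
    refine hFne _ hz.1 (repVec (sndProj 1 n z)) (isRep_repVec _) ?_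
    rw [one_mul, zero_mul, sub_zero] at h1
    rw [← h1]
    congr 1
    congr 1
    ext p
    simp [appendVec]
  let φ : Polynomial L := MvPolynomial.aeval (fun i => Polynomial.C (e 1 0 i) +
    Polynomial.X * Polynomial.C (e 0 1 i)) f
  have hφ : ∀ t, φ.eval t = MvPolynomial.eval (e 1 t) f := by
    intro t
    rw [← Polynomial.coe_aeval_eq_eval, MvPolynomial.comp_aeval_apply]
    refine congrArg (fun z => MvPolynomial.eval z f) (funext fun i => ?_)
    simp only [e, map_add, map_mul, Polynomial.aeval_C, Polynomial.aeval_X]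
    split_ifs <;> simp
  have hφ0 : φ ≠ 0 := by
    intro h
    apply hf0
    rw [← hφ, h, Polynomial.eval_zero]
  -- Where `G ≠ 0`, the ratio `F / G` is a root of the nonzero polynomial `φ`, so it takes finitely
  -- many values. By irreducibility either `G = 0` on `C`, which fails at `q`, or `F = ρ G` on `C`,
  -- which fails at `p`.
  have hcov : C ⊆ ⋃₀ (insert (hypersurface G)
      ((fun ρ => hypersurface (F - MvPolynomial.C ρ * G)) '' φ.roots.toFinset)) := by
    intro x hx
    by_cases hGx : MvPolynomial.eval (repVec x) G = 0
    · exact ⟨_, Set.mem_insert _ _, (mem_hypersurface hG (isRep_repVec x)).mpr hGx⟩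
    · refine ⟨_, Set.mem_insert_of_mem _ ⟨MvPolynomial.eval (repVec x) F /
        MvPolynomial.eval (repVec x) G, ?_, rfl⟩, ?_⟩
      · rw [Finset.mem_coe, Multiset.mem_toFinset, Polynomial.mem_roots hφ0, Polynomial.IsRoot, hφ]
        obtain ⟨y, hy⟩ : ∃ y, IsRep (e 1 (MvPolynomial.eval (repVec x) F /
          MvPolynomial.eval (repVec x) G)) y := exists_isRep fun i => ⟨j, by simp [e]⟩
        refine mem_coneIdeal.mp hf y (hmem _ _ y x _ hy hx (isRep_repVec x) ?_) _ hy
        field_simp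
      · refine (mem_hypersurface (hF.sub (hG.C_mul _)) (isRep_repVec x)).mpr ?_
        rw [map_sub, map_mul, MvPolynomial.eval_C]
        field_simp
        ring
  have hfin : (insert (hypersurface G)
      ((fun ρ => hypersurface (F - MvPolynomial.C ρ * G)) '' (φ.roots.toFinset : Set L))).Finite :=
    ((Finset.finite_toSet _).image _).insert _
  obtain ⟨Z, hZ, hCZ⟩ := isIrreducible_iff_sUnion_isClosed.mp hCi hfin.toFinset
    (by
      intro Z hZ
      rw [Set.Finite.mem_toFinset] at hZ
      rcases hZ with rfl | ⟨ρ, -, rfl⟩ <;> exact isClosed_hypersurface _)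
    (by rwa [Set.Finite.coe_toFinset])
  rw [Set.Finite.mem_toFinset] at hZ
  rcases hZ with rfl | ⟨ρ, -, rfl⟩
  · exact hGq (hCZ hq _ (isRep_repVec q))
  · have := hCZ hp _ (isRep_repVec p)
    rw [map_sub, map_mul, hGp, mul_zero, sub_zero] at this
    exact hFne p hp _ (isRep_repVec p) this

end Fibres

/-! ## Fibre dimension: cutting by hypersurfaces -/

section FibreDimension

universe u

variable {L : Type u} [Field L] {N n m r : ℕ}

attribute [local instance] zariskiTopology

open TopologicalSpace

theorem exists_natCast_eq_of_lt_top {a : WithBot ℕ∞} (h0 : 0 ≤ a) (h : a < ⊤) :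
    ∃ k : ℕ, a = k := by
  induction a with
  | bot => simp at h0
  | coe a =>
    induction a with
    | top => simp at h
    | coe a => exact ⟨a, rfl⟩

theorem exists_irreducible_cover {C : Set (Fin n → ℙ L (Fin (N + 1) → L))}
    (hC : IsClosed C) : ∃ S : Set (Set (Fin n → ℙ L (Fin (N + 1) → L))), S.Finite ∧
      (∀ Z ∈ S, IsClosed Z ∧ IsIrreducible Z ∧ Z ⊆ C) ∧
      ∀ W, IsIrreducible W → W ⊆ C → ∃ Z ∈ S, W ⊆ Z := by
  have := noetherianSpace_tuple (L := L) (N := N) (n := n)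
  obtain ⟨S, hSf, hSc, hSi, hSu⟩ := NoetherianSpace.exists_finite_set_isClosed_irreducible hC
  refine ⟨S, hSf, fun Z hZ => ⟨hSc Z hZ, hSi Z hZ, hSu ▸ Set.subset_sUnion_of_mem hZ⟩, ?_⟩
  intro W hW hWC
  obtain ⟨Z, hZ, hWZ⟩ := isIrreducible_iff_sUnion_isClosed.mp hW hSf.toFinset
    (fun Z hZ => hSc Z (by simpa using hZ)) (by rwa [Set.Finite.coe_toFinset, ← hSu])
  exact ⟨Z, by simpa using hZ, hWZ⟩

variable [IsAlgClosed L]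

theorem dim_singleton (a : Fin n → ℙ L (Fin (N + 1) → L)) :
    dim ({a} : Set (Fin n → ℙ L (Fin (N + 1) → L))) = 0 := by
  obtain ⟨k, hk, h⟩ := exists_natCast_eq_dim (isClosed_singleton_tuple a) isIrreducible_singleton
  rw [ringDim_coneIdeal_singleton] at h
  obtain rfl : k = 0 := by omega
  simpa using hk

theorem dim_tuple_lt_top {C : Set (Fin n → ℙ L (Fin (N + 1) → L))}
    (hC : IsClosed C) : dim C < ⊤ := by
  have : dim C ≤ (ringDim (⊥ : Ideal (MvPolynomial (Fin n × Fin (N + 1)) L)) : ℕ) := by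
    refine le_of_forall_natCast_le fun k hk => ?_
    obtain ⟨Z, hZ, hZi, -, hk⟩ := exists_irreducible_of_natCast_le_dim hC hk
    have := coneIdeal_isPrime hZi
    have h1 := (natCast_le_dim_iff_ringDim hZ hZi k).mp hk
    have h2 := ringDim_le_of_le (bot_le : ⊥ ≤ coneIdeal Z)
    exact_mod_cast (by omega : k ≤ _)
  exact this.trans_lt (WithBot.coe_lt_coe.mpr (ENat.natCast_lt_top _))

/-- A general hypersurface cuts the dimension down by at least one. -/
theorem exists_form_dim_inter_lt (φ : Fin m → Fin n)
    {C : Set (Fin n → ℙ L (Fin (N + 1) → L))} (hC : IsClosed C) {k : ℕ}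
    (hk : dim C < ((k + 1 : ℕ) : WithBot ℕ∞)) :
    ∃ F : MvPolynomial (Fin m × Fin (N + 1)) L, IsMultihomogeneous F 1 ∧
      dim (C ∩ (fun x i => x (φ i)) ⁻¹' hypersurface F) < k := by
  obtain ⟨S, hSf, hS, hcov⟩ := exists_irreducible_cover hC
  have := hSf.to_subtype
  -- One point on each piece of a finite irreducible cover: a form avoiding their projections
  -- contains no piece.
  choose p hp using fun Z : S => (hS Z Z.2).2.1.nonempty
  obtain ⟨F, hF, hFp⟩ := exists_form_forall_ne_zero (fun (Z : S) i => p Z (φ i))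
  refine ⟨F, hF, ?_⟩
  by_contra! h
  have hcl : IsClosed (C ∩ (fun x i => x (φ i)) ⁻¹' hypersurface F) :=
    hC.inter ((isClosed_hypersurface F).preimage (continuous_comp φ))
  obtain ⟨W, hW, hWi, hWC, hWk⟩ := exists_irreducible_of_natCast_le_dim hcl h
  obtain ⟨Z, hZ, hWZ⟩ := hcov W hWi (hWC.trans Set.inter_subset_left)
  have hss : W ⊂ Z := ⟨hWZ, fun h => hFp ⟨Z, hZ⟩ (hWC (h (hp ⟨Z, hZ⟩))).2⟩
  exact absurd ((natCast_succ_le_dim_of_ssubset hW (hS Z hZ).1 (hS Z hZ).2.1 hss hWk).trans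
    (dim_le_dim_of_subset (hS Z hZ).2.2)) (not_le.mpr hk)

/-- Iterated general sections. The strict bound makes `k = 0` the statement that the section is
empty. -/
theorem exists_forms_dim_inter_lt (φ : Fin m → Fin n) (e : ℕ) :
    ∀ {C : Set (Fin n → ℙ L (Fin (N + 1) → L))}, IsClosed C → ∀ {k : ℕ},
    dim C < ((k + e : ℕ) : WithBot ℕ∞) →
    ∃ F : Fin e → MvPolynomial (Fin m × Fin (N + 1)) L, (∀ i, IsMultihomogeneous (F i) 1) ∧
      dim (C ∩ ⋂ i, (fun x i => x (φ i)) ⁻¹' hypersurface (F i)) < k := by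
  induction e with
  | zero => intro C hC k hk; exact ⟨Fin.elim0, fun i => i.elim0, by simpa using hk⟩
  | succ e ih =>
    intro C hC k hk
    obtain ⟨F, hF, h⟩ := exists_form_dim_inter_lt φ hC (k := k + e) hk
    obtain ⟨G, hG, h'⟩ := ih (hC.inter ((isClosed_hypersurface F).preimage (continuous_comp φ))) h
    refine ⟨Fin.cons F G, Fin.cases hF hG, (dim_le_dim_of_subset ?_).trans_lt h'⟩
    intro x hx
    have h2 := Set.mem_iInter.mp hx.2
    exact ⟨⟨hx.1, h2 0⟩, Set.mem_iInter.mpr fun i => h2 i.succ⟩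

/-- Hypersurfaces through a point cutting a closed set down to that point, locally. -/
theorem exists_forms_inter_eq_singleton (a : Fin n → ℙ L (Fin (N + 1) → L)) (e : ℕ) :
    ∀ {D : Set (Fin n → ℙ L (Fin (N + 1) → L))}, IsClosed D →
    (∀ W, IsClosed W → IsIrreducible W → a ∈ W → W ⊆ D → dim W ≤ e) →
    ∃ F : Fin e → MvPolynomial (Fin n × Fin (N + 1)) L,
      (∀ i, IsMultihomogeneous (F i) 1) ∧ (∀ i, a ∈ hypersurface (F i)) ∧
      ∀ W, IsClosed W → IsIrreducible W → a ∈ W → W ⊆ D → (∀ i, W ⊆ hypersurface (F i)) →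
        W = {a} := by
  induction e with
  | zero =>
    intro D hD h
    refine ⟨Fin.elim0, fun i => i.elim0, fun i => i.elim0, fun W hW hWi haW hWD _ => ?_⟩
    by_contra hne
    have hss : {a} ⊂ W := (Set.singleton_subset_iff.mpr haW).ssubset_of_ne (Ne.symm hne)
    have h1 := natCast_succ_le_dim_of_ssubset (isClosed_singleton_tuple a) hW hWi hss (k := 0)
      (by rw [dim_singleton]; rfl)
    exact absurd (h1.trans (h W hW hWi haW hWD)) (by simp)
  | succ e ih =>
    intro D hD h
    obtain ⟨S, hSf, hS, hcov⟩ := exists_irreducible_cover hD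
    have := (hSf.subset (Set.sep_subset S fun Z => Z ≠ {a})).to_subtype
    have hq : ∀ Z : {Z | Z ∈ S ∧ Z ≠ {a}}, ∃ q ∈ (Z : Set _), q ≠ a := by
      intro Z
      by_contra! h0
      exact Z.2.2 ((Set.eq_singleton_iff_nonempty_unique_mem).mpr
        ⟨(hS Z Z.2.1).2.1.nonempty, h0⟩)
    choose q hqZ hqa using hq
    -- The form passes through `a` but contains no piece other than possibly `{a}`, so the bound on
    -- irreducible sets through `a` decreases by one.
    obtain ⟨F, hF, haF, hFq⟩ := exists_form_forall_ne_zero_of_ne a q hqa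
    obtain ⟨G, hG, haG, hGW⟩ := ih (hD.inter (isClosed_hypersurface F)) (by
      intro W hW hWi haW hWD
      obtain ⟨Z, hZ, hWZ⟩ := hcov W hWi (hWD.trans Set.inter_subset_left)
      by_cases hZa : Z = {a}
      · subst hZa
        refine (dim_le_dim_of_subset hWZ).trans ?_
        rw [dim_singleton]
        exact_mod_cast Nat.zero_le e
      · have hss : W ⊂ Z := ⟨hWZ, fun h => hFq ⟨Z, hZ, hZa⟩ (hWD (h (hqZ ⟨Z, hZ, hZa⟩))).2⟩
        obtain ⟨k, hk, -⟩ := exists_natCast_eq_dim hW hWi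
        have h1 := (natCast_succ_le_dim_of_ssubset hW (hS Z hZ).1 (hS Z hZ).2.1 hss hk.ge).trans
          (h Z (hS Z hZ).1 (hS Z hZ).2.1 (hWZ haW) (hS Z hZ).2.2)
        rw [hk]
        exact_mod_cast Nat.le_of_succ_le_succ (by exact_mod_cast h1))
    refine ⟨Fin.cons F G, Fin.cases hF hG, Fin.cases haF haG, fun W hW hWi haW hWD hWF => ?_⟩
    exact hGW W hW hWi haW (Set.subset_inter hWD (hWF 0)) fun i => hWF i.succ

theorem inter_hypersurfaces_nonempty (k : ℕ) : ∀ {C : Set (Fin n → ℙ L (Fin (N + 1) → L))},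
    IsClosed C → (k : WithBot ℕ∞) ≤ dim C → ∀ F : Fin k → MvPolynomial (Fin n × Fin (N + 1)) L,
    (∀ i, IsMultihomogeneous (F i) 1) → (C ∩ ⋂ i, hypersurface (F i)).Nonempty := by
  have key : ∀ k : ℕ, ∀ {C : Set (Fin n → ℙ L (Fin (N + 1) → L))},
      IsClosed C → IsIrreducible C → (k : WithBot ℕ∞) ≤ dim C →
      ∀ F : Fin k → MvPolynomial (Fin n × Fin (N + 1)) L,
      (∀ i, IsMultihomogeneous (F i) 1) → (C ∩ ⋂ i, hypersurface (F i)).Nonempty := by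
    intro k
    induction k with
    | zero => intro C hC hCi hk F hF; simpa using hCi.nonempty
    | succ k ih =>
      intro C hC hCi hk F hF
      obtain ⟨p, hp, hpF⟩ := inter_hypersurface_nonempty hC hCi
        (le_trans (by exact_mod_cast Nat.succ_le_succ (Nat.zero_le k)) hk) (hF 0)
      obtain ⟨W, hW, hWi, -, hWC, hWF, hdim⟩ := exists_component_dim_le hC hCi
        (isIrreducible_singleton (x := p)) (Set.singleton_subset_iff.mpr hp) (r := 1)
        (fun _ => F 0) (fun _ => ⟨_, hF 0⟩) (fun _ => Set.singleton_subset_iff.mpr hpF)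
      obtain ⟨l, hl, -⟩ := exists_natCast_eq_dim hW hWi
      have hkl : (k : WithBot ℕ∞) ≤ dim W := by
        rw [hl] at hdim ⊢
        have h1 := hk.trans hdim
        exact_mod_cast Nat.le_of_succ_le_succ (by exact_mod_cast h1)
      obtain ⟨x, hxW, hx⟩ := ih hW hWi hkl (fun i => F i.succ) fun i => hF i.succ
      exact ⟨x, hWC hxW, Set.mem_iInter.mpr (Fin.cases (hWF 0 hxW) (Set.mem_iInter.mp hx))⟩
  intro C hC hk F hF
  obtain ⟨Z, hZ, hZi, hZC, hkZ⟩ := exists_irreducible_of_natCast_le_dim hC hk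
  exact (key k hZ hZi hkZ F hF).mono (Set.inter_subset_inter_left _ hZC)

/-- Each form cuts a component by at most one dimension and meets it as long as it is
positive-dimensional; conversely, if `dim C < k`, then `k` general forms leave nothing. -/
theorem natCast_le_dim_iff_inter_hypersurfaces {C : Set (Fin n → ℙ L (Fin (N + 1) → L))}
    (hC : IsClosed C) {k : ℕ} : (k : WithBot ℕ∞) ≤ dim C ↔
      ∀ F : Fin k → MvPolynomial (Fin n × Fin (N + 1)) L,
        (∀ i, IsMultihomogeneous (F i) 1) → (C ∩ ⋂ i, hypersurface (F i)).Nonempty := by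
  refine ⟨fun h => inter_hypersurfaces_nonempty k hC h, fun h => ?_⟩
  by_contra! hk
  obtain ⟨F, hF, hd⟩ := exists_forms_dim_inter_lt id k hC (k := 0) (by simpa using hk)
  have h1 := zero_le_dim (h F hF)
  exact absurd h1 (not_le.mpr (by simpa using hd))

/-- By the criterion above, the locus is the intersection, over all systems of `k + 1` forms in the
fibre coordinates, of the projections of the corresponding sections of `C`; these are closed. -/
theorem isClosed_setOf_lt_dim_fibre {C : Set (Fin (n + r) → ℙ L (Fin (N + 1) → L))}
    (hC : IsClosed C) (k : ℕ) : IsClosed {a | (k : WithBot ℕ∞) < dim (fibre C a)} := by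
  have : {a | (k : WithBot ℕ∞) < dim (fibre C a)} =
      ⋂ F ∈ {F : Fin (k + 1) → MvPolynomial (Fin r × Fin (N + 1)) L |
        ∀ i, IsMultihomogeneous (F i) 1},
        fstProj n r '' (C ∩ ⋂ i, sndProj n r ⁻¹' hypersurface (F i)) := by
    ext a
    rw [Set.mem_ofPred_eq, ← natCast_succ_le_iff,
      natCast_le_dim_iff_inter_hypersurfaces (isClosed_fibre_tuple hC a), Set.mem_iInter₂]
    refine forall₂_congr fun F hF => ⟨?_, ?_⟩
    · rintro ⟨b, hb, hbF⟩
      refine ⟨Fin.append a b, ⟨hb, Set.mem_iInter.mpr fun i => ?_⟩, fstProj_append a b⟩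
      rw [Set.mem_preimage, sndProj_append]
      exact Set.mem_iInter.mp hbF i
    · rintro ⟨x, ⟨hx, hxF⟩, rfl⟩
      refine ⟨sndProj n r x, ?_, Set.mem_iInter.mpr fun i => Set.mem_iInter.mp hxF i⟩
      rw [fibre, Set.mem_ofPred_eq, append_fstProj_sndProj]
      exact hx
  rw [this]
  exact isClosed_biInter fun F _ => isClosedMap_fstProj _ (hC.inter (isClosed_iInter fun i =>
    (isClosed_hypersurface _).preimage continuous_sndProj))

/-- Pull back `dim pr(C)` forms that isolate `a` on the base. A component of their section through a
point above `a` has lost at most that many dimensions, and it projects onto `{a}`, so it lies in the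
fibre. -/
theorem dim_le_dim_fibre_add {C : Set (Fin (n + r) → ℙ L (Fin (N + 1) → L))}
    (hC : IsClosed C) (hCi : IsIrreducible C) {a : Fin n → ℙ L (Fin (N + 1) → L)}
    (ha : a ∈ fstProj n r '' C) : dim C ≤ dim (fibre C a) + dim (fstProj n r '' C) := by
  obtain ⟨c, hc, rfl⟩ := ha
  have hpr := isClosedMap_fstProj C hC
  have hpri : IsIrreducible (fstProj n r '' C) := hCi.image _ continuous_fstProj.continuousOn
  obtain ⟨e, he, -⟩ := exists_natCast_eq_dim hpr hpri
  obtain ⟨F, hF, haF, hFW⟩ := exists_forms_inter_eq_singleton (fstProj n r c) e hpr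
    fun W _ _ _ hW => (dim_le_dim_of_subset hW).trans_eq he
  obtain ⟨G, hG, hGF⟩ : ∃ G : Fin e → MvPolynomial (Fin (n + r) × Fin (N + 1)) L,
      (∀ i, ∃ d, IsMultihomogeneous (G i) d) ∧
      ∀ i, hypersurface (G i) = fstProj n r ⁻¹' hypersurface (F i) :=
    ⟨_, fun i => (hF i).rename (Fin.castAdd r), fun i => hypersurface_rename (hF i) (Fin.castAdd r)⟩
  obtain ⟨W, hW, hWi, hcW, hWC, hWF, hdim⟩ := exists_component_dim_le hC hCi
    (isIrreducible_singleton (x := c)) (Set.singleton_subset_iff.mpr hc) G hG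
    (fun i => by rw [hGF, Set.singleton_subset_iff]; exact haF i)
  have hprW : fstProj n r '' W = {fstProj n r c} := by
    refine hFW _ (isClosedMap_fstProj W hW) (hWi.image _ continuous_fstProj.continuousOn)
      ⟨c, Set.singleton_subset_iff.mp hcW, rfl⟩ (Set.image_mono hWC) fun i => ?_
    rw [Set.image_subset_iff, ← hGF]
    exact hWF i
  have hsub : W ⊆ (fun b => Fin.append (fstProj n r c) b) '' fibre C (fstProj n r c) := by
    intro x hx
    have h1 : fstProj n r x = fstProj n r c := by
      have h2 : fstProj n r x ∈ fstProj n r '' W := Set.mem_image_of_mem _ hx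
      rwa [hprW] at h2
    have h2 : Fin.append (fstProj n r c) (sndProj n r x) = x := by
      rw [← h1, append_fstProj_sndProj]
    refine ⟨sndProj n r x, ?_, h2⟩
    rw [fibre, Set.mem_ofPred_eq, h2]
    exact hWC hx
  have hle : dim W ≤ dim (fibre C (fstProj n r c)) :=
    (dim_le_dim_of_subset hsub).trans_eq (dim_image_of_isEmbedding (isEmbedding_append _) _)
  rw [he]
  exact hdim.trans (by gcongr)

/-- If `dim C` were smaller, `e` general forms in the fibre coordinates would cut it below `dim
pr(C)`. But every fibre over `pr(C)` meets these forms, so the section still maps onto `pr(C)`, and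
closed maps do not raise dimension. -/
theorem dim_add_le_of_forall_le_dim_fibre {C : Set (Fin (n + r) → ℙ L (Fin (N + 1) → L))}
    (hC : IsClosed C) {e : ℕ}
    (h : ∀ a ∈ fstProj n r '' C, (e : WithBot ℕ∞) ≤ dim (fibre C a)) :
    dim (fstProj n r '' C) + e ≤ dim C := by
  rcases C.eq_empty_or_nonempty with rfl | hne
  · simp [dim_empty]
  obtain ⟨p, hp⟩ := exists_natCast_eq_of_lt_top (zero_le_dim (hne.image (fstProj n r)))
    (dim_tuple_lt_top (isClosedMap_fstProj C hC))
  by_contra! hlt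
  rw [hp] at hlt
  obtain ⟨F, hF, hd⟩ := exists_forms_dim_inter_lt (Fin.natAdd n) e hC (k := p)
    (by exact_mod_cast hlt)
  have := noetherianSpace_tuple (L := L) (N := N) (n := n + r)
  have h1 := dim_image_le continuous_fstProj isClosedMap_fstProj
    (hC.inter (isClosed_iInter fun i =>
      (isClosed_hypersurface (F i)).preimage (continuous_comp (Fin.natAdd n))))
  refine absurd ((dim_le_dim_of_subset ?_).trans h1) (not_le.mpr (hp ▸ hd))
  intro a ha
  obtain ⟨b, hb, hbF⟩ := inter_hypersurfaces_nonempty e (isClosed_fibre_tuple hC a) (h a ha) F hF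
  refine ⟨Fin.append a b, ⟨hb, Set.mem_iInter.mpr fun i => ?_⟩, fstProj_append a b⟩
  have := Set.mem_iInter.mp hbF i
  rw [← sndProj_append a b] at this
  exact this

theorem exists_isLeast_dim_fibre {C : Set (Fin (n + r) → ℙ L (Fin (N + 1) → L))}
    (hC : IsClosed C) (hCi : IsIrreducible C) :
    ∃ d, IsLeast ((fun a => dim (fibre C a)) '' (fstProj n r '' C)) d ∧
      dim C = dim (fstProj n r '' C) + d := by
  obtain ⟨d, ⟨a, ha, rfl⟩, hd⟩ := WellFounded.has_min (r := ((· < ·) : WithBot ℕ∞ → _ → Prop))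
    wellFounded_lt ((fun a => dim (fibre C a)) '' (fstProj n r '' C))
    ((hCi.nonempty.image _).image _)
  obtain ⟨x, hx, rfl⟩ := ha
  have hne : (fibre C (fstProj n r x)).Nonempty :=
    ⟨sndProj n r x, by rw [fibre, Set.mem_ofPred_eq, append_fstProj_sndProj]; exact hx⟩
  obtain ⟨e, he⟩ := exists_natCast_eq_of_lt_top (zero_le_dim hne)
    (dim_tuple_lt_top (isClosed_fibre_tuple hC _))
  have hmin : ∀ a ∈ fstProj n r '' C, dim (fibre C (fstProj n r x)) ≤ dim (fibre C a) :=
    fun a ha => not_lt.mp (hd _ ⟨a, ha, rfl⟩)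
  refine ⟨_, ⟨⟨_, ⟨x, hx, rfl⟩, rfl⟩, ?_⟩, le_antisymm ?_ ?_⟩
  · rintro _ ⟨a, ha, rfl⟩
    exact hmin a ha
  · exact (dim_le_dim_fibre_add hC hCi ⟨x, hx, rfl⟩).trans_eq (add_comm _ _)
  · simp only [he] at hmin ⊢
    exact dim_add_le_of_forall_le_dim_fibre hC hmin

theorem dim_prod {C : Set (Fin n → ℙ L (Fin (N + 1) → L))}
    {D : Set (Fin r → ℙ L (Fin (N + 1) → L))} (hC : IsClosed C) (hCi : IsIrreducible C)
    (hD : IsClosed D) (hDi : IsIrreducible D) :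
    dim {x | fstProj n r x ∈ C ∧ sndProj n r x ∈ D} = dim C + dim D := by
  obtain ⟨d, ⟨⟨a, ha, rfl⟩, -⟩, hd⟩ := exists_isLeast_dim_fibre (isClosed_prod_tuple hC hD)
    (isIrreducible_prod hCi hDi)
  obtain ⟨x, hx, rfl⟩ := ha
  have h1 : fstProj n r '' {x | fstProj n r x ∈ C ∧ sndProj n r x ∈ D} = C := by
    refine Set.Subset.antisymm (Set.image_subset_iff.mpr fun y hy => hy.1) fun y hy => ?_
    obtain ⟨z, hz⟩ := hDi.nonempty
    exact ⟨Fin.append y z, by simpa [fstProj_append, sndProj_append] using ⟨hy, hz⟩,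
      fstProj_append y z⟩
  have h2 : fibre {x | fstProj n r x ∈ C ∧ sndProj n r x ∈ D} (fstProj n r x) = D := by
    ext b
    simp only [fibre, Set.mem_ofPred_eq, fstProj_append, sndProj_append]
    exact and_iff_right hx.1
  rw [hd, h1]
  exact congrArg (fun E => dim C + dim E) h2

end FibreDimension

/-! ## Local equations of the diagonal of a smooth variety -/

section LocalEquations

universe u

variable {L : Type u} [Field L] {N n m : ℕ}

/-- The increments of a polynomial as combinations of the increments of the variables. -/
theorem exists_increment {σ : Type*} [Fintype σ] [DecidableEq σ] (f : MvPolynomial σ L) :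
    ∃ A : σ → MvPolynomial (σ ⊕ σ) L,
      (∀ x y : σ → L, MvPolynomial.eval y f - MvPolynomial.eval x f =
        ∑ k, MvPolynomial.eval (Sum.elim x y) (A k) * (y k - x k)) ∧
      ∀ (x : σ → L) k, MvPolynomial.eval (Sum.elim x x) (A k) =
        MvPolynomial.eval x (MvPolynomial.pderiv k f) := by
  induction f using MvPolynomial.induction_on with
  | C a => exact ⟨0, by simp, by simp⟩
  | add f g hf hg =>
    obtain ⟨A, hA, hA'⟩ := hf
    obtain ⟨B, hB, hB'⟩ := hg
    refine ⟨A + B, fun x y => ?_, fun x k => by simp [hA', hB']⟩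
    simp only [Pi.add_apply, map_add, add_mul, Finset.sum_add_distrib, ← hA, ← hB]
    ring
  | mul_X f i hf =>
    obtain ⟨A, hA, hA'⟩ := hf
    -- From `f(y) y_i - f(x) x_i = y_i (f(y) - f(x)) + f(x) (y_i - x_i)`.
    refine ⟨fun k => A k * MvPolynomial.X (Sum.inr i) +
      if k = i then MvPolynomial.rename Sum.inl f else 0, fun x y => ?_, fun x k => ?_⟩
    · have h1 : ∀ k, MvPolynomial.eval (Sum.elim x y) (A k * MvPolynomial.X (Sum.inr i) +
          if k = i then MvPolynomial.rename Sum.inl f else 0) * (y k - x k) =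
          y i * (MvPolynomial.eval (Sum.elim x y) (A k) * (y k - x k)) +
          if k = i then MvPolynomial.eval x f * (y i - x i) else 0 := by
        intro k
        split_ifs with h
        · subst h
          simp only [map_add, map_mul, MvPolynomial.eval_X, Sum.elim_inr, MvPolynomial.eval_rename,
            Sum.elim_comp_inl]
          ring
        · simp only [map_add, map_mul, MvPolynomial.eval_X, Sum.elim_inr, map_zero]
          ring
      simp only [h1, Finset.sum_add_distrib, ← Finset.mul_sum, ← hA, Finset.sum_ite_eq',
        Finset.mem_univ, if_true, map_mul, MvPolynomial.eval_X]
      ring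
    · rw [Derivation.leibniz, MvPolynomial.pderiv_X]
      by_cases h : k = i
      · subst h
        simp [hA', MvPolynomial.eval_rename]
        ring
      · simp [hA', h, Ne.symm h, mul_comm]

theorem eval_smul_rep_eq_zero {V : Set (ℙ L (Fin (N + 1) → L))} {P : ℙ L (Fin (N + 1) → L)}
    (hP : P ∈ V) {f : MvPolynomial (Fin (N + 1)) L} (hf : f ∈ idealOf V) {c : L} (hc : c ≠ 0) :
    MvPolynomial.eval (c • P.rep) f = 0 := by
  refine MvPolynomial.mem_vanishingIdeal_iff.mp hf _ ⟨smul_ne_zero hc P.rep_nonzero, ?_⟩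
  have : Projectivization.mk L (c • P.rep) (smul_ne_zero hc P.rep_nonzero) = P := by
    conv_rhs => rw [← P.mk_rep]
    exact (Projectivization.mk_eq_mk_iff' _ _ _ _ _).mpr ⟨c, rfl⟩
  rwa [this]

/-- The cone contains the nonzero multiples of `P.rep`. Euler's identity is not directly available
for inhomogeneous `f`; instead the increment from `P.rep` to `t • P.rep` is divided by `t - 1` and
evaluated at `t = 1`. -/
theorem rep_mem_coneTangentSpace [Infinite L] {V : Set (ℙ L (Fin (N + 1) → L))}
    {P : ℙ L (Fin (N + 1) → L)} (hP : P ∈ V) : P.rep ∈ coneTangentSpace V P.rep := by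
  classical
  intro f hf
  obtain ⟨A, hA, hA'⟩ := exists_increment f
  let q : Polynomial L := ∑ k, MvPolynomial.aeval (Sum.elim (fun i => Polynomial.C (P.rep i))
    fun i => Polynomial.X * Polynomial.C (P.rep i)) (A k) * Polynomial.C (P.rep k)
  have hq : ∀ t, q.eval t =
      ∑ k, MvPolynomial.eval (Sum.elim P.rep (t • P.rep)) (A k) * P.rep k := by
    intro t
    simp only [q, Polynomial.eval_finsetSum, Polynomial.eval_mul, Polynomial.eval_C]
    refine Finset.sum_congr rfl fun k _ => ?_
    rw [← Polynomial.coe_aeval_eq_eval, MvPolynomial.comp_aeval_apply]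
    congr 1
    refine congrArg (fun z => MvPolynomial.eval z (A k)) (funext fun i => ?_)
    cases i
    · simp
    · simp only [Sum.elim_inr, map_mul, Polynomial.aeval_X, Polynomial.aeval_C, Pi.smul_apply,
        smul_eq_mul, Algebra.algebraMap_self_apply]
  have hq0 : q = 0 := by
    refine Polynomial.eq_zero_of_infinite_isRoot q ((Set.toFinite ({0, 1} : Set L)).infinite_compl.mono ?_)
    intro t ht
    simp only [Set.mem_compl_iff, Set.mem_insert_iff, Set.mem_singleton_iff, not_or] at ht
    change q.eval t = 0
    rw [hq]
    have h1 := hA P.rep (t • P.rep)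
    have h2 := eval_smul_rep_eq_zero hP hf one_ne_zero
    rw [one_smul] at h2
    rw [eval_smul_rep_eq_zero hP hf ht.1, h2, sub_zero] at h1
    refine (mul_eq_zero.mp (?_ : (t - 1) * _ = 0)).resolve_left (sub_ne_zero.mpr ht.2)
    rw [h1, Finset.mul_sum]
    refine Finset.sum_congr rfl fun k _ => ?_
    simp only [Pi.smul_apply, smul_eq_mul]
    ring
  have h1 := hq 1
  rw [hq0, Polynomial.eval_zero, one_smul] at h1
  rw [h1]
  exact Finset.sum_congr rfl fun k _ => by rw [hA']

/-- The linear forms on the ambient space, modulo the differentials of the equations of a variety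
at a point, are spanned by as many forms as the dimension of the tangent space, one of which may
be chosen not to vanish at a given tangent vector. -/
theorem exists_dual_coordinates {V : Set (ℙ L (Fin (N + 1) → L))} {v w : Fin (N + 1) → L}
    (hw : w ∈ coneTangentSpace V v) (hw0 : w ≠ 0)
    (hm : Module.finrank L (coneTangentSpace V v) = m + 1) :
    ∃ (l : Module.Dual L (Fin (N + 1) → L)) (ℓ : Fin m → Module.Dual L (Fin (N + 1) → L)),
      l w = 1 ∧ ∀ i, ∃ f ∈ idealOf V, ∃ (c : L) (d : Fin m → L), ∀ z : Fin (N + 1) → L,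
        z i = ∑ j, MvPolynomial.eval v (MvPolynomial.pderiv j f) * z j + c * l z +
          ∑ k, d k * ℓ k z := by
  let grad : MvPolynomial (Fin (N + 1)) L →ₗ[L] Module.Dual L (Fin (N + 1) → L) :=
    ∑ j, ((LinearMap.lsmul L _).flip (LinearMap.proj j : (Fin (N + 1) → L) →ₗ[L] L)).comp
      ((MvPolynomial.aeval v).toLinearMap.comp (MvPolynomial.pderiv j).toLinearMap)
  have hgrad : ∀ f z, grad f z = ∑ j, MvPolynomial.eval v (MvPolynomial.pderiv j f) * z j := by
    intro f z
    simp [grad, LinearMap.sum_apply, MvPolynomial.aeval_eq_eval]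
  let D : Submodule L (Module.Dual L (Fin (N + 1) → L)) :=
    ((idealOf V).restrictScalars L).map grad
  have hD : D.dualCoannihilator = coneTangentSpace V v := by
    ext z
    rw [Submodule.mem_dualCoannihilator]
    constructor
    · intro h f hf
      rw [← hgrad]
      exact h _ ⟨f, hf, rfl⟩
    · rintro h _ ⟨f, hf, rfl⟩
      rw [hgrad]
      exact h f hf
  have hD' : (coneTangentSpace V v).dualAnnihilator = D := by
    rw [← hD, Subspace.dualCoannihilator_dualAnnihilator_eq]
  let b := Module.finBasisOfFinrankEq L (coneTangentSpace V v) hm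
  obtain ⟨j, hj⟩ : ∃ j, b.coord j ⟨w, hw⟩ ≠ 0 := by
    by_contra! h
    have := (b.forall_coord_eq_zero_iff).mp h
    exact hw0 (congrArg Subtype.val this)
  choose e he using fun k => LinearMap.exists_extend (b.coord k)
  have he' : ∀ k (z : coneTangentSpace V v), e k z = b.coord k z := fun k z => by
    rw [← he k]; rfl
  refine ⟨(b.coord j ⟨w, hw⟩)⁻¹ • e j, fun k => e (j.succAbove k), ?_, fun i => ?_⟩
  · rw [LinearMap.smul_apply, he' j ⟨w, hw⟩, smul_eq_mul, inv_mul_cancel₀ hj]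
  · have h1 : (LinearMap.proj i : (Fin (N + 1) → L) →ₗ[L] L) -
        ∑ k, (b k : Fin (N + 1) → L) i • e k ∈ D := by
      rw [← hD', Submodule.mem_dualAnnihilator]
      intro z hz
      have h2 := congrArg (fun z : coneTangentSpace V v => (z : Fin (N + 1) → L) i)
        (b.sum_repr ⟨z, hz⟩)
      simp only [Submodule.coe_sum, Submodule.coe_smul, Finset.sum_apply, Pi.smul_apply,
        smul_eq_mul] at h2
      rw [LinearMap.sub_apply, LinearMap.proj_apply, ← h2, LinearMap.sum_apply, sub_eq_zero]
      refine Finset.sum_congr rfl fun k _ => ?_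
      rw [LinearMap.smul_apply, he' k ⟨z, hz⟩, smul_eq_mul, mul_comm]
      rfl
    obtain ⟨f, hf, hfe⟩ := h1
    refine ⟨f, hf, (b j : Fin (N + 1) → L) i * b.coord j ⟨w, hw⟩,
      fun k => (b (j.succAbove k) : Fin (N + 1) → L) i, fun z => ?_⟩
    have h2 := congrArg (fun φ : Module.Dual L (Fin (N + 1) → L) => φ z) hfe
    simp only [hgrad, LinearMap.sub_apply, LinearMap.add_apply, LinearMap.sum_apply,
      LinearMap.smul_apply, LinearMap.proj_apply, smul_eq_mul, Fin.sum_univ_succAbove _ j] at h2 ⊢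
    rw [h2]
    field_simp
    ring

/-- The linear form `l` in the `i`-th group of variables. -/
def linearForm (l : Module.Dual L (Fin (N + 1) → L)) (i : Fin n) :
    MvPolynomial (Fin n × Fin (N + 1)) L :=
  ∑ j, MvPolynomial.C (l (Pi.single j 1)) * MvPolynomial.X (i, j)

theorem eval_linearForm (l : Module.Dual L (Fin (N + 1) → L)) (i : Fin n)
    (w : Fin n × Fin (N + 1) → L) :
    MvPolynomial.eval w (linearForm l i) = l fun j => w (i, j) := by
  rw [LinearMap.pi_apply_eq_sum_univ l fun j => w (i, j)]
  simp only [linearForm, map_sum, map_mul, MvPolynomial.eval_C, MvPolynomial.eval_X, smul_eq_mul]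
  refine Finset.sum_congr rfl fun j _ => ?_
  rw [mul_comm]
  congr 2
  ext k
  simp [Pi.single_apply, eq_comm]

theorem isMultihomogeneous_linearForm (l : Module.Dual L (Fin (N + 1) → L)) (i : Fin n) :
    IsMultihomogeneous (linearForm l i) (Pi.single i 1) := by
  refine MvPolynomial.IsWeightedHomogeneous.sum _ _ _ fun j _ => ?_
  have h := (MvPolynomial.isWeightedHomogeneous_X L
    (fun p : Fin n × Fin (N + 1) => (Pi.single p.1 1 : Fin n → ℕ)) (i, j)).C_mul
    (l (Pi.single j 1))
  exact h

/-- Near the point `(P, P)`, where `H` does not vanish, the diagonal of a smooth variety of dimension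
`m` is cut out by `m` equations. -/
theorem exists_local_equations [Infinite L] {V : Set (ℙ L (Fin (N + 1) → L))}
    {P : ℙ L (Fin (N + 1) → L)} (hP : P ∈ V)
    (hm : Module.finrank L (coneTangentSpace V P.rep) = m + 1) :
    ∃ (G : Fin m → MvPolynomial (Fin 2 × Fin (N + 1)) L) (H : MvPolynomial (Fin 2 × Fin (N + 1)) L),
      (∀ k, ∃ d, IsMultihomogeneous (G k) d) ∧
      (∀ k (z : Fin (N + 1) → L), MvPolynomial.eval (fun p => z p.2) (G k) = 0) ∧
      MvPolynomial.eval (fun p => P.rep p.2) H ≠ 0 ∧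
      ∀ (x : Fin 2 → ℙ L (Fin (N + 1) → L)) w, IsRep w x → (∀ i, x i ∈ V) →
        (∀ k, MvPolynomial.eval w (G k) = 0) → MvPolynomial.eval w H ≠ 0 → x 0 = x 1 := by
  classical
  obtain ⟨l, ℓ, hl, h⟩ := exists_dual_coordinates (rep_mem_coneTangentSpace hP) P.rep_nonzero hm
  choose f hf c d hz using h
  choose A hA hA' using fun i => exists_increment (f i)
  -- The two vectors are rescaled to have the same value under `l`, which makes them comparable
  -- independently of representatives.
  let X' : Fin (N + 1) ⊕ Fin (N + 1) → MvPolynomial (Fin 2 × Fin (N + 1)) L :=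
    Sum.elim (fun j => linearForm l 1 * MvPolynomial.X (0, j))
      fun j => linearForm l 0 * MvPolynomial.X (1, j)
  -- Row `i` combines the increment of `f i` with its correction by `l` and the `ℓ k`. At `(P, P)`
  -- it is the differential expression for the coordinate `z_i`, so `R` becomes the identity there.
  let R : Matrix (Fin (N + 1)) (Fin (N + 1)) (MvPolynomial (Fin 2 × Fin (N + 1)) L) :=
    Matrix.of fun i j => MvPolynomial.aeval X' (A i j) +
      MvPolynomial.C (c i * l (Pi.single j 1) + ∑ k, d i k * ℓ k (Pi.single j 1))
  have hX' : ∀ (w : Fin 2 × Fin (N + 1) → L) g, MvPolynomial.eval w (MvPolynomial.aeval X' g) =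
      MvPolynomial.eval (Sum.elim ((l fun j => w (1, j)) • fun j => w (0, j))
        ((l fun j => w (0, j)) • fun j => w (1, j))) g := by
    intro w g
    rw [← MvPolynomial.coe_aeval_eq_eval, RingHom.coe_coe, MvPolynomial.comp_aeval_apply]
    refine congrArg (fun z => MvPolynomial.eval z g) (funext fun i => ?_)
    cases i <;> simp [X', MvPolynomial.aeval_eq_eval, eval_linearForm]
  have hsum : ∀ (φ : Module.Dual L (Fin (N + 1) → L)) z, ∑ j, φ (Pi.single j 1) * z j = φ z := by
    intro φ z
    have := eval_linearForm (n := 1) φ 0 fun p => z p.2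
    simpa [linearForm] using this
  refine ⟨fun k => linearForm (ℓ k) 0 * linearForm l 1 - linearForm l 0 * linearForm (ℓ k) 1,
    linearForm l 0 * linearForm l 1 * R.det, fun k => ⟨Pi.single 0 1 + Pi.single 1 1, ?_⟩, ?_, ?_, ?_⟩
  · exact ((isMultihomogeneous_linearForm (ℓ k) 0).mul (isMultihomogeneous_linearForm l 1)).sub
      ((isMultihomogeneous_linearForm l 0).mul (isMultihomogeneous_linearForm (ℓ k) 1))
  · intro k z
    simp only [map_sub, map_mul, eval_linearForm]
    ring
  · have hdet : (MvPolynomial.eval fun p : Fin 2 × Fin (N + 1) => P.rep p.2).mapMatrix R = 1 := by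
      ext i j
      have h1 := hz i (Pi.single j 1)
      simp only [RingHom.mapMatrix_apply, Matrix.map_apply, R, Matrix.of_apply, map_add, hX',
        MvPolynomial.eval_C, hl, one_smul, hA', Matrix.one_apply]
      rw [Finset.sum_eq_single j (fun k _ hk => by simp [hk]) (by simp), Pi.single_eq_same,
        mul_one, Pi.single_apply] at h1
      rw [h1]
      ring
    rw [map_mul, map_mul, eval_linearForm, eval_linearForm, hl, RingHom.map_det, hdet,
      Matrix.det_one]
    simp
  · intro x w hw hx hG hH
    rw [map_mul, map_mul, RingHom.map_det, eval_linearForm, eval_linearForm] at hH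
    simp only [map_sub, map_mul, eval_linearForm] at hG
    set y₀ : Fin (N + 1) → L := fun j => w (0, j) with hy₀
    set y₁ : Fin (N + 1) → L := fun j => w (1, j) with hy₁
    have hl0 : l y₀ ≠ 0 := fun h => hH (by rw [h]; ring)
    have hl1 : l y₁ ≠ 0 := fun h => hH (by rw [h]; ring)
    have hdet := right_ne_zero_of_mul hH
    obtain ⟨t, ht⟩ := hw
    have hf0 : ∀ i, MvPolynomial.eval (l y₁ • y₀) (f i) = 0 := by
      intro i
      have h1 : l y₁ • y₀ = (l y₁ * t 0) • (x 0).rep := by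
        ext j; simp [hy₀, ht, mul_assoc]
      rw [h1]
      exact eval_smul_rep_eq_zero (hx 0) (hf i) (mul_ne_zero hl1 (t 0).ne_zero)
    have hf1 : ∀ i, MvPolynomial.eval (l y₀ • y₁) (f i) = 0 := by
      intro i
      have h1 : l y₀ • y₁ = (l y₀ * t 1) • (x 1).rep := by
        ext j; simp [hy₁, ht, mul_assoc]
      rw [h1]
      exact eval_smul_rep_eq_zero (hx 1) (hf i) (mul_ne_zero hl0 (t 1).ne_zero)
    -- Each part of `R` kills the difference of the rescaled vectors: both lie in the zero locus of
    -- the `f i`, they agree under `l`, and the equations `G` make them agree under every `ℓ k`.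
    have hmul : ((MvPolynomial.eval w).mapMatrix R).mulVec (l y₀ • y₁ - l y₁ • y₀) = 0 := by
      ext i
      have h1 := hA i (l y₁ • y₀) (l y₀ • y₁)
      rw [hf0, hf1, sub_zero] at h1
      simp only [Matrix.mulVec, dotProduct, RingHom.mapMatrix_apply, Matrix.map_apply, R,
        Matrix.of_apply, map_add, hX', MvPolynomial.eval_C, add_mul, Finset.sum_add_distrib,
        Pi.zero_apply]
      rw [← hy₀, ← hy₁]
      simp only [Pi.sub_apply] at h1 ⊢
      rw [← h1, zero_add]
      have h2 : ∀ φ : Module.Dual L (Fin (N + 1) → L),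
          ∑ j, φ (Pi.single j 1) * ((l y₀ • y₁) j - (l y₁ • y₀) j) = l y₀ * φ y₁ - l y₁ * φ y₀ := by
        intro φ
        have := hsum φ (l y₀ • y₁ - l y₁ • y₀)
        rw [map_sub, map_smul, map_smul] at this
        exact this
      simp only [mul_assoc, Finset.sum_mul]
      rw [← Finset.mul_sum, h2, Finset.sum_comm]
      simp only [← Finset.mul_sum, h2]
      rw [Finset.sum_eq_zero fun k _ => by
        rw [show l y₀ * ℓ k y₁ - l y₁ * ℓ k y₀ = 0 by linear_combination - hG k, mul_zero]]
      ring
    have heq := sub_eq_zero.mp (Matrix.eq_zero_of_mulVec_eq_zero hdet hmul)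
    refine (IsRep.eq_iff ⟨t, ht⟩).mpr fun j j' => ?_
    have h1 := congrFun heq j
    have h2 := congrFun heq j'
    simp only [Pi.smul_apply, smul_eq_mul, hy₀, hy₁] at h1 h2
    refine mul_left_cancel₀ hl1 ?_
    linear_combination - w (1, j') * h1 + w (1, j) * h2

end LocalEquations

/-! ## Intersections in powers of a smooth variety -/

section Presmooth

universe u

variable {L : Type u} [Field L] {N n m : ℕ}

attribute [local instance] zariskiTopology

theorem isEmbedding_append_self [Infinite L] :
    Topology.IsEmbedding (fun x : Fin n → ℙ L (Fin (N + 1) → L) => Fin.append x x) := by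
  have h : (fun x : Fin n → ℙ L (Fin (N + 1) → L) => Fin.append x x) =
      fun x i => x (Fin.append id id i) := by
    ext x i
    induction i using Fin.addCases <;> simp only [Fin.append_left, Fin.append_right, id]
  have hc : Continuous fun x : Fin n → ℙ L (Fin (N + 1) → L) => Fin.append x x := by
    rw [h]; exact continuous_comp _
  exact Function.LeftInverse.isEmbedding (f := fstProj n n) (fun x => fstProj_append x x)
    continuous_fstProj hc

variable [IsAlgClosed L]

/-- Reduction to the diagonal: near `(p, p)`, with `p ∈ W`, the diagonal is cut out in `V^n × V^n`
by `n * m` equations. A component of the section of `C₁ × C₂` containing the diagonal copy of `W` is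
shown to lie in the diagonal, and maximality of `W` bounds it. -/
theorem dim_add_dim_le_of_isComponent {V : Set (ℙ L (Fin (N + 1) → L))}
    (hV : ∀ P ∈ V, Module.finrank L (coneTangentSpace V P.rep) = m + 1)
    {C₁ C₂ W : Set (Fin n → ℙ L (Fin (N + 1) → L))} (h₁ : IsClosed C₁) (h₁i : IsIrreducible C₁)
    (h₁V : ∀ x ∈ C₁, ∀ i, x i ∈ V) (h₂ : IsClosed C₂) (h₂i : IsIrreducible C₂)
    (h₂V : ∀ x ∈ C₂, ∀ i, x i ∈ V) (hW : IsComponent W (C₁ ∩ C₂)) :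
    dim C₁ + dim C₂ ≤ dim W + (n * m : ℕ) := by
  obtain ⟨⟨hWc, hWi, hWC⟩, hWmax⟩ := hW
  obtain ⟨p, hp⟩ := hWi.nonempty
  choose G H hG hGd hHp hGH using fun i => exists_local_equations (h₁V p (hWC hp).1 i)
    (hV _ (h₁V p (hWC hp).1 i))
  let φ : Fin n → Fin 2 → Fin (n + n) := fun i => ![Fin.castAdd n i, Fin.natAdd n i]
  obtain ⟨F, hF, hFG⟩ : ∃ F : Fin (n * m) → MvPolynomial (Fin (n + n) × Fin (N + 1)) L,
      (∀ k, ∃ d, IsMultihomogeneous (F k) d) ∧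
      ∀ i k, F (finProdFinEquiv (i, k)) =
        MvPolynomial.rename (fun p => (φ i p.1, p.2)) (G i k) := by
    refine ⟨fun k => MvPolynomial.rename
      (fun p => (φ (finProdFinEquiv.symm k).1 p.1, p.2)) (G (finProdFinEquiv.symm k).1
        (finProdFinEquiv.symm k).2), fun k => ?_, fun i k => ?_⟩
    · obtain ⟨d, hd⟩ := hG (finProdFinEquiv.symm k).1 (finProdFinEquiv.symm k).2
      exact hd.rename _
    · simp only [Equiv.symm_apply_apply]
  have hδ := isEmbedding_append_self (L := L) (N := N) (n := n)
  have hC := isClosed_prod_tuple h₁ h₂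
  have hCi := isIrreducible_prod h₁i h₂i
  have hdiag : ∀ x : Fin n → ℙ L (Fin (N + 1) → L), IsRep (appendVec (repVec x) (repVec x))
      (Fin.append x x) := fun x => (isRep_repVec x).append (isRep_repVec x)
  have hφ : ∀ (x : Fin n → ℙ L (Fin (N + 1) → L)) i,
      (fun p : Fin 2 × Fin (N + 1) => appendVec (repVec x) (repVec x) (φ i p.1, p.2)) =
        fun p => (x i).rep p.2 := by
    intro x i
    ext ⟨k, j⟩
    fin_cases k
    · simp [φ, appendVec, repVec]
    · exact Fin.addCases_right (motive := fun _ => L) i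
  obtain ⟨W', hW', hW'i, hWW', hW'C, hW'F, hdim⟩ := exists_component_dim_le hC hCi
    (hWi.image _ hδ.continuous.continuousOn)
    (by
      rintro _ ⟨x, hx, rfl⟩
      simp only [Set.mem_ofPred_eq, fstProj_append, sndProj_append]
      exact hWC hx) F hF
    (by
      rintro k _ ⟨x, hx, rfl⟩
      obtain ⟨⟨i, k⟩, rfl⟩ := finProdFinEquiv.surjective k
      obtain ⟨d, hd⟩ := hF (finProdFinEquiv (i, k))
      rw [mem_hypersurface hd (hdiag x), hFG, MvPolynomial.eval_rename]
      exact (congrArg (fun z => MvPolynomial.eval z (G i k)) (hφ x i)).trans (hGd i k _))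
  have hprime := coneIdeal_isPrime hW'i
  have hW'd : ∀ x ∈ W', fstProj n n x = sndProj n n x := by
    -- The local equations give the diagonal only where `H i ≠ 0`. Primeness removes this
    -- restriction: `H i` times each minor lies in the ideal of `W'`, while `H i` does not, being
    -- nonzero at `(p, p)`.
    have hmem : ∀ i j j', MvPolynomial.X (Fin.castAdd n i, j) * MvPolynomial.X (Fin.natAdd n i, j') -
        MvPolynomial.X (Fin.castAdd n i, j') * MvPolynomial.X (Fin.natAdd n i, j) ∈
          coneIdeal W' := by
      intro i j j'
      refine (hprime.mem_or_mem (x := MvPolynomial.rename (fun p => (φ i p.1, p.2)) (H i))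
        (mem_coneIdeal.mpr fun x hx w hw => ?_)).resolve_left fun h => ?_
      · rw [map_mul]
        by_cases h0 : MvPolynomial.eval w (MvPolynomial.rename (fun p => (φ i p.1, p.2)) (H i)) = 0
        · rw [h0, zero_mul]
        · rw [MvPolynomial.eval_rename] at h0
          have h1 := hGH i (fun k => x (φ i k)) _ (hw.comp (φ i)) (by
            intro k
            fin_cases k
            · exact h₁V _ (hW'C hx).1 i
            · exact h₂V _ (hW'C hx).2 i) (fun k => by
              obtain ⟨d, hd⟩ := hF (finProdFinEquiv (i, k))
              have h2 := (mem_hypersurface hd hw).mp (hW'F (finProdFinEquiv (i, k)) hx)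
              rwa [hFG, MvPolynomial.eval_rename] at h2) h0
          have h2 := (hw.eq_iff (i := Fin.castAdd n i) (k := Fin.natAdd n i)).mp h1 j j'
          rw [map_sub, map_mul, map_mul]
          simp only [MvPolynomial.eval_X]
          rw [h2, sub_self, mul_zero]
      · have h1 := mem_coneIdeal.mp h _ (hWW' ⟨p, hp, rfl⟩) _ (hdiag p)
        rw [MvPolynomial.eval_rename] at h1
        exact hHp i ((congrArg (fun z => MvPolynomial.eval z (H i)) (hφ p i)).symm.trans h1)
    intro x hx
    ext1 i
    refine ((isRep_repVec x).eq_iff (i := Fin.castAdd n i) (k := Fin.natAdd n i)).mpr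
      fun j j' => ?_
    have h1 := mem_coneIdeal.mp (hmem i j j') x hx _ (isRep_repVec x)
    simpa [sub_eq_zero] using h1
  have hW'δ : W' ⊆ (fun x => Fin.append x x) '' (fstProj n n '' W') := by
    intro x hx
    refine ⟨_, ⟨x, hx, rfl⟩, ?_⟩
    conv_rhs => rw [← append_fstProj_sndProj x, ← hW'd x hx]
  have hpr : fstProj n n '' W' ⊆ W := by
    refine hWmax ⟨isClosedMap_fstProj W' hW', hW'i.image _ continuous_fstProj.continuousOn, ?_⟩ ?_
    · rintro _ ⟨x, hx, rfl⟩
      exact ⟨(hW'C hx).1, hW'd x hx ▸ (hW'C hx).2⟩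
    · intro x hx
      exact ⟨_, hWW' ⟨x, hx, rfl⟩, fstProj_append x x⟩
  rw [← dim_prod h₁ h₁i h₂ h₂i, ← dim_image_of_isEmbedding hδ W]
  refine hdim.trans ?_
  gcongr
  exact dim_le_dim_of_subset (hW'δ.trans (Set.image_mono hpr))

end Presmooth

/-! ## Transcendence degree of the homogeneous coordinate ring -/

section CoordinateRing

universe u

theorem trdeg_fractionRing (k A : Type u) [Field k] [CommRing A] [IsDomain A] [Algebra k A] :
    Algebra.trdeg k (FractionRing A) = Algebra.trdeg k A := by
  have : Algebra.IsAlgebraic A (FractionRing A) := IsLocalization.isAlgebraic _ (nonZeroDivisors A)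
  have h := trdeg_add_eq k A (A := FractionRing A)
  rw [← h, trdeg_eq_zero (R := A) (A := FractionRing A), add_zero]

theorem trdeg_eq_trdeg_subalgebra_add_one {k K : Type u} [Field k] [Field K] [Algebra k K]
    (F : Subalgebra k K) {ξ : K} (hξ : Transcendental F ξ)
    [Algebra.IsAlgebraic (Algebra.adjoin F {ξ}) K] :
    Algebra.trdeg k K = Algebra.trdeg k F + 1 := by
  have h1 : IsTranscendenceBasis F (fun _ : Unit => ξ) := by
    rw [isTranscendenceBasis_iff_algebraicIndependent_isAlgebraic]
    refine ⟨algebraicIndependent_unique_type_iff.mpr hξ, ?_⟩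
    rw [Set.range_const]
    infer_instance
  have h2 := trdeg_add_eq k F (A := K)
  have h3 := h1.lift_cardinalMk_eq_trdeg
  simp only [Cardinal.mk_fintype, Fintype.card_unit, Nat.cast_one, Cardinal.lift_one,
    Cardinal.lift_uzero] at h3
  rw [← h2, ← h3]

variable {L : Type u} [Field L] {N : ℕ}

theorem smul_mem_cone {V : Set (ℙ L (Fin (N + 1) → L))} {v : Fin (N + 1) → L} (hv : v ∈ cone V)
    {s : L} (hs : s ≠ 0) : s • v ∈ cone V := by
  obtain ⟨hv0, hv⟩ := hv
  refine ⟨smul_ne_zero hs hv0, ?_⟩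
  rwa [(Projectivization.mk_eq_mk_iff' L (s • v) v (smul_ne_zero hs hv0) hv0).mpr ⟨s, rfl⟩]

/-- The substitution `x ↦ s x`. -/
def scaleVars (s : L) : MvPolynomial (Fin (N + 1)) L →ₐ[L] MvPolynomial (Fin (N + 1)) L :=
  MvPolynomial.aeval fun i => MvPolynomial.C s * MvPolynomial.X i

theorem eval_scaleVars (s : L) (v : Fin (N + 1) → L) (f : MvPolynomial (Fin (N + 1)) L) :
    MvPolynomial.eval v (scaleVars s f) = MvPolynomial.eval (s • v) f := by
  rw [scaleVars, ← MvPolynomial.coe_aeval_eq_eval, RingHom.coe_coe, MvPolynomial.comp_aeval_apply]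
  refine congrArg (fun z => MvPolynomial.eval z f) (funext fun i => ?_)
  simp [MvPolynomial.aeval_eq_eval]

theorem scaleVars_mem_idealOf_iff (V : Set (ℙ L (Fin (N + 1) → L))) {s : L} (hs : s ≠ 0)
    {f : MvPolynomial (Fin (N + 1)) L} : scaleVars s f ∈ idealOf V ↔ f ∈ idealOf V := by
  simp only [idealOf, MvPolynomial.mem_vanishingIdeal_iff, MvPolynomial.aeval_eq_eval,
    eval_scaleVars]
  refine ⟨fun h v hv => ?_, fun h v hv => h _ (smul_mem_cone hv hs)⟩
  have := h _ (smul_mem_cone hv (inv_ne_zero hs))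
  rwa [smul_smul, mul_inv_cancel₀ hs, one_smul] at this

theorem scaleVars_of_isHomogeneous [Infinite L] {f : MvPolynomial (Fin (N + 1)) L} {d : ℕ}
    (hf : f.IsHomogeneous d) (s : L) : scaleVars s f = MvPolynomial.C (s ^ d) * f := by
  refine MvPolynomial.funext fun v => ?_
  rw [eval_scaleVars, eval_smul_of_isHomogeneous hf, map_mul, MvPolynomial.eval_C]

/-- The endomorphism of the fraction field of the homogeneous coordinate ring which multiplies the
coordinates by `s`. -/
theorem exists_scale_fractionRing {V : Set (ℙ L (Fin (N + 1) → L))} [(idealOf V).IsPrime] {s : L}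
    (hs : s ≠ 0) : ∃ σ : FractionRing (CoordRing V) →ₐ[L] FractionRing (CoordRing V),
      ∀ f, σ (algebraMap (CoordRing V) _ (Ideal.Quotient.mk (idealOf V) f)) =
        algebraMap (CoordRing V) _ (Ideal.Quotient.mk (idealOf V) (scaleVars s f)) := by
  let τ : CoordRing V →ₐ[L] CoordRing V := Ideal.Quotient.liftₐ (idealOf V)
    ((Ideal.Quotient.mkₐ L (idealOf V)).comp (scaleVars s)) fun f hf =>
      Ideal.Quotient.eq_zero_iff_mem.mpr ((scaleVars_mem_idealOf_iff V hs).mpr hf)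
  have hτ : Function.Injective τ := by
    rw [injective_iff_map_eq_zero]
    intro f hf
    obtain ⟨f, rfl⟩ := Ideal.Quotient.mk_surjective f
    exact Ideal.Quotient.eq_zero_iff_mem.mpr ((scaleVars_mem_idealOf_iff V hs).mp
      (Ideal.Quotient.eq_zero_iff_mem.mp hf))
  have hinj : Function.Injective ((IsScalarTower.toAlgHom L (CoordRing V)
      (FractionRing (CoordRing V))).comp τ) :=
    (IsFractionRing.injective (CoordRing V) (FractionRing (CoordRing V))).comp hτ
  refine ⟨IsFractionRing.liftAlgHom hinj, fun f => ?_⟩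
  rw [IsFractionRing.liftAlgHom_apply, IsFractionRing.lift_algebraMap]
  rfl

theorem exists_X_notMem_idealOf {V : Set (ℙ L (Fin (N + 1) → L))} (hV : (idealOf V).IsPrime) :
    ∃ j, MvPolynomial.X j ∉ idealOf V := by
  by_contra! h
  refine hV.ne_top ((Ideal.eq_top_iff_one _).mpr ?_)
  refine MvPolynomial.mem_vanishingIdeal_iff.mpr fun v hv => ?_
  refine absurd (funext fun j => ?_) hv.1
  simpa using MvPolynomial.mem_vanishingIdeal_iff.mp (h j) v hv

/-- Adjoining one coordinate `x_j ∉ I(V)` to the degree-zero fractions recovers every coordinate as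
`(x_i / x_j) x_j`. It is transcendental because the scalings by `s ≠ 0` fix the function field and
move `x_j` to `s x_j`, producing infinitely many roots of any relation. -/
theorem trdeg_coordRing_eq [Infinite L] {V : Set (ℙ L (Fin (N + 1) → L))}
    (hV : (idealOf V).IsPrime) :
    Algebra.trdeg L (CoordRing V) = Algebra.trdeg L (functionField V) + 1 := by
  obtain ⟨j, hj⟩ := exists_X_notMem_idealOf hV
  rw [← trdeg_fractionRing]
  let ι : MvPolynomial (Fin (N + 1)) L →ₐ[L] FractionRing (CoordRing V) :=
    (IsScalarTower.toAlgHom L (CoordRing V) _).comp (Ideal.Quotient.mkₐ L (idealOf V))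
  have hι : ∀ f, ι f = algebraMap (CoordRing V) _ (Ideal.Quotient.mk (idealOf V) f) := fun _ => rfl
  have hι0 : ∀ f, ι f = 0 ↔ f ∈ idealOf V := fun f => by
    rw [hι, ← Ideal.Quotient.eq_zero_iff_mem]
    exact map_eq_zero_iff _ (IsFractionRing.injective _ _)
  have hξ0 : ι (MvPolynomial.X j) ≠ 0 := fun h => hj ((hι0 _).mp h)
  have htr : Transcendental (functionField V) (ι (MvPolynomial.X j)) := by
    rintro ⟨p, hp, hpξ⟩
    have hp' : p.map (algebraMap (functionField V) (FractionRing (CoordRing V))) ≠ 0 := by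
      rwa [Ne, Polynomial.map_eq_zero_iff (FaithfulSMul.algebraMap_injective _ _)]
    refine hp' (Polynomial.eq_zero_of_infinite_isRoot _ ?_)
    have hinj : Set.InjOn (fun s : L => algebraMap L (FractionRing (CoordRing V)) s *
        ι (MvPolynomial.X j)) ({0}ᶜ : Set L) :=
      fun s _ t _ h => (algebraMap L (FractionRing (CoordRing V))).injective
        (mul_right_cancel₀ hξ0 h)
    refine (((Set.finite_singleton (0 : L)).infinite_compl).image hinj).mono ?_
    rintro _ ⟨s, hs, rfl⟩
    obtain ⟨σ, hσ⟩ := exists_scale_fractionRing (V := V) (s := s) hs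
    -- Numerator and denominator have the same degree and scale by the same factor.
    have hfix : ∀ z : functionField V, σ z = z := by
      rintro ⟨z, hz⟩
      induction hz using Algebra.adjoin_induction with
      | mem z hz =>
        obtain ⟨d, a, b, ha, hb, hbV, hz⟩ := hz
        have h1 := congrArg σ hz
        rw [map_mul, hσ, hσ, scaleVars_of_isHomogeneous ha, scaleVars_of_isHomogeneous hb] at h1
        simp only [← hι] at h1 hz
        rw [map_mul, map_mul, ← hz] at h1
        have hC : ι (MvPolynomial.C (s ^ d)) ≠ 0 := by
          rw [← MvPolynomial.algebraMap_eq, AlgHom.commutes]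
          exact (map_ne_zero _).mpr (pow_ne_zero _ hs)
        have hb0 : ι b ≠ 0 := fun h => hbV ((hι0 _).mp h)
        refine mul_right_cancel₀ (mul_ne_zero hC hb0) ?_
        rw [h1]
        ring
      | algebraMap r => exact σ.commutes r
      | add x y hx hy h1 h2 => exact (map_add σ x y).trans (congrArg₂ _ h1 h2)
      | mul x y hx hy h1 h2 => exact (map_mul σ x y).trans (congrArg₂ _ h1 h2)
    have h1 := congrArg σ hpξ
    rw [map_zero, Polynomial.aeval_def, ← RingHom.coe_coe σ, Polynomial.hom_eval₂, RingHom.coe_coe,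
      hι, hσ, scaleVars_of_isHomogeneous (MvPolynomial.isHomogeneous_X L j), ← hι, map_mul,
      pow_one, ← MvPolynomial.algebraMap_eq, AlgHom.commutes,
      show (σ : _ →+* FractionRing (CoordRing V)).comp
        (algebraMap (functionField V) (FractionRing (CoordRing V))) = algebraMap _ _ from
        RingHom.ext hfix] at h1
    change Polynomial.eval _ _ = 0
    rw [Polynomial.eval_map]
    exact h1
  have hmem : ∀ f, ι f ∈ Algebra.adjoin (functionField V) {ι (MvPolynomial.X j)} := by
    intro f
    induction f using MvPolynomial.induction_on with
    | C a =>
      rw [← MvPolynomial.algebraMap_eq, AlgHom.commutes]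
      exact Subalgebra.algebraMap_mem _ (algebraMap L (functionField V) a)
    | add f g hf hg => rw [map_add]; exact add_mem hf hg
    | mul_X f i hf =>
      rw [map_mul]
      refine mul_mem hf ?_
      have h1 : ι (MvPolynomial.X i) / ι (MvPolynomial.X j) ∈ functionField V :=
        Algebra.subset_adjoin ⟨1, MvPolynomial.X i, MvPolynomial.X j,
          MvPolynomial.isHomogeneous_X L i, MvPolynomial.isHomogeneous_X L j, hj,
          div_mul_cancel₀ _ hξ0⟩
      have h2 := mul_mem (Subalgebra.algebraMap_mem
        (Algebra.adjoin (functionField V) {ι (MvPolynomial.X j)}) (⟨_, h1⟩ : functionField V))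
        (Algebra.subset_adjoin (Set.mem_singleton _))
      have h3 : algebraMap (functionField V) (FractionRing (CoordRing V)) ⟨_, h1⟩ *
        ι (MvPolynomial.X j) = ι (MvPolynomial.X i) := div_mul_cancel₀ (ι (MvPolynomial.X i)) hξ0
      rwa [h3] at h2
  have halg : Algebra.IsAlgebraic (Algebra.adjoin (functionField V) {ι (MvPolynomial.X j)})
      (FractionRing (CoordRing V)) := by
    refine ⟨fun z => ?_⟩
    obtain ⟨a, b, hb, rfl⟩ := IsFractionRing.div_surjective (A := CoordRing V) z
    obtain ⟨a, rfl⟩ := Ideal.Quotient.mk_surjective a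
    obtain ⟨b, rfl⟩ := Ideal.Quotient.mk_surjective b
    rw [← hι, ← hι, div_eq_mul_inv]
    exact (isAlgebraic_algebraMap (⟨_, hmem a⟩ : Algebra.adjoin (functionField V) _)).mul
      (isAlgebraic_algebraMap (⟨_, hmem b⟩ : Algebra.adjoin (functionField V) _)).inv
  exact trdeg_eq_trdeg_subalgebra_add_one (functionField V) htr

end CoordinateRing

/-! ## Powers of a projective variety -/

section Powers

universe u

variable {L : Type u} [Field L] {N n m : ℕ}

attribute [local instance] zariskiTopology

/-- The power `V^n` as a subset of the power of projective space. -/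
def powerSet (V : Set (ℙ L (Fin (N + 1) → L))) (n : ℕ) : Set (Fin n → ℙ L (Fin (N + 1) → L)) :=
  {x | ∀ i, x i ∈ V}

theorem isClosed_powerSet [Infinite L] {V : Set (ℙ L (Fin (N + 1) → L))}
    (hV : ∃ S : Set (MvPolynomial (Fin (N + 1)) L), (∀ f ∈ S, ∃ d : ℕ, f.IsHomogeneous d) ∧
      V = {P | ∀ f ∈ S, MvPolynomial.eval P.rep f = 0}) (n : ℕ) : IsClosed (powerSet V n) := by
  obtain ⟨S, hS, rfl⟩ := hV
  refine isClosed_of_forall_isRep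
    {g | ∃ i : Fin n, ∃ f ∈ S, g = MvPolynomial.rename (fun j => (i, j)) f} fun x v hv => ?_
  obtain ⟨t, ht⟩ := hv
  have key : ∀ i, ∀ f ∈ S, MvPolynomial.eval v (MvPolynomial.rename (fun j => (i, j)) f) = 0 ↔
      MvPolynomial.eval (x i).rep f = 0 := by
    intro i f hf
    obtain ⟨d, hd⟩ := hS f hf
    rw [MvPolynomial.eval_rename, show (v ∘ fun j => (i, j)) = (t i : L) • (x i).rep from
      funext fun j => ht (i, j), eval_smul_of_isHomogeneous hd,
      mul_eq_zero_iff_left (pow_ne_zero _ (t i).ne_zero)]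
  constructor
  · rintro h _ ⟨i, f, hf, rfl⟩
    exact (key i f hf).mpr (h i f hf)
  · intro h i f hf
    exact (key i f hf).mp (h _ ⟨i, f, hf, rfl⟩)

theorem coneIdeal_powerSet_one (V : Set (ℙ L (Fin (N + 1) → L))) :
    coneIdeal (powerSet V 1) = (idealOf V).comap
      (MvPolynomial.renameEquiv L (Equiv.uniqueProd (Fin (N + 1)) (Fin 1))) := by
  ext f
  rw [mem_coneIdeal, Ideal.mem_comap, idealOf, MvPolynomial.mem_vanishingIdeal_iff]
  simp only [MvPolynomial.renameEquiv_apply, MvPolynomial.aeval_eq_eval, MvPolynomial.eval_rename]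
  constructor
  · rintro h v ⟨hv0, hv⟩
    obtain ⟨a, ha⟩ := Projectivization.exists_smul_eq_mk_rep L v hv0
    refine h (fun _ => Projectivization.mk L v hv0) (fun _ => hv) _ ⟨fun _ => a⁻¹, fun p => ?_⟩
    rw [← ha]
    simp [Units.smul_def]
  · rintro h x hx v ⟨t, ht⟩
    have h1 : v = ((t 0 : L) • (x 0).rep) ∘ Equiv.uniqueProd (Fin (N + 1)) (Fin 1) := by
      ext ⟨i, j⟩
      obtain rfl := Subsingleton.elim i 0
      exact ht (0, j)
    have h2 : (x 0).rep ∈ cone V := ⟨(x 0).rep_nonzero, by rw [Projectivization.mk_rep]; exact hx 0⟩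
    rw [h1]
    exact h _ (smul_mem_cone h2 (t 0).ne_zero)

variable [IsAlgClosed L]

theorem isIrreducible_powerSet_one {V : Set (ℙ L (Fin (N + 1) → L))}
    (hV : IsSmoothProjectiveVariety V m) : IsIrreducible (powerSet V 1) := by
  have := hV.irreducible
  refine isIrreducible_of_coneIdeal_isPrime (isClosed_powerSet hV.algebraic 1) ?_ ?_
  · by_contra! h
    refine this.ne_top ((Ideal.eq_top_iff_one _).mpr
      (MvPolynomial.mem_vanishingIdeal_iff.mpr fun v hv => ?_))
    exact absurd (show (fun _ => Projectivization.mk L v hv.1) ∈ powerSet V 1 from fun _ => hv.2)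
      (h ▸ Set.notMem_empty _)
  · rw [coneIdeal_powerSet_one]
    exact Ideal.comap_isPrime _ _

/-- The multicone of `V^1` is the affine cone over `V`; its extra dimension over `V` matches the
extra one in `trdeg_coordRing_eq`. -/
theorem dim_powerSet_one {V : Set (ℙ L (Fin (N + 1) → L))}
    (hV : IsSmoothProjectiveVariety V m) : dim (powerSet V 1) = m := by
  obtain ⟨k, hk, h⟩ := exists_natCast_eq_dim (isClosed_powerSet hV.algebraic 1)
    (isIrreducible_powerSet_one hV)
  have hprime := coneIdeal_isPrime (isIrreducible_powerSet_one hV)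
  have h1 := natCast_ringDim (coneIdeal (powerSet V 1))
  have h2 := (Ideal.quotientEquivAlg (coneIdeal (powerSet V 1)) (idealOf V)
    (MvPolynomial.renameEquiv L (Equiv.uniqueProd (Fin (N + 1)) (Fin 1))) (by
      rw [coneIdeal_powerSet_one]
      exact (Ideal.map_comap_of_surjective _ (AlgEquiv.surjective _) _).symm)).trdeg_eq
  rw [h2, trdeg_coordRing_eq hV.irreducible, hV.trdeg_eq, h] at h1
  have h3 : k + 1 = m + 1 := by exact_mod_cast h1
  rw [hk, Nat.succ_injective h3]

/-- Induction through `V^(n+1) = V^n × V`. The value `n * m` is exactly the number of local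
equations of the diagonal used for pre-smoothness. -/
theorem isIrreducible_powerSet_and_dim {V : Set (ℙ L (Fin (N + 1) → L))}
    (hV : IsSmoothProjectiveVariety V m) (n : ℕ) :
    IsIrreducible (powerSet V n) ∧ dim (powerSet V n) = (n * m : ℕ) := by
  induction n with
  | zero =>
    have h : powerSet V 0 = {Fin.elim0} := by
      ext x
      simp [powerSet, Subsingleton.elim x Fin.elim0]
    rw [h]
    exact ⟨isIrreducible_singleton, by simp [dim_singleton]⟩
  | succ n ih =>
    have h : powerSet V (n + 1) =
        {x | fstProj n 1 x ∈ powerSet V n ∧ sndProj n 1 x ∈ powerSet V 1} := by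
      ext x
      exact Fin.forall_fin_add fun i => x i ∈ V
    rw [h]
    refine ⟨isIrreducible_prod ih.1 (isIrreducible_powerSet_one hV), ?_⟩
    rw [dim_prod (isClosed_powerSet hV.algebraic n) ih.1 (isClosed_powerSet hV.algebraic 1)
      (isIrreducible_powerSet_one hV), ih.2, dim_powerSet_one hV]
    push_cast
    ring

end Powers

/-! ### Comparison of powers of `V` with their images in powers of projective space. -/

section Transfer

universe u

variable {L : Type u} [Field L] {N n m r : ℕ}

attribute [local instance] zariskiTopology powerTopology

/-- The inclusion of `V^n` in the power of projective space. -/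
def inclusion (V : Set (ℙ L (Fin (N + 1) → L))) (n : ℕ) (x : Fin n → V) :
    Fin n → ℙ L (Fin (N + 1) → L) :=
  fun i => x i

variable {V : Set (ℙ L (Fin (N + 1) → L))}

theorem inclusion_injective : Function.Injective (inclusion V n) := fun _ _ h =>
  funext fun i => Subtype.ext (congrFun h i)

theorem range_inclusion : Set.range (inclusion V n) = powerSet V n := by
  ext x
  exact ⟨by rintro ⟨y, rfl⟩ i; exact (y i).2, fun h => ⟨fun i => ⟨x i, h i⟩, rfl⟩⟩

theorem isEmbedding_inclusion : Topology.IsEmbedding (inclusion V n) :=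
  ⟨⟨rfl⟩, inclusion_injective⟩

theorem isIrreducible_image_inclusion_iff {C : Set (Fin n → V)} :
    IsIrreducible (inclusion V n '' C) ↔ IsIrreducible C :=
  isIrreducible_image_iff_of_isInducing isEmbedding_inclusion.isInducing

theorem dim_image_inclusion (C : Set (Fin n → V)) : dim (inclusion V n '' C) = dim C :=
  dim_image_of_isEmbedding isEmbedding_inclusion C

theorem image_univ_inclusion : inclusion V n '' Set.univ = powerSet V n := by
  rw [Set.image_univ, range_inclusion]

theorem inclusion_append (a : Fin n → V) (b : Fin r → V) :
    inclusion V (n + r) (Fin.append a b) = Fin.append (inclusion V n a) (inclusion V r b) := by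
  ext1 i
  induction i using Fin.addCases <;> simp only [inclusion, Fin.append_left, Fin.append_right]

theorem fibre_image_inclusion (C : Set (Fin (n + r) → V)) (a : Fin n → V) :
    fibre (inclusion V (n + r) '' C) (inclusion V n a) = inclusion V r '' fibre C a := by
  ext b
  constructor
  · rintro ⟨x, hx, h⟩
    rw [← append_fstProj_sndProj x, inclusion_append] at h
    have h1 := congrArg (fstProj n r) h
    have h2 := congrArg (sndProj n r) h
    rw [fstProj_append, fstProj_append] at h1
    rw [sndProj_append, sndProj_append] at h2
    refine ⟨sndProj n r x, ?_, h2⟩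
    rw [fibre, Set.mem_ofPred_eq, ← inclusion_injective h1, append_fstProj_sndProj]
    exact hx
  · rintro ⟨b, hb, rfl⟩
    exact ⟨Fin.append a b, hb, inclusion_append a b⟩

theorem fstProj_image_inclusion (C : Set (Fin (n + r) → V)) :
    fstProj n r '' (inclusion V (n + r) '' C) = inclusion V n '' (fstProj n r '' C) := by
  rw [Set.image_image, Set.image_image]
  rfl

end Transfer

/-! ## The Zariski structure on a smooth projective variety -/

section ZariskiStructure

universe u

variable {L : Type u} [Field L] [IsAlgClosed L] {N n m : ℕ} {V : Set (ℙ L (Fin (N + 1) → L))}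

attribute [local instance] zariskiTopology powerTopology

theorem isClosedEmbedding_inclusion (hV : IsSmoothProjectiveVariety V m) :
    Topology.IsClosedEmbedding (inclusion V n) :=
  ⟨isEmbedding_inclusion, by rw [range_inclusion]; exact isClosed_powerSet hV.algebraic n⟩

/-- Any competitor contained in the image of `C` is itself the image of a subset of `V^n`, and a
closed embedding preserves and reflects closedness and irreducibility. -/
theorem IsComponent.image_inclusion (hV : IsSmoothProjectiveVariety V m)
    {C W : Set (Fin n → V)} (hW : IsComponent W C) :
    IsComponent (inclusion V n '' W) (inclusion V n '' C) := by
  have he := isClosedEmbedding_inclusion (n := n) hV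
  obtain ⟨⟨hWc, hWi, hWC⟩, hmax⟩ := hW
  refine ⟨⟨he.isClosedMap W hWc, isIrreducible_image_inclusion_iff.mpr hWi, Set.image_mono hWC⟩,
    fun Z hZ hWZ => ?_⟩
  obtain ⟨hZc, hZi, hZC⟩ := hZ
  obtain ⟨Z, rfl⟩ := Set.subset_range_iff_exists_image_eq.mp
    (hZC.trans (Set.image_subset_range (inclusion V n) C))
  exact Set.image_mono (hmax ⟨he.isClosed_iff_image_isClosed.mpr hZc,
    isIrreducible_image_inclusion_iff.mp hZi, (Set.image_subset_image_iff he.injective).mp hZC⟩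
    ((Set.image_subset_image_iff he.injective).mp hWZ))

theorem isZariskiStructure (hV : IsSmoothProjectiveVariety V m) :
    IsZariskiStructure (τ := powerTopology V) V where
  isClosed_diagonal n := by
    convert (isClosed_diagonal_tuple (L := L) (N := N) (n := n)).preimage
      (isEmbedding_inclusion (V := V) (n := n + n)).continuous using 1
    ext x
    exact (inclusion_injective (V := V)).eq_iff.symm
  isClosed_singleton a := by
    rw [(isClosedEmbedding_inclusion hV).isClosed_iff_image_isClosed, Set.image_singleton]
    exact isClosed_singleton_tuple _
  isClosed_prod n k C D hC hD := by
    have hn := isClosedEmbedding_inclusion (n := n) hV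
    have hk := isClosedEmbedding_inclusion (n := k) hV
    convert (isClosed_prod_tuple (hn.isClosedMap C hC) (hk.isClosedMap D hD)).preimage
      (isEmbedding_inclusion (V := V) (n := n + k)).continuous using 1
    ext x
    exact and_congr (hn.injective.mem_set_image (a := fstProj n k x)).symm
      (hk.injective.mem_set_image (a := sndProj n k x)).symm
  continuous_proj n i := isEmbedding_inclusion.continuous_iff.mpr
    ((continuous_comp i.succAbove).comp isEmbedding_inclusion.continuous)
  isClosedMap_proj n i := fun C hC => by
    rw [(isClosedEmbedding_inclusion hV).isClosed_iff_image_isClosed]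
    convert isClosedMap_succAbove i _ ((isClosedEmbedding_inclusion hV).isClosedMap C hC) using 1
    rw [Set.image_image, Set.image_image]
    rfl
  noetherian n := by
    have := noetherianSpace_tuple (L := L) (N := N) (n := n)
    exact (isEmbedding_inclusion (V := V) (n := n)).isInducing.noetherianSpace
  dim_lt_top n C hC := by
    rw [← dim_image_inclusion]
    exact dim_tuple_lt_top ((isClosedEmbedding_inclusion hV).isClosedMap C hC)
  presmooth n C₁ C₂ h₁ h₁i h₂ h₂i _ W hW := by
    have he := isClosedEmbedding_inclusion (n := n) hV
    have hW' := hW.image_inclusion hV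
    rw [Set.image_inter he.injective] at hW'
    have hmem : ∀ C : Set (Fin n → V), ∀ x ∈ inclusion V n '' C, ∀ i, x i ∈ V := by
      rintro C _ ⟨y, -, rfl⟩ i
      exact (y i).2
    have h := dim_add_dim_le_of_isComponent hV.smooth (he.isClosedMap _ h₁)
      (isIrreducible_image_inclusion_iff.mpr h₁i) (hmem C₁) (he.isClosedMap _ h₂)
      (isIrreducible_image_inclusion_iff.mpr h₂i) (hmem C₂) hW'
    -- The number of equations is read back as `dim V^n`.
    rw [← (isIrreducible_powerSet_and_dim hV n).2, ← image_univ_inclusion] at h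
    simpa only [dim_image_inclusion] using h
  isClosed_fibre n r C hC k := by
    convert (isClosed_setOf_lt_dim_fibre
      ((isClosedEmbedding_inclusion (n := n + r) hV).isClosedMap C hC) k).preimage
      (isEmbedding_inclusion (V := V) (n := n)).continuous using 1
    ext a
    rw [Set.mem_ofPred_eq, Set.mem_preimage, Set.mem_ofPred_eq, fibre_image_inclusion,
      dim_image_inclusion]
  generic_fibre n r C hC hCi := by
    obtain ⟨d, hd, h⟩ := exists_isLeast_dim_fibre
      ((isClosedEmbedding_inclusion (n := n + r) hV).isClosedMap C hC)
      (isIrreducible_image_inclusion_iff.mpr hCi)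
    rw [fstProj_image_inclusion] at hd h
    rw [dim_image_inclusion, dim_image_inclusion] at h
    rw [Set.image_image] at hd
    simp only [fibre_image_inclusion, dim_image_inclusion] at hd
    exact ⟨d, hd, h⟩

theorem isIrreducibleZariskiStructure (hV : IsSmoothProjectiveVariety V m) :
    IsIrreducibleZariskiStructure (τ := powerTopology V) V m where
  toIsZariskiStructure := isZariskiStructure hV
  irreducible := by
    rw [← isIrreducible_image_inclusion_iff, image_univ_inclusion]
    exact isIrreducible_powerSet_one hV
  dim_eq := by
    rw [← dim_image_inclusion, image_univ_inclusion, dim_powerSet_one hV]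

end ZariskiStructure

end ZariskiGeometry

end

theorem theorem1p3 {L : Type*} [Field L] [IsAlgClosed L] {N : ℕ}
    (V : Set (Projectivization L (Fin (N + 1) → L))) (m : ℕ)
    (hV : ZariskiGeometry.IsSmoothProjectiveVariety V m) :
    ZariskiGeometry.IsIrreducibleZariskiStructure (τ := ZariskiGeometry.powerTopology V) V m := by
  exact ZariskiGeometry.isIrreducibleZariskiStructure hV
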